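/- Let $q\in\mathbb C^\times$ be not a root of unity, fix a square root $q^{1/2}$, and put $[n]=\frac{q^n-q^{-n}}{q-q^{-1}}$. Let $Q$ be a lattice generated by $\alpha_1,\dots,\alpha_l$, with a symmetric $\mathbb Z$-valued bilinear form $(\,|\,)$ such that $(\alpha_i|\alpha_i)=2$ for all $i$ (for instance, the root lattice of a Kac--Moody algebra with symmetric Cartan matrix). Let $\hat Q$ be a central extension of $Q$ by a finite cyclic group $\langle\kappa\rangle$, let $a_i\in\hat Q$ be a preimage of $\alpha_i$, and let $T$ be a complex $\hat Q$-module on which $\kappa$ acts as a primitive root of unity of order $o(\kappa)$ and $a_ia_j=(-1)^{(\alpha_i|\alpha_j)}a_ja_i$. Let $S$ be the polynomial algebra over $\mathbb C$ in $a_i(-n)$ ($1\le i\le l$, $n>0$ odd), and $V_Q=S\otimes T$. For $n>0$ odd, $a_i(-n)$ acts on $S$ by multiplication and $a_i(n)$ acts as the derivation with $a_i(n)\cdot a_j(-m)=\delta_{m,n}\frac{[(\alpha_i|\alpha_j)n]}{2n}\frac{q^n-q^{-n}}{q-q^{-1}}$. Put $$X_i^{\pm}(z)=\exp\Big(\pm\sum_{n>0\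 \mathrm{odd}}\tfrac{2q^{\mp n/2}}{[n]}a_i(-n)z^n\Big)\exp\Big(\mp\sum_{n>0\ \mathrm{odd}}\tfrac{2q^{\mp n/2}}{[n]}a_i(n)z^{-n}\Big)a_i^{\pm1}=\sum_{n\in\mathbb Z}X_i^\pm(n)z^{-n},$$ $$\Phi_i(z)=\exp\Big(2(q^{-1}-q)\sum_{n>0\ \mathrm{odd}}a_i(-n)z^n\Big),\qquad \Psi_i(z)=\exp\Big(2(q-q^{-1})\sum_{n>0\ \mathrm{odd}}a_i(n)z^{-n}\Big).$$ Let $\delta(x)=\sum_{n\in\mathbb Z}x^n$, let $G_{ij}(x)$ be the Taylor series at $x=0$ of $\frac{q^{r}x-1}{q^{r}x+1}\cdot\frac{x+q^{r}}{x-q^{r}}$ with $r=(\alpha_i|\alpha_j)$, and for an integer $n\ge0$ let $$(z-w)^n_{q^2}=z^n\,\frac{(q^{-n+1}w/z;q^2)_\infty}{(q^{n+1}w/z;q^2)_\infty}=\prod_{k=0}^{n-1}\big(z-q^{2k+1-n}w\big),\qquad (z+w)^n_{q^2}=\prod_{k=0}^{n-1}\big(z+q^{2k+1-n}w\big)$$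 (the product being the definition for all $q$). Then on $V_Q$, for all $i,j$ and with $r=(\alpha_i|\alpha_j)$, the following identities of formal series hold: \begin{gather*} [\Phi_i(z),\Phi_j(w)]=[\Psi_i(z),\Psi_j(w)]=0,\qquad \Phi_i(z)\Psi_j(w)=\Psi_j(w)\Phi_i(z)\,\frac{G_{ij}(q^{-1}z/w)}{G_{ij}(qz/w)},\\ \Phi_i(z)X_j^{\pm}(w)\Phi_i(z)^{-1}=X_j^{\pm}(w)\,G_{ij}(q^{\mp1/2}z/w)^{\pm1},\\ \Psi_i(z)X_j^{\pm}(w)\Psi_i(z)^{-1}=X_j^{\pm}(w)\,G_{ij}(q^{\mp1/2}w/z)^{\mp1},\\ [X_i^\pm(z),X_j^\pm(w)]=[X_i^+(z),X_j^-(w)]=0\quad\text{if } r=0,\\ (z+w)^{-r}_{q^2}\,[X_i^+(z),X_j^-(w)]=0\quad\text{if } r<0,\\ [X_i^+(z),X_i^-(w)]=\frac{2(q+q^{-1})}{q-q^{-1}}\Big(\Psi_i(q^{-1/2}z)\,\delta(qw/z)-\Phi_i(q^{1/2}z)\,\delta(q^{-1}w/z)\Big),\\ (z-w)^{-r-1}_{q^2}(z-q^{\pm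 r}w)(z+q^{\mp r}w)X_i^\pm(z)X_j^\pm(w)=(z-w)^{-r-1}_{q^2}(q^{\pm r}z-w)(q^{\mp r}z+w)X_j^\pm(w)X_i^\pm(z)\quad\text{if } r<0,\\ (z-q^{\pm2}w)(z+q^{\mp2}w)X_i^\pm(z)X_i^\pm(w)=(q^{\pm2}z-w)(q^{\mp2}z+w)X_i^\pm(w)X_i^\pm(z)+2(q+q^{-1})^2z^2\,\delta(-w/z)\,a_i^{\pm2}. \end{gather*} Moreover, let $U$ be the twisted quantum loop algebra attached to the matrix $((\alpha_i|\alpha_j))$: the associative unital $\mathbb C$-algebra generated by $a_{i,m}$ ($m$ odd), $x_{i,n}^\pm$ ($n\in\mathbb Z$) and central elements $c$, $\gamma^{\pm1/2}$ ($\gamma$ standing for $q^c$), subject to the relations obtained from those above by replacing $a_i(m)$ by $a_{i,m}$, $X_i^\pm(n)$ by $x_{i,n}^\pm$, the factor $a_i^{\pm2}$ in the last relation by $c$, and the power of $q$ by the same power of $\gamma$ in the arguments of $\Phi_i$, $\Psi_i$, $\delta$ and in the factors $q^{\mp1/2}$, $q^{\pm1}$ in the arguments of $G_{ij}$. If the normalization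 $a_i^2=1$ holds on $T$ for all $i$, then $a_{i,m}\mapsto a_i(m)$, $x_{i,n}^\pm\mapsto X_i^\pm(n)$, $c\mapsto1$, $\gamma^{1/2}\mapsto q^{1/2}$ defines a (level one) representation of $U$ on $V_Q$. -/

import Mathlib

open scoped TensorProduct

noncomputable section

namespace TwistedLoop

/-! ### Scalars: `q`-integers, the series `G`, the powers `(z - w)_{q²}^n` -/

/-- The `q`-integer `[n] = (q^n - q^{-n}) / (q - q^{-1})`. -/
def qInt (q : ℂ) (n : ℤ) : ℂ := (q ^ n - q ^ (-n)) / (q - q⁻¹)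

/-- Taylor series at `x = 0` of `(q^r x - 1)/(q^r x + 1) * (x + q^r)/(x - q^r)`. -/
def G (q : ℂ) (r : ℤ) : PowerSeries ℂ :=
  (PowerSeries.C (q ^ r) * PowerSeries.X - 1) * (PowerSeries.X + PowerSeries.C (q ^ r)) *
    ((PowerSeries.C (q ^ r) * PowerSeries.X + 1) * (PowerSeries.X - PowerSeries.C (q ^ r)))⁻¹

/-- `G(x)^{s}` for a sign `s = ±1`. -/
def Gpow (q : ℂ) (r : ℤ) (s : ℤˣ) : PowerSeries ℂ := if s = 1 then G q r else (G q r)⁻¹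

/-- The variable `z` of the polynomial ring `ℂ[z, w]`. -/
abbrev Z : MvPolynomial (Fin 2) ℂ := MvPolynomial.X 0

/-- The variable `w` of the polynomial ring `ℂ[z, w]`. -/
abbrev W : MvPolynomial (Fin 2) ℂ := MvPolynomial.X 1

/-- A scalar as a constant polynomial in `ℂ[z, w]`. -/
abbrev K (c : ℂ) : MvPolynomial (Fin 2) ℂ := MvPolynomial.C c

/-- The `q`-analogue in base `q²` of `(x - y)^n`, `n` a natural number:
`(x - y)_{q²}^n = x^n (1 - y/x)_{q²}^n`, where
`(1 - t)_{q²}^n = (q^{-n+1} t; q²)_∞ / (q^{n+1} t; q²)_∞ = ∏_{k < n} (1 - q^{2k+1-n} t)`;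
see `qPow_mul_pochhammer` for the last equality. -/
def qPow (q : ℂ) (n : ℕ) (x y : MvPolynomial (Fin 2) ℂ) : MvPolynomial (Fin 2) ℂ :=
  ∏ k ∈ Finset.range n, (x - K (q ^ (2 * (k : ℤ) + 1 - n)) * y)

/-- For `|q| < 1`, the value of `(z - w)_{q²}^n` at `z = 1`, `w = t` times `(q^{n+1} t; q²)_∞`
is `(q^{-n+1} t; q²)_∞`. -/
theorem qPow_mul_pochhammer (q : ℂ) (hq0 : q ≠ 0) (hq1 : ‖q‖ < 1) (n : ℕ) (t : ℂ) :
    MvPolynomial.eval ![1, t] (qPow q n Z W) *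
        ∏' k : ℕ, (1 - (q ^ 2) ^ k * (q ^ ((n : ℤ) + 1) * t)) =
      ∏' k : ℕ, (1 - (q ^ 2) ^ k * (q ^ (-(n : ℤ) + 1) * t)) := by
  have hm : ∀ b : ℂ, Multipliable fun k : ℕ => (1 - (q ^ 2) ^ k * b) := by
    intro b
    have h2 : ‖q ^ 2‖ < 1 := by
      rw [norm_pow]; exact pow_lt_one₀ (norm_nonneg _) hq1 two_ne_zero
    have hs : Summable fun k : ℕ => ‖-((q ^ 2) ^ k * b)‖ := by
      simp only [norm_neg, norm_mul, norm_pow (q ^ 2)]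
      exact (summable_geometric_of_lt_one (norm_nonneg _) h2).mul_right _
    simpa [sub_eq_add_neg] using multipliable_one_add_of_summable hs
  have hshift : ∀ k : ℕ, (1 - (q ^ 2) ^ (k + n) * (q ^ (-(n : ℤ) + 1) * t)) =
      (1 - (q ^ 2) ^ k * (q ^ ((n : ℤ) + 1) * t)) := by
    intro k
    have : (q ^ 2) ^ (k + n) * q ^ (-(n : ℤ) + 1) = (q ^ 2) ^ k * q ^ ((n : ℤ) + 1) := by
      rw [← pow_mul, ← pow_mul, ← zpow_natCast, ← zpow_natCast, ← zpow_add₀ hq0, ← zpow_add₀ hq0]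
      congr 1; push_cast; ring
    rw [← mul_assoc, this, mul_assoc]
  have key := Multipliable.prod_mul_tprod_nat_mul' (k := n)
    (f := fun k : ℕ => (1 - (q ^ 2) ^ k * (q ^ (-(n : ℤ) + 1) * t)))
    (by simpa only [hshift] using hm (q ^ ((n : ℤ) + 1) * t))
  simp only [hshift] at key
  rw [← key]
  congr 1
  simp only [qPow, map_prod]
  refine Finset.prod_congr rfl fun k _ => ?_
  have : (q ^ 2) ^ k * q ^ (-(n : ℤ) + 1) = q ^ (2 * (k : ℤ) + 1 - n) := by
    rw [← pow_mul, ← zpow_natCast, ← zpow_add₀ hq0]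
    congr 1; push_cast; ring
  rw [← mul_assoc, this]
  simp

/-! ### Formal distributions with coefficients in an algebra

A distribution `F(z)` is the function sending `a` to its coefficient at `z^a`; a distribution in
`z, w` sends `a, b` to its coefficient at `z^a w^b`. -/

section Distributions

variable {R : Type*} [Ring R] [Algebra ℂ R]

/-- `exp (∑_{n ≥ 1} s n x^n)`, for a sequence with `s 0 = 0`. -/
def expSeries (s : ℕ → R) : PowerSeries R :=
  PowerSeries.mk fun n =>
    ∑ k ∈ Finset.range (n + 1), ((k.factorial : ℂ)⁻¹) • PowerSeries.coeff n (PowerSeries.mk s ^ k)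

/-- The coefficients of a power series, indexed by all integers. -/
def zcoeff (f : PowerSeries R) (n : ℤ) : R := if 0 ≤ n then PowerSeries.coeff n.toNat f else 0

/-- `F(z) G(w)`. -/
def prodZW (F H : ℤ → R) : ℤ → ℤ → R := fun a b => F a * H b

/-- `G(w) F(z)`. -/
def prodWZ (F H : ℤ → R) : ℤ → ℤ → R := fun a b => H b * F a

/-- `[F(z), G(w)]`. -/
def comm (F H : ℤ → R) : ℤ → ℤ → R := prodZW F H - prodWZ F H

/-- Product of a polynomial in `z, w` and a distribution in `z, w`. -/
def polyMul (P : MvPolynomial (Fin 2) ℂ) (F : ℤ → ℤ → R) : ℤ → ℤ → R := fun a b =>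
  ∑ m ∈ P.support, P.coeff m • F (a - m 0) (b - m 1)

/-- The distribution `δ(-w/z) u`, where `δ(x) = ∑_{n ∈ ℤ} x^n` and `u` does not depend on
`z, w`. -/
def deltaNeg (u : R) : ℤ → ℤ → R := fun a b => if a + b = 0 then ((-1 : ℂ) ^ b) • u else 0

/-- `F(z) δ(c w/z)`, for a scalar `c`. -/
def deltaMul (c : ℂ) (F : ℤ → R) : ℤ → ℤ → R := fun a b => c ^ b • F (a + b)

/-- `F(c z)`, for a scalar `c`. -/
def dilate (c : ℂ) (F : ℤ → R) : ℤ → R := fun a => c ^ a • F a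

variable {ι : Type*}

/-- `Φ_i(z) = exp (2 (q⁻¹ - q) ∑_{n > 0 odd} a_i(-n) z^n)`, a power series in `z`. -/
def Phi (q : ℂ) (a : ι → ℤ → R) (i : ι) : PowerSeries R :=
  expSeries fun n => if Odd n then (2 * (q⁻¹ - q)) • a i (-(n : ℤ)) else 0

/-- `Ψ_i(z) = exp (2 (q - q⁻¹) ∑_{n > 0 odd} a_i(n) z^{-n})`, a power series in `z⁻¹`. -/
def Psi (q : ℂ) (a : ι → ℤ → R) (i : ι) : PowerSeries R :=
  expSeries fun n => if Odd n then (2 * (q - q⁻¹)) • a i (n : ℤ) else 0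

/-- `Φ_i(z)` as a distribution. -/
def PhiD (q : ℂ) (a : ι → ℤ → R) (i : ι) : ℤ → R := fun n => zcoeff (Phi q a i) n

/-- `Ψ_i(z)` as a distribution. -/
def PsiD (q : ℂ) (a : ι → ℤ → R) (i : ι) : ℤ → R := fun n => zcoeff (Psi q a i) (-n)

end Distributions

/-! ### The Fock space and the twisted vertex operators -/

section Fock

variable {ι : Type*}

/-- The variables `a_i(-n)`, `n` a positive odd integer. -/
abbrev Var (ι : Type*) := ι × {n : ℕ // Odd n}

/-- The space `S(h̃⁻)` of polynomials in the `a_i(-n)`, `n` positive and odd. -/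
abbrev Fock (ι : Type*) := MvPolynomial (Var ι) ℂ

/-- The annihilation operator `a_i(n)`: the derivation with
`a_i(n) · a_j(-n) = [(α_i|α_j) n] / (2n) * (q^n - q^{-n}) / (q - q⁻¹)` and `a_i(n) · a_j(-m) = 0`
for `m ≠ n`. -/
def annih (A : ι → ι → ℤ) (q : ℂ) (i : ι) (n : ℕ) : Module.End ℂ (Fock ι) :=
  (MvPolynomial.mkDerivation ℂ fun x : Var ι =>
    if x.2.1 = n then
      (MvPolynomial.C (qInt q (A i x.1 * n) / (2 * n) * ((q ^ n - q⁻¹ ^ n) / (q - q⁻¹))) : Fock ι)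
    else 0).toLinearMap

/-- The operator `a_i(m)` on the Fock space with central charge `γ = q`, for `m` an odd integer
(and `0` for `m` even, which is never used). -/
def heis (A : ι → ι → ℤ) (q : ℂ) (i : ι) (m : ℤ) : Module.End ℂ (Fock ι) :=
  if h : Odd m.natAbs then
    (if 0 < m then annih A q i m.natAbs
      else LinearMap.mulLeft ℂ (MvPolynomial.X (i, ⟨m.natAbs, h⟩)))
  else 0

/-- `E_-^ε(α_i, z) = exp (ε ∑_{n > 0 odd} 2 q^{-ε n/2} / [n] a_i(-n) z^n)`, a power series in `z`;
here `p = q^{1/2}`. -/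
def Eminus (A : ι → ι → ℤ) (q p : ℂ) (ε : ℤˣ) (i : ι) : PowerSeries (Module.End ℂ (Fock ι)) :=
  expSeries fun n =>
    if Odd n then (((ε : ℤ) : ℂ) * (2 * p ^ (-((ε : ℤ) * n)) / qInt q n)) • heis A q i (-(n : ℤ))
    else 0

/-- `E_+^ε(α_i, z) = exp (-ε ∑_{n > 0 odd} 2 q^{-ε n/2} / [n] a_i(n) z^{-n})`, a power series
in `z⁻¹`; here `p = q^{1/2}`. -/
def Eplus (A : ι → ι → ℤ) (q p : ℂ) (ε : ℤˣ) (i : ι) : PowerSeries (Module.End ℂ (Fock ι)) :=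
  expSeries fun n =>
    if Odd n then (-((ε : ℤ) : ℂ) * (2 * p ^ (-((ε : ℤ) * n)) / qInt q n)) • heis A q i (n : ℤ)
    else 0

/-- Degree of a monomial, with `a_i(-n)` of degree `n`. -/
def wt (m : Var ι →₀ ℕ) : ℕ := m.sum fun x k => k * x.2.1

/-- Polynomials all of whose monomials have degree at most `d`. -/
def filt (ι : Type*) (d : ℤ) : Submodule ℂ (Fock ι) where
  carrier := {v | ∀ m, v.coeff m ≠ 0 → (wt m : ℤ) ≤ d}
  zero_mem' := by intro m hm; simp at hm
  add_mem' := by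
    intro u v hu hv m hm
    by_cases h : u.coeff m = 0
    · refine hv m ?_
      simpa [h] using hm
    · exact hu m h
  smul_mem' := by
    intro c v hv m hm
    refine hv m fun h => hm ?_
    simp [h]

theorem monomial_mem_filt {d : ℤ} (m : Var ι →₀ ℕ) (c : ℂ) (h : (wt m : ℤ) ≤ d) :
    MvPolynomial.monomial m c ∈ filt ι d := by
  classical
  intro m' hm'
  rw [MvPolynomial.coeff_monomial] at hm'
  by_cases e : m = m'
  · exact e ▸ h
  · simp [e] at hm'

/-- Operators lowering the degree by at least `n`. -/
def lowers (ι : Type*) (n : ℤ) : Submodule ℂ (Module.End ℂ (Fock ι)) where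
  carrier := {f | ∀ d, ∀ v ∈ filt ι d, f v ∈ filt ι (d - n)}
  zero_mem' := by intro d v _; simp
  add_mem' := by
    intro f g hf hg d v hv
    exact add_mem (hf d v hv) (hg d v hv)
  smul_mem' := by
    intro c f hf d v hv
    exact Submodule.smul_mem _ c (hf d v hv)

theorem annih_mem_lowers (A : ι → ι → ℤ) (q : ℂ) (i : ι) (n : ℕ) :
    annih A q i n ∈ lowers ι n := by
  intro d v hv
  rw [v.as_sum, map_sum]
  refine Submodule.sum_mem _ fun m hm => ?_
  have hmd : (wt m : ℤ) ≤ d := hv m (MvPolynomial.mem_support_iff.1 hm)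
  simp only [annih, Derivation.coeFn_coe,
    MvPolynomial.mkDerivation_monomial]
  refine Submodule.smul_mem _ _ (Submodule.sum_mem _ fun x hx => ?_)
  dsimp only
  split_ifs with h
  · rw [smul_eq_mul, mul_comm, MvPolynomial.C_mul_monomial]
    refine monomial_mem_filt _ _ ?_
    have hx1 : Finsupp.single x 1 ≤ m := by
      rw [Finsupp.single_le_iff]
      exact Nat.one_le_iff_ne_zero.2 (Finsupp.mem_support_iff.1 hx)
    have hw : wt m = wt (m - Finsupp.single x 1) + n := by
      conv_lhs => rw [← tsub_add_cancel_of_le hx1]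
      rw [wt, Finsupp.sum_add_index' (by simp) (by intros; ring), Finsupp.sum_single_index (by simp),
        one_mul, h, wt]
    omega
  · simp

theorem coeff_pow_mem_lowers {s : ℕ → Module.End ℂ (Fock ι)} (hs : ∀ n : ℕ, s n ∈ lowers ι n)
    (j : ℕ) : ∀ n : ℕ, PowerSeries.coeff n (PowerSeries.mk s ^ j) ∈ lowers ι n := by
  induction j with
  | zero =>
    intro n
    rw [pow_zero, PowerSeries.coeff_one]
    split_ifs with h
    · subst h; intro d v hv; simpa using hv
    · exact Submodule.zero_mem _
  | succ j ih =>
    intro n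
    rw [pow_succ, PowerSeries.coeff_mul]
    refine Submodule.sum_mem _ fun x hx => ?_
    intro d v hv
    have h1 := hs x.2 d v hv
    have h2 := ih x.1 _ _ h1
    have hx' := Finset.HasAntidiagonal.mem_antidiagonal.1 hx
    have e : d - (n : ℤ) = d - (x.2 : ℤ) - (x.1 : ℤ) := by rw [← hx']; push_cast; ring
    rw [e]
    simpa [PowerSeries.coeff_mk] using h2

theorem coeff_Eplus_mem_lowers (A : ι → ι → ℤ) (q p : ℂ) (ε : ℤˣ) (i : ι) (n : ℕ) :
    PowerSeries.coeff n (Eplus A q p ε i) ∈ lowers ι n := by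
  rw [Eplus, expSeries, PowerSeries.coeff_mk]
  refine Submodule.sum_mem _ fun j _ => Submodule.smul_mem _ _ (coeff_pow_mem_lowers ?_ j n)
  intro k
  split_ifs with h
  · refine Submodule.smul_mem _ _ ?_
    have hk : 0 < (k : ℤ) := by exact_mod_cast h.pos
    rw [heis, dif_pos (by simpa using h), if_pos hk]
    simpa using annih_mem_lowers A q i k
  · exact Submodule.zero_mem _

/-- Only finitely many coefficients of `E_+^ε(α_i, z)` are nonzero on a given vector. -/
theorem finite_Eplus (A : ι → ι → ℤ) (q p : ℂ) (ε : ℤˣ) (i : ι) (v : Fock ι) :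
    {k : ℕ | PowerSeries.coeff k (Eplus A q p ε i) v ≠ 0}.Finite := by
  obtain ⟨D, hD⟩ : ∃ D : ℕ, v ∈ filt ι D := by
    refine ⟨v.support.sup wt, fun m hm => ?_⟩
    exact_mod_cast Finset.le_sup (f := wt) (MvPolynomial.mem_support_iff.2 hm)
  refine (Set.finite_le_nat D).subset fun k hk => ?_
  by_contra hlt
  refine hk ?_
  have h := coeff_Eplus_mem_lowers A q p ε i k D v hD
  ext m
  by_contra hm
  have := h m hm
  have hlt' : D < k := not_le.1 hlt
  omega

theorem finite_vertex (A : ι → ι → ℤ) (q p : ℂ) (ε : ℤˣ) (i : ι) (a : ℤ) (v : Fock ι) :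
    (Function.support fun k : ℕ =>
      zcoeff (Eminus A q p ε i) (a + k) (PowerSeries.coeff k (Eplus A q p ε i) v)).Finite :=
  (finite_Eplus A q p ε i v).subset fun k hk h => hk (by
    change zcoeff (Eminus A q p ε i) (a + k) (PowerSeries.coeff k (Eplus A q p ε i) v) = 0
    rw [h, map_zero])

/-- The coefficient at `z^a` of `E_-^ε(α_i, z) E_+^ε(α_i, z)`; on each vector the sum is finite. -/
def vertexFock (A : ι → ι → ℤ) (q p : ℂ) (ε : ℤˣ) (i : ι) (a : ℤ) : Module.End ℂ (Fock ι) where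
  toFun v := ∑ᶠ k : ℕ,
    zcoeff (Eminus A q p ε i) (a + k) (PowerSeries.coeff k (Eplus A q p ε i) v)
  map_add' u v := by
    simp only [map_add]
    exact finsum_add_distrib (finite_vertex A q p ε i a u) (finite_vertex A q p ε i a v)
  map_smul' c v := by
    simp only [map_smul, RingHom.id_apply]
    exact (smul_finsum' c (finite_vertex A q p ε i a v)).symm

variable {E T : Type*} [Group E] [AddCommGroup T] [Module ℂ T]

/-- The operator `a_i(m)` on `V_Q = S(h̃⁻) ⊗ T`. -/
def heisV (A : ι → ι → ℤ) (q : ℂ) (T : Type*) [AddCommGroup T] [Module ℂ T] (i : ι) (m : ℤ) :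
    Module.End ℂ (Fock ι ⊗[ℂ] T) :=
  TensorProduct.map (heis A q i m) LinearMap.id

/-- The operator of an element of the central extension on `V_Q = S(h̃⁻) ⊗ T`. -/
def groupV (ρ : Representation ℂ E T) (g : E) : Module.End ℂ (Fock ι ⊗[ℂ] T) :=
  TensorProduct.map LinearMap.id (ρ g)

/-- The twisted vertex operator `X_i^ε(z) = E_-^ε(α_i, z) E_+^ε(α_i, z) a_i^ε` on `V_Q`, where
`e i` is the chosen preimage `a_i` of `α_i`. The value at `a` is the coefficient of `z^a`, that is
the operator `X_i^ε(-a)`. -/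
def vertex (A : ι → ι → ℤ) (q p : ℂ) (ρ : Representation ℂ E T) (e : ι → E) (ε : ℤˣ) (i : ι) :
    ℤ → Module.End ℂ (Fock ι ⊗[ℂ] T) :=
  fun a => TensorProduct.map (vertexFock A q p ε i a) (ρ (e i ^ (ε : ℤ)))

end Fock

/-! ### The twisted quantum loop algebra -/

section Algebra

/-- Generators: `a_{i,m}` with `m` odd, `x_{i,n}^ε`, the central element `c`, and
`γ^{1/2} = q^{c/2}` with its inverse. -/
inductive Gen (ι : Type*) : Type _
  | a (i : ι) (m : {m : ℤ // Odd m}) : Gen ι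
  | x (ε : ℤˣ) (i : ι) (n : ℤ) : Gen ι
  | c : Gen ι
  | g : Gen ι
  | gi : Gen ι

variable {ι : Type*}

/-- The generators inside the free algebra. -/
abbrev gen (y : Gen ι) : FreeAlgebra ℂ (Gen ι) := FreeAlgebra.ι ℂ y

/-- `a_{i,m}` for `m` odd (and `0` for `m` even, which is never used). -/
def genA (i : ι) (m : ℤ) : FreeAlgebra ℂ (Gen ι) := if h : Odd m then gen (Gen.a i ⟨m, h⟩) else 0

/-- `x_i^ε(z) = ∑ x_{i,n}^ε z^{-n}`. -/
def genX (ε : ℤˣ) (i : ι) : ℤ → FreeAlgebra ℂ (Gen ι) := fun a => gen (Gen.x ε i (-a))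

/-- `γ^{k/2} = q^{k c/2}`. -/
def gam (k : ℤ) : FreeAlgebra ℂ (Gen ι) :=
  if 0 ≤ k then gen Gen.g ^ k.toNat else gen Gen.gi ^ (-k).toNat

/-- `φ_i(z)`, a power series in `z`. -/
abbrev phi (q : ℂ) (i : ι) : PowerSeries (FreeAlgebra ℂ (Gen ι)) := Phi q genA i

/-- `ψ_i(z)`, a power series in `z⁻¹`. -/
abbrev psi (q : ℂ) (i : ι) : PowerSeries (FreeAlgebra ℂ (Gen ι)) := Psi q genA i

/-- The defining relations, coefficient by coefficient. Since `φ_i` and `ψ_i` are invertible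
series, a relation `φ x φ⁻¹ = x G` is written `φ x = x G φ`. -/
inductive Rel (A : ι → ι → ℤ) (q : ℂ) : FreeAlgebra ℂ (Gen ι) → FreeAlgebra ℂ (Gen ι) → Prop
  | c_central (y : Gen ι) : Rel A q (gen Gen.c * gen y) (gen y * gen Gen.c)
  | g_central (y : Gen ι) : Rel A q (gen Gen.g * gen y) (gen y * gen Gen.g)
  | g_gi : Rel A q (gen Gen.g * gen Gen.gi) 1
  | gi_g : Rel A q (gen Gen.gi * gen Gen.g) 1
  -- `[φ_i(z), φ_j(w)] = [ψ_i(z), ψ_j(w)] = 0`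
  | phi_phi (i j : ι) (m n : ℕ) :
      Rel A q (PowerSeries.coeff m (phi q i) * PowerSeries.coeff n (phi q j))
        (PowerSeries.coeff n (phi q j) * PowerSeries.coeff m (phi q i))
  | psi_psi (i j : ι) (m n : ℕ) :
      Rel A q (PowerSeries.coeff m (psi q i) * PowerSeries.coeff n (psi q j))
        (PowerSeries.coeff n (psi q j) * PowerSeries.coeff m (psi q i))
  -- `φ_i(z) ψ_j(w) = ψ_j(w) φ_i(z) G_{ij}(γ⁻¹ z/w) / G_{ij}(γ z/w)`
  | phi_psi (i j : ι) (m n : ℕ) :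
      Rel A q (PowerSeries.coeff m (phi q i) * PowerSeries.coeff n (psi q j))
        (∑ k ∈ Finset.range (min m n + 1), ∑ l ∈ Finset.HasAntidiagonal.antidiagonal k,
          (PowerSeries.coeff l.1 (G q (A i j)) * PowerSeries.coeff l.2 (G q (A i j))⁻¹) •
            (gam (2 * ((l.2 : ℤ) - l.1)) *
              (PowerSeries.coeff (n - k) (psi q j) * PowerSeries.coeff (m - k) (phi q i))))
  -- `φ_i(z) x_j^ε(w) φ_i(z)⁻¹ = x_j^ε(w) G_{ij}(γ^{-ε/2} z/w)^ε`
  | phi_x (ε : ℤˣ) (i j : ι) (m : ℕ) (b : ℤ) :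
      Rel A q (PowerSeries.coeff m (phi q i) * genX ε j b)
        (∑ l ∈ Finset.HasAntidiagonal.antidiagonal m, PowerSeries.coeff l.1 (Gpow q (A i j) ε) •
          (gam (-((ε : ℤ) * l.1)) * genX ε j (b + l.1) * PowerSeries.coeff l.2 (phi q i)))
  -- `ψ_i(z) x_j^ε(w) ψ_i(z)⁻¹ = x_j^ε(w) G_{ij}(γ^{-ε/2} w/z)^{-ε}`
  | psi_x (ε : ℤˣ) (i j : ι) (m : ℕ) (b : ℤ) :
      Rel A q (PowerSeries.coeff m (psi q i) * genX ε j b)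
        (∑ l ∈ Finset.HasAntidiagonal.antidiagonal m, PowerSeries.coeff l.1 (Gpow q (A i j) (-ε)) •
          (gam (-((ε : ℤ) * l.1)) * genX ε j (b - l.1) * PowerSeries.coeff l.2 (psi q i)))
  -- `[x_i^ε(z), x_j^ε'(w)] = 0` if `(α_i|α_j) = 0`
  | x_x_zero (ε ε' : ℤˣ) (i j : ι) (h : A i j = 0) (a b : ℤ) :
      Rel A q (comm (genX ε i) (genX ε' j) a b) 0
  -- `(z + w)_{q²}^{-(α_i|α_j)} [x_i^+(z), x_j^-(w)] = 0` if `(α_i|α_j) < 0`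
  | x_x_opp (i j : ι) (h : A i j < 0) (a b : ℤ) :
      Rel A q (polyMul (qPow q (-A i j).toNat Z (-W)) (comm (genX 1 i) (genX (-1) j)) a b) 0
  -- `[x_i^+(z), x_i^-(w)] = 2(q+q⁻¹)/(q-q⁻¹)
  --   (ψ_i(γ^{-1/2} z) δ(γ w/z) - φ_i(γ^{1/2} z) δ(γ⁻¹ w/z))`
  | x_x_diag (i : ι) (a b : ℤ) :
      Rel A q (comm (genX 1 i) (genX (-1) i) a b)
        ((2 * (q + q⁻¹) / (q - q⁻¹)) •
          (gam (-(a + b) + 2 * b) * PsiD q genA i (a + b)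
            - gam ((a + b) - 2 * b) * PhiD q genA i (a + b)))
  -- `(z-w)_{q²}^{-r-1} (z - q^{εr} w)(z + q^{-εr} w) x_i^ε(z) x_j^ε(w)
  --   = (z-w)_{q²}^{-r-1} (q^{εr} z - w)(q^{-εr} z + w) x_j^ε(w) x_i^ε(z)`, `r = (α_i|α_j) < 0`
  | x_x_same (ε : ℤˣ) (i j : ι) (h : A i j < 0) (a b : ℤ) :
      Rel A q
        (polyMul (qPow q (-A i j - 1).toNat Z W * (Z - K (q ^ ((ε : ℤ) * A i j)) * W)
          * (Z + K (q ^ (-((ε : ℤ) * A i j))) * W)) (prodZW (genX ε i) (genX ε j)) a b)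
        (polyMul (qPow q (-A i j - 1).toNat Z W * (K (q ^ ((ε : ℤ) * A i j)) * Z - W)
          * (K (q ^ (-((ε : ℤ) * A i j))) * Z + W)) (prodWZ (genX ε i) (genX ε j)) a b)
  -- `(z - q^{2ε} w)(z + q^{-2ε} w) x_i^ε(z) x_i^ε(w)
  --   = (q^{2ε} z - w)(q^{-2ε} z + w) x_i^ε(w) x_i^ε(z) + 2 (q+q⁻¹)² z² δ(-w/z) c`
  | x_x_self (ε : ℤˣ) (i : ι) (a b : ℤ) :
      Rel A q
        (polyMul ((Z - K (q ^ (2 * (ε : ℤ))) * W) * (Z + K (q ^ (-(2 * (ε : ℤ)))) * W))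
          (prodZW (genX ε i) (genX ε i)) a b)
        (polyMul ((K (q ^ (2 * (ε : ℤ))) * Z - W) * (K (q ^ (-(2 * (ε : ℤ)))) * Z + W))
            (prodWZ (genX ε i) (genX ε i)) a b
          + polyMul (K (2 * (q + q⁻¹) ^ 2) * Z ^ 2) (deltaNeg (gen Gen.c)) a b)

/-- The twisted quantum loop algebra attached to the matrix `A = ((α_i|α_j))`. -/
abbrev LoopAlgebra (A : ι → ι → ℤ) (q : ℂ) := RingQuot (Rel A q)

/-- The class of a generator in the twisted quantum loop algebra. -/
def LoopAlgebra.of (A : ι → ι → ℤ) (q : ℂ) (y : Gen ι) : LoopAlgebra A q :=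
  RingQuot.mkAlgHom ℂ (Rel A q) (gen y)

end Algebra

end TwistedLoop

end

/-! Everything is a computation with exponentials in a Heisenberg algebra. On the Fock space
`[a_i(m), a_j(-n)]` is a scalar and vanishes unless `m = n`, so moving `exp` of annihilation
operators past `exp` of creation operators costs the exponential of a scalar series
(`coeff_expSeries_mul_coeff_expSeries`). That lemma is obtained from the differential equation `x y'
= (x s') y` satisfied by `exp s`: conjugation by `exp (s(x))` is an algebra homomorphism which
translates each `t_k` by a multiple of `x^k`.

Applied to `Φ`, `Ψ` and the two halves of a vertex operator, this gives the `Φ`-`Ψ`, `Φ`-`X` and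
`Ψ`-`X` relations at once; only the scalar exponents have to be compared with `log G`.

For two vertex operators it gives `X_i(z) X_j(w) = f(w/z) N(z, w)`, where `N` is the normally
ordered product, and, up to the sign coming from `T`, `X_j(w) X_i(z) = f(z/w) N(z, w)` with the same
`N` and the same `f`. Applied to a vector, `N` has finitely many terms on each line of constant
total degree, so it can be multiplied by any doubly infinite scalar series in `x = w/z` (`pairing`).
Each quadratic relation thus becomes an identity between the expansions of a rational function at `x
= 0` and at `x = ∞` (`polyMul_vertexFock_sub`). The function `f` is a product of factors `((1 + c
x)/(1 - c x))^{±1}`, read off from `[rn]/[n]`. For `r < 0` the polynomial prefactors cancel all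
poles, and what remains is a polynomial that is palindromic up to the sign `(-1)^r`, which matches
the sign from `T`. For `r = 2` simple poles survive, the two expansions differ by delta series
(`zcoeff_opeSeries_sub`, `zcoeff_opeSeries_self`), and a delta series sets `w` to a multiple of `z`
in `N`. There creation parts, annihilation parts or both cancel, leaving `Ψ`, `Φ` or the identity
(`pairing_zpow_of_left_eq_one`, `pairing_zpow_of_right_eq_one`).

The group elements act on the other tensor factor and contribute signs and the term `a_i^{±2}`. The
representation of the loop algebra then comes from the universal property of its presentation. -/

noncomputable section

namespace TwistedLoop

open PowerSeries

/-! ### Exponentials of power series over a noncommutative algebra -/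

section Exponential

variable {R S : Type*} [Ring R] [Algebra ℂ R] [Ring S] [Algebra ℂ S]

/-- The Euler derivation `x d/dx`. -/
def euler (f : PowerSeries R) : PowerSeries R := PowerSeries.mk fun n => (n : ℂ) • coeff n f

@[simp] theorem coeff_euler (f : PowerSeries R) (n : ℕ) : coeff n (euler f) = (n : ℂ) • coeff n f :=
  coeff_mk _ _

theorem euler_mul (f g : PowerSeries R) : euler (f * g) = euler f * g + f * euler g := by
  ext n
  rw [coeff_euler, map_add, coeff_mul, coeff_mul, coeff_mul, Finset.smul_sum,
    ← Finset.sum_add_distrib]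
  refine Finset.sum_congr rfl fun x hx => ?_
  rw [coeff_euler, coeff_euler, ← Finset.HasAntidiagonal.mem_antidiagonal.1 hx, Nat.cast_add, add_smul,
    smul_mul_assoc, mul_smul_comm]

theorem euler_sub (f g : PowerSeries R) : euler (f - g) = euler f - euler g := by
  ext n; rw [coeff_euler, map_sub, map_sub, coeff_euler, coeff_euler, smul_sub]

theorem euler_C (a : R) : euler (C a) = 0 := by
  ext n
  rcases eq_or_ne n 0 with rfl | h
  · simp
  · simp [coeff_C, h]

theorem euler_smul (c : ℂ) (f : PowerSeries R) : euler (c • f) = c • euler f := by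
  ext n; rw [coeff_euler, PowerSeries.coeff_smul, PowerSeries.coeff_smul, coeff_euler, smul_comm]

theorem euler_X_pow (n : ℕ) : euler (X ^ n : PowerSeries R) = (n : ℂ) • X ^ n := by
  ext m
  rw [coeff_euler, PowerSeries.coeff_smul, coeff_X_pow]
  split_ifs with h
  · rw [h]
  · simp

/-- A solution of `x y' = g y` with vanishing constant term is zero, if `g` has no constant term. -/
theorem eq_zero_of_euler_eq {g y : PowerSeries R} (hg : coeff 0 g = 0) (h0 : coeff 0 y = 0)
    (h : euler y = g * y) : y = 0 := by
  ext n
  rw [map_zero]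
  induction n using Nat.strong_induction_on with
  | _ n ih =>
    rcases eq_or_ne n 0 with rfl | hn
    · exact h0
    · have h1 : (n : ℂ) • coeff n y = 0 := by
        -- As `g` has no constant term, the coefficient of `g * y` in degree `n` involves only lower
        -- coefficients of `y`.
        rw [← coeff_euler, h, coeff_mul]
        refine Finset.sum_eq_zero fun x hx => ?_
        have hx := Finset.HasAntidiagonal.mem_antidiagonal.1 hx
        rcases eq_or_ne x.1 0 with h1 | h1
        · rw [h1, hg, zero_mul]
        · rw [ih x.2 (by omega), mul_zero]
      have h2 := congrArg (fun v => (n : ℂ)⁻¹ • v) h1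
      simpa [smul_smul, hn] using h2

theorem commute_mk {R : Type*} [Ring R] {s t : ℕ → R} (h : ∀ m n, Commute (s m) (t n)) :
    Commute (PowerSeries.mk s) (PowerSeries.mk t) := by
  ext n
  rw [coeff_mul, coeff_mul, ← Finset.Nat.sum_antidiagonal_swap]
  refine Finset.sum_congr rfl fun x _ => ?_
  simpa using (h x.2 x.1).eq

theorem commute_of_coeff {R : Type*} [Ring R] {f g : PowerSeries R} (h : ∀ m n, Commute (coeff m f) (coeff n g)) :
    Commute f g := by
  have := commute_mk h
  rwa [show PowerSeries.mk (fun m => coeff m f) = f from PowerSeries.ext fun n => coeff_mk _ _,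
    show PowerSeries.mk (fun m => coeff m g) = g from PowerSeries.ext fun n => coeff_mk _ _] at this

theorem commute_coeff_pow {R : Type*} [Ring R] {x : R} {f : PowerSeries R} (h : ∀ n, Commute x (coeff n f)) (k n : ℕ) :
    Commute x (coeff n (f ^ k)) := by
  have h1 : Commute (C x) f := commute_of_coeff fun m n => by
    rw [coeff_C]; split_ifs
    · exact h n
    · exact Commute.zero_left _
  have h2 := congrArg (coeff n) (h1.pow_right k).eq
  rwa [coeff_C_mul, coeff_mul_C] at h2

theorem commute_coeff_expSeries {x : R} {s : ℕ → R} (h : ∀ n, Commute x (s n)) (n : ℕ) :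
    Commute x (coeff n (expSeries s)) := by
  rw [expSeries, coeff_mk]
  exact Commute.sum_right _ _ _ fun k _ =>
    (commute_coeff_pow (fun n => by rw [coeff_mk]; exact h n) k n).smul_right _

theorem commute_coeff_expSeries_expSeries {s t : ℕ → R} (h : ∀ m n, Commute (s m) (t n))
    (m n : ℕ) : Commute (coeff m (expSeries s)) (coeff n (expSeries t)) :=
  commute_coeff_expSeries (fun n => (commute_coeff_expSeries (fun m => (h m n).symm) m).symm) n

@[simp] theorem coeff_zero_expSeries (s : ℕ → R) : coeff 0 (expSeries s) = 1 := by
  simp [expSeries]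

@[simp] theorem constantCoeff_expSeries (s : ℕ → R) : constantCoeff (expSeries s) = 1 := by
  rw [← coeff_zero_eq_constantCoeff_apply, coeff_zero_expSeries]

theorem coeff_pow_eq_zero {R : Type*} [Ring R] {f : PowerSeries R} (h : coeff 0 f = 0) {n k : ℕ} (hk : n < k) :
    coeff n (f ^ k) = 0 := by
  induction k generalizing n with
  | zero => omega
  | succ k ih =>
    rw [pow_succ, coeff_mul]
    refine Finset.sum_eq_zero fun x hx => ?_
    have hx := Finset.HasAntidiagonal.mem_antidiagonal.1 hx
    rcases eq_or_ne x.2 0 with h1 | h1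
    · rw [h1, h, mul_zero]
    · rw [ih (by omega), zero_mul]

/-- The power `s^k` starts in degree `k`, so the truncation of the exponential sum is immaterial
once it exceeds the degree. This allows one truncation for several coefficients. -/
theorem coeff_expSeries_eq {s : ℕ → R} (h0 : s 0 = 0) {n N : ℕ} (hN : n < N) :
    coeff n (expSeries s) =
      ∑ k ∈ Finset.range N, ((k.factorial : ℂ)⁻¹) • coeff n (PowerSeries.mk s ^ k) := by
  rw [expSeries, coeff_mk]
  refine Finset.sum_subset (Finset.range_subset_range.2 hN) fun k _ hk => ?_
  rw [coeff_pow_eq_zero (by simpa using h0) (by simpa using hk), smul_zero]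

theorem euler_pow {f : PowerSeries R} (h : Commute (euler f) f) (k : ℕ) :
    euler (f ^ (k + 1)) = ((k + 1 : ℕ) : ℂ) • (euler f * f ^ k) := by
  induction k with
  | zero => simp
  | succ k ih =>
    rw [pow_succ, euler_mul, ih, smul_mul_assoc, mul_assoc, ← pow_succ,
      ← (h.pow_right (k + 1)).eq, Nat.cast_add (k + 1) 1, add_smul, Nat.cast_one, one_smul]

/-- Termwise differentiation; commutativity of the `s n` makes the power rule hold. -/
theorem euler_expSeries {s : ℕ → R} (h0 : s 0 = 0) (hs : ∀ m n, Commute (s m) (s n)) :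
    euler (expSeries s) = euler (PowerSeries.mk s) * expSeries s := by
  have hc : Commute (euler (PowerSeries.mk s)) (PowerSeries.mk s) := by
    refine commute_of_coeff fun m n => ?_
    simpa using (hs m n).smul_left (m : ℂ)
  ext n
  have key : ∀ k : ℕ, (((k + 1).factorial : ℂ)⁻¹) • coeff n (euler (PowerSeries.mk s ^ (k + 1)))
      = ((k.factorial : ℂ)⁻¹) • coeff n (euler (PowerSeries.mk s) * PowerSeries.mk s ^ k) := by
    intro k
    rw [euler_pow hc, PowerSeries.coeff_smul, smul_smul]
    congr 1
    rw [Nat.factorial_succ, Nat.cast_mul]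
    have : ((k + 1 : ℕ) : ℂ) ≠ 0 := by exact_mod_cast k.succ_ne_zero
    field_simp
  have e1 : euler (1 : PowerSeries R) = 0 := by
    ext m; rw [coeff_euler, coeff_one]; split_ifs with h <;> simp [h]
  -- The term `k = 0` is killed by the derivation and the others shift down by one, so `n + 2` terms
  -- here match `n + 1` terms on the right.
  rw [coeff_euler, coeff_expSeries_eq h0 (n := n) (N := n + 2) (by omega), Finset.smul_sum]
  simp_rw [smul_comm (n : ℂ), ← coeff_euler]
  rw [Finset.sum_range_succ', pow_zero, e1, map_zero, smul_zero, add_zero,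
    Finset.sum_congr rfl fun k _ => key k, coeff_mul]
  simp_rw [coeff_mul, Finset.smul_sum]
  rw [Finset.sum_comm]
  refine Finset.sum_congr rfl fun x hx => ?_
  have hx := Finset.HasAntidiagonal.mem_antidiagonal.1 hx
  rw [coeff_expSeries_eq h0 (n := x.2) (N := n + 1) (by omega), Finset.mul_sum]
  exact Finset.sum_congr rfl fun k _ => (mul_smul_comm _ _ _).symm

/-- Uniqueness for the differential equation. Identities between exponentials are verified through
it, without multiplying out double sums. -/
theorem eq_expSeries_of_euler {s : ℕ → R} (h0 : s 0 = 0) (hs : ∀ m n, Commute (s m) (s n))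
    {y : PowerSeries R} (hy0 : coeff 0 y = 1) (hy : euler y = euler (PowerSeries.mk s) * y) :
    y = expSeries s := by
  rw [← sub_eq_zero]
  refine eq_zero_of_euler_eq (g := euler (PowerSeries.mk s)) (by simp) (by rw [map_sub, hy0, coeff_zero_expSeries, sub_self]) ?_
  rw [euler_sub, hy, euler_expSeries h0 hs, mul_sub]

theorem expSeries_zero : expSeries (fun _ => (0 : R)) = 1 := by
  refine (eq_expSeries_of_euler rfl (fun _ _ => Commute.zero_left _) (by simp) ?_).symm
  ext n
  rw [coeff_euler, coeff_one, coeff_mul]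
  split_ifs with h <;> simp [h]

theorem expSeries_add {s t : ℕ → R} (hs0 : s 0 = 0) (ht0 : t 0 = 0)
    (hs : ∀ m n, Commute (s m) (s n)) (ht : ∀ m n, Commute (t m) (t n))
    (hst : ∀ m n, Commute (s m) (t n)) :
    expSeries (fun n => s n + t n) = expSeries s * expSeries t := by
  refine (eq_expSeries_of_euler (by simp [hs0, ht0]) (fun m n => ?_) (by simp) ?_).symm
  · exact ((hs m n).add_right (hst m n)).add_left (((hst n m).symm).add_right (ht m n))
  · have h1 : Commute (expSeries s) (euler (PowerSeries.mk t)) := by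
      refine commute_of_coeff fun m n => ?_
      rw [coeff_euler, coeff_mk]
      exact ((commute_coeff_expSeries (fun k => (hst k n).symm) m).symm).smul_right _
    have h2 : euler (PowerSeries.mk fun n => s n + t n) =
        euler (PowerSeries.mk s) + euler (PowerSeries.mk t) := by
      ext n; simp
    rw [euler_mul, euler_expSeries hs0 hs, euler_expSeries ht0 ht, h2, ← mul_assoc, h1.eq]
    noncomm_ring

theorem expSeries_mul_neg {s : ℕ → R} (h0 : s 0 = 0) (hs : ∀ m n, Commute (s m) (s n)) :
    expSeries s * expSeries (fun n => -s n) = 1 := by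
  rw [← expSeries_add h0 (by simp [h0]) hs (fun m n => ((hs m n).neg_left).neg_right)
    fun m n => (hs m n).neg_right]
  simp [expSeries_zero]

theorem expSeries_neg_mul {s : ℕ → R} (h0 : s 0 = 0) (hs : ∀ m n, Commute (s m) (s n)) :
    expSeries (fun n => -s n) * expSeries s = 1 := by
  simpa using expSeries_mul_neg (s := fun n => -s n) (by simp [h0])
    (fun m n => ((hs m n).neg_left).neg_right)

theorem map_coeff_expSeries (φ : R →ₐ[ℂ] S) (s : ℕ → R) (n : ℕ) :
    φ (coeff n (expSeries s)) = coeff n (expSeries fun k => φ (s k)) := by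
  have h : ∀ k, φ (coeff n (PowerSeries.mk s ^ k)) =
      coeff n ((PowerSeries.mk fun j => φ (s j)) ^ k) := by
    intro k
    have h1 : (PowerSeries.mk fun j => φ (s j)) =
        PowerSeries.map (φ : R →+* S) (PowerSeries.mk s) := by
      ext j; simp
    rw [h1, ← map_pow, PowerSeries.coeff_map]; rfl
  simp [expSeries, h]

/-- A product of coefficients `s k` of total degree `n` picks up exactly `x^n` when `x` commutes
with all of them. -/
theorem coeff_expSeries_mul_pow {s : ℕ → R} {x : R} (hx : ∀ n, Commute x (s n)) (n : ℕ) :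
    coeff n (expSeries fun k => s k * x ^ k) = coeff n (expSeries s) * x ^ n := by
  have h : ∀ k n, coeff n ((PowerSeries.mk fun k => s k * x ^ k) ^ k) =
      coeff n (PowerSeries.mk s ^ k) * x ^ n := by
    intro k
    induction k with
    | zero =>
      intro n
      rw [pow_zero, pow_zero, coeff_one]
      split_ifs with h <;> simp [h]
    | succ k ih =>
      intro n
      rw [pow_succ, pow_succ, coeff_mul, coeff_mul, Finset.sum_mul]
      refine Finset.sum_congr rfl fun y hy => ?_
      rw [ih, coeff_mk, coeff_mk, ← Finset.HasAntidiagonal.mem_antidiagonal.1 hy, pow_add, mul_assoc, mul_assoc,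
        ← mul_assoc (x ^ y.1), ((hx y.2).pow_left y.1).eq, mul_assoc]
  simp [expSeries, h, Finset.sum_mul]

theorem coeff_expSeries_pow_smul (c : ℂ) (s : ℕ → R) (n : ℕ) :
    coeff n (expSeries fun k => c ^ k • s k) = c ^ n • coeff n (expSeries s) := by
  have h := coeff_expSeries_mul_pow (s := s) (x := algebraMap ℂ R c)
    (fun n => Algebra.commutes c (s n)) n
  simp_rw [← map_pow, ← Algebra.commutes, ← Algebra.smul_def] at h
  exact h

theorem coeff_expSeries_smul_pow (c : ℕ → ℂ) (x : R) (n : ℕ) :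
    coeff n (expSeries fun k => c k • x ^ k) = coeff n (expSeries c) • x ^ n := by
  simp_rw [Algebra.smul_def]
  rw [coeff_expSeries_mul_pow fun n => (Algebra.commutes _ x).symm]
  congr 1
  exact (map_coeff_expSeries (Algebra.ofId ℂ R) c n).symm

/-- Both sides solve `x y' = (x s') y` with the same constant term: `[x s', t]` is the central
element `n c x^n`, which is also the derivative of the correction `c x^n`. The hypothesis on `n = 0`
makes the constant terms agree. -/
theorem expSeries_mul_C {s : ℕ → R} (h0 : s 0 = 0) (hs : ∀ m n, Commute (s m) (s n))
    {t : R} {c : ℂ} {n : ℕ} (hn : n = 0 → c = 0)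
    (hst : ∀ m, s m * t = t * s m + if m = n then algebraMap ℂ R c else 0) :
    expSeries s * C t = (C t + c • X ^ n) * expSeries s := by
  rw [← sub_eq_zero]
  refine eq_zero_of_euler_eq (g := euler (PowerSeries.mk s)) (by simp) ?_ ?_
  · rcases eq_or_ne n 0 with h | h
    · simp [hn h]
    · simp [h, PowerSeries.coeff_zero_eq_constantCoeff_apply]
  · have h1 : euler (PowerSeries.mk s) * C t = C t * euler (PowerSeries.mk s) +
        ((n : ℂ) * c) • X ^ n := by
      ext m
      rw [map_add, coeff_mul_C, coeff_C_mul, PowerSeries.coeff_smul, coeff_X_pow, coeff_euler,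
        coeff_mk, smul_mul_assoc, hst, smul_add, mul_smul_comm]
      congr 1
      split_ifs with h
      · rw [h, mul_smul, Algebra.algebraMap_eq_smul_one]
      · simp
    have h2 : euler (PowerSeries.mk s) * X ^ n = X ^ n * euler (PowerSeries.mk s) :=
      ((PowerSeries.commute_X (euler (PowerSeries.mk s))).pow_right n).eq
    have e1 : euler (expSeries s * C t) = euler (PowerSeries.mk s) * (expSeries s * C t) := by
      rw [euler_mul, euler_C, mul_zero, add_zero, euler_expSeries h0 hs, mul_assoc]
    have e2 : euler ((C t + c • X ^ n) * expSeries s) =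
        euler (PowerSeries.mk s) * ((C t + c • X ^ n) * expSeries s) := by
      have e3 : euler (C t + c • X ^ n : PowerSeries R) = ((n : ℂ) * c) • X ^ n := by
        rw [show (C t + c • X ^ n : PowerSeries R) = c • X ^ n - C (-t) by simp [add_comm],
          euler_sub, euler_C, euler_smul, euler_X_pow, sub_zero, smul_smul, mul_comm]
      rw [euler_mul, e3, euler_expSeries h0 hs, ← mul_assoc, ← mul_assoc, mul_add, h1,
        mul_smul_comm, h2, ← add_mul, add_mul (C t), smul_mul_assoc]
      congr 1
      abel
    rw [euler_sub, e1, e2, mul_sub]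

/-- If `[s m, t n] = δ_{mn} c n`, then `exp (s(x)) exp (t(y)) = exp (t(y)) exp (s(x)) exp (c(xy))`. -/
theorem coeff_expSeries_mul_coeff_expSeries {s t : ℕ → R} {c : ℕ → ℂ} (hs0 : s 0 = 0)
    (ht0 : t 0 = 0) (hc0 : c 0 = 0)
    (hs : ∀ m n, Commute (s m) (s n)) (ht : ∀ m n, Commute (t m) (t n))
    (hst : ∀ m n, s m * t n = t n * s m + if m = n then algebraMap ℂ R (c n) else 0) (m n : ℕ) :
    coeff m (expSeries s) * coeff n (expSeries t) =
      ∑ k ∈ Finset.range (min m n + 1),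
        coeff k (expSeries c) • (coeff (n - k) (expSeries t) * coeff (m - k) (expSeries s)) := by
  have hE : expSeries (fun n => -s n) * expSeries s = 1 := expSeries_neg_mul hs0 hs
  have hE' : expSeries s * expSeries (fun n => -s n) = 1 := expSeries_mul_neg hs0 hs
  -- Conjugation by `exp s` is a homomorphism from `R` to series over `R`. It can therefore be
  -- applied inside the exponential of `t`, whose own variable stays separate, and no series in two
  -- variables is needed.
  let φ : R →ₐ[ℂ] PowerSeries R := AlgHom.ofLinearMap
    { toFun x := expSeries s * C x * expSeries (fun n => -s n)
      map_add' x y := by rw [map_add, mul_add, add_mul]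
      map_smul' a x := by
        rw [← smul_mul_assoc, ← mul_smul_comm, RingHom.id_apply]
        congr 2
        ext; simp [coeff_C] }
    (by simp [hE'])
    (fun x y => by
      simp only [LinearMap.coe_mk, AddHom.coe_mk, map_mul]
      calc expSeries s * (C x * C y) * expSeries (fun n => -s n)
          = expSeries s * C x * 1 * C y * expSeries (fun n => -s n) := by noncomm_ring
        _ = _ := by rw [← hE]; noncomm_ring)
  have hφt : ∀ k, φ (t k) = C (t k) + c k • X ^ k := by
    intro k
    change expSeries s * C (t k) * expSeries (fun n => -s n) = _
    rw [expSeries_mul_C hs0 hs (c := c k) (n := k) (fun h => by rw [h, hc0]) (fun m => hst m k),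
      mul_assoc, hE', mul_one]
  have hcomm : ∀ (a : ℂ) (m : ℕ) (f : PowerSeries R), Commute (a • X ^ m : PowerSeries R) f :=
    fun a m f => (((PowerSeries.commute_X f).pow_right m).symm).smul_left a
  let CA : R →ₐ[ℂ] PowerSeries R := AlgHom.mk (C (R := R)) fun a => by
    ext; simp [PowerSeries.algebraMap_apply]
  -- The translated exponent `t_k + c_k x^k` is a sum of commuting parts, so its exponential factors
  -- as `exp t` times the scalar series.
  have h1 : φ (coeff n (expSeries t)) = ∑ x ∈ Finset.HasAntidiagonal.antidiagonal n,
      C (coeff x.1 (expSeries t)) * (coeff x.2 (expSeries c) • X ^ x.2) := by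
    rw [map_coeff_expSeries]
    simp_rw [hφt]
    rw [expSeries_add (s := fun k => C (t k)) (t := fun k => c k • (X : PowerSeries R) ^ k)
      (by simp [ht0]) (by simp [hc0]) (fun m n => (ht m n).map (C (R := R)))
      (fun m n => hcomm _ _ _) (fun m n => (hcomm _ _ _).symm), coeff_mul]
    refine Finset.sum_congr rfl fun x _ => ?_
    rw [coeff_expSeries_smul_pow]
    congr 1
    exact (map_coeff_expSeries CA t x.1).symm
  have h2 : expSeries s * C (coeff n (expSeries t)) =
      φ (coeff n (expSeries t)) * expSeries s := by
    change _ = expSeries s * C (coeff n (expSeries t)) * expSeries (fun n => -s n) * expSeries s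
    rw [mul_assoc _ _ (expSeries s), hE, mul_one]
  have h3 := congrArg (coeff m) h2
  rw [coeff_mul_C, h1, Finset.sum_mul, map_sum, Finset.Nat.sum_antidiagonal_eq_sum_range_succ_mk,
    ← Finset.sum_range_reflect] at h3
  rw [h3]
  -- After reflection `j` counts the contracted degree. The factor `X^j` kills the terms with `j >
  -- m`, which turns the range up to `n` into one up to `min m n`.
  have h4 : ∀ j ∈ Finset.range (n + 1), coeff m (C (coeff (n + 1 - 1 - j) (expSeries t)) *
      (coeff (n - (n + 1 - 1 - j)) (expSeries c) • X ^ (n - (n + 1 - 1 - j))) * expSeries s) =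
      if j ≤ m then coeff j (expSeries c) • (coeff (n - j) (expSeries t) *
        coeff (m - j) (expSeries s)) else 0 := by
    intro j hj
    have hj' : j ≤ n := by simpa [Nat.lt_succ_iff] using hj
    rw [Nat.add_sub_cancel, Nat.sub_sub_self hj', mul_smul_comm, smul_mul_assoc,
      PowerSeries.coeff_smul, mul_assoc, coeff_C_mul, coeff_X_pow_mul']
    split_ifs <;> simp
  rw [Finset.sum_congr rfl h4, ← Finset.sum_filter]
  refine Finset.sum_congr ?_ fun _ _ => rfl
  ext j
  simp only [Finset.mem_filter, Finset.mem_range]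
  omega

end Exponential

/-! ### The Heisenberg operators on the Fock space and their exponentials -/

section Heisenberg

variable {ι : Type*} (A : ι → ι → ℤ) (q : ℂ)

/-- The scalar `[a_i(n), a_j(-n)]`, as a function of `r = (α_i|α_j)`. -/
def bracket (q : ℂ) (r : ℤ) (n : ℕ) : ℂ :=
  qInt q (r * n) / (2 * n) * ((q ^ n - q⁻¹ ^ n) / (q - q⁻¹))

theorem heis_pos {n : ℕ} (hn : Odd n) (i : ι) : heis A q i n = annih A q i n := by
  have h0 : (0 : ℤ) < n := by exact_mod_cast hn.pos
  rw [heis, dif_pos (by simpa using hn), if_pos h0, Int.natAbs_natCast]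

theorem heis_neg {n : ℕ} (hn : Odd n) (i : ι) :
    heis A q i (-(n : ℤ)) = LinearMap.mulLeft ℂ (MvPolynomial.X (i, ⟨n, hn⟩)) := by
  have h0 : ¬ (0 : ℤ) < -(n : ℤ) := by omega
  have h1 : Odd (-(n : ℤ)).natAbs := by simpa using hn
  rw [heis, dif_pos h1, if_neg h0]
  congr 3
  ext
  simp

/-- The commutator of two derivations is a derivation, and it kills every variable because both send
variables to constants. -/
theorem annih_commute (i j : ι) (m n : ℕ) : Commute (annih A q i m) (annih A q j n) := by
  have h : ∀ D₁ D₂ : Derivation ℂ (Fock ι) (Fock ι),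
      (∀ x, ∃ c, D₁ (MvPolynomial.X x) = MvPolynomial.C c) →
      (∀ x, ∃ c, D₂ (MvPolynomial.X x) = MvPolynomial.C c) → ⁅D₁, D₂⁆ = 0 := by
    intro D₁ D₂ h₁ h₂
    refine MvPolynomial.derivation_ext fun x => ?_
    obtain ⟨c₁, h₁⟩ := h₁ x
    obtain ⟨c₂, h₂⟩ := h₂ x
    rw [Derivation.commutator_apply, h₁, h₂]
    simp
  have hX : ∀ (i : ι) (n : ℕ) (x : Var ι), ∃ c, MvPolynomial.mkDerivation ℂ (fun x : Var ι =>
      if x.2.1 = n then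
        (MvPolynomial.C (qInt q (A i x.1 * n) / (2 * n) * ((q ^ n - q⁻¹ ^ n) / (q - q⁻¹))) : Fock ι)
      else 0) (MvPolynomial.X x) = MvPolynomial.C c := by
    intro i n x
    rw [MvPolynomial.mkDerivation_X]
    split_ifs
    · exact ⟨_, rfl⟩
    · exact ⟨0, by simp⟩
  refine LinearMap.ext fun v => ?_
  have := DFunLike.congr_fun (h _ _ (hX i m) (hX j n)) v
  rw [Derivation.commutator_apply] at this
  exact sub_eq_zero.1 this

theorem annih_mul_mulLeft (i j : ι) (m n : ℕ) (hn : Odd n) :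
    annih A q i m * LinearMap.mulLeft ℂ (MvPolynomial.X (j, ⟨n, hn⟩)) =
      LinearMap.mulLeft ℂ (MvPolynomial.X (j, ⟨n, hn⟩)) * annih A q i m +
        if m = n then algebraMap ℂ _ (bracket q (A i j) n) else 0 := by
  refine LinearMap.ext fun v => ?_
  rw [Module.End.mul_apply, LinearMap.add_apply, Module.End.mul_apply, LinearMap.mulLeft_apply,
    LinearMap.mulLeft_apply, annih, Derivation.coeFn_coe, Derivation.leibniz,
    MvPolynomial.mkDerivation_X, smul_eq_mul, smul_eq_mul]
  congr 1
  by_cases h : m = n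
  · subst h
    simp [MvPolynomial.smul_eq_C_mul, bracket, mul_comm, Module.algebraMap_end_apply]
    ring
  · rw [if_neg (fun h' => h h'.symm), if_neg h]
    simp

/-- The coefficients of `∑_{n > 0 odd} c n a_i(-n) z^n`. -/
def creation (i : ι) (c : ℕ → ℂ) (n : ℕ) : Module.End ℂ (Fock ι) :=
  if Odd n then c n • heis A q i (-(n : ℤ)) else 0

/-- The coefficients of `∑_{n > 0 odd} c n a_i(n) z^{-n}`. -/
def annihilation (i : ι) (c : ℕ → ℂ) (n : ℕ) : Module.End ℂ (Fock ι) :=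
  if Odd n then c n • heis A q i (n : ℤ) else 0

@[simp] theorem creation_zero (i : ι) (c : ℕ → ℂ) : creation A q i c 0 = 0 := by simp [creation]

@[simp] theorem annihilation_zero (i : ι) (c : ℕ → ℂ) : annihilation A q i c 0 = 0 := by
  simp [annihilation]

theorem creation_commute (i j : ι) (c d : ℕ → ℂ) (m n : ℕ) :
    Commute (creation A q i c m) (creation A q j d n) := by
  rw [creation, creation]
  split_ifs with hm hn
  · rw [heis_neg A q hm, heis_neg A q hn]
    refine (Commute.smul_left ?_ _).smul_right _
    refine LinearMap.ext fun v => ?_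
    simp [mul_left_comm]
  all_goals simp

theorem annihilation_commute (i j : ι) (c d : ℕ → ℂ) (m n : ℕ) :
    Commute (annihilation A q i c m) (annihilation A q j d n) := by
  rw [annihilation, annihilation]
  split_ifs with hm hn
  · rw [heis_pos A q hm, heis_pos A q hn]
    exact ((annih_commute A q i j m n).smul_left _).smul_right _
  all_goals simp

/-- The scalars `[c n a_i(n), d n a_j(-n)]` for `n` odd, as a function of `r = (α_i|α_j)`. -/
def contraction (q : ℂ) (r : ℤ) (c d : ℕ → ℂ) (n : ℕ) : ℂ :=
  if Odd n then c n * d n * bracket q r n else 0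

theorem annihilation_mul_creation (i j : ι) (c d : ℕ → ℂ) (m n : ℕ) :
    annihilation A q i c m * creation A q j d n =
      creation A q j d n * annihilation A q i c m +
        if m = n then algebraMap ℂ _ (contraction q (A i j) c d n) else 0 := by
  by_cases hm : Odd m
  · by_cases hn : Odd n
    · rw [annihilation, creation, if_pos hm, if_pos hn, heis_pos A q hm, heis_neg A q hn,
        contraction, if_pos hn, smul_mul_smul_comm, smul_mul_smul_comm, annih_mul_mulLeft,
        smul_add, mul_comm (d n)]
      congr 1
      split_ifs with h
      · rw [h, Algebra.algebraMap_eq_smul_one, Algebra.algebraMap_eq_smul_one, smul_smul]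
      · simp
    · rw [creation, if_neg hn, if_neg (fun h : m = n => hn (h ▸ hm))]; simp
  · rw [annihilation, if_neg hm]
    simp only [zero_mul, mul_zero, zero_add]
    split_ifs with h
    · rw [contraction, if_neg (h ▸ hm), map_zero]
    · rfl

theorem contraction_zero (r : ℤ) (c d : ℕ → ℂ) : contraction q r c d 0 = 0 := by
  simp [contraction]

theorem exp_annihilation_mul_exp_creation (i j : ι) (c d : ℕ → ℂ) (m n : ℕ) :
    coeff m (expSeries (annihilation A q i c)) * coeff n (expSeries (creation A q j d)) =
      ∑ k ∈ Finset.range (min m n + 1), coeff k (expSeries (contraction q (A i j) c d)) •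
        (coeff (n - k) (expSeries (creation A q j d)) *
          coeff (m - k) (expSeries (annihilation A q i c))) :=
  coeff_expSeries_mul_coeff_expSeries (by simp) (by simp) (contraction_zero q _ c d)
    (annihilation_commute A q i i c c) (creation_commute A q j j d d)
    (annihilation_mul_creation A q i j c d) m n

/-- In this order the commutator changes sign, and the annihilating index comes first, hence `A j
i`. -/
theorem exp_creation_mul_exp_annihilation (i j : ι) (c d : ℕ → ℂ) (m n : ℕ) :
    coeff m (expSeries (creation A q i c)) * coeff n (expSeries (annihilation A q j d)) =
      ∑ k ∈ Finset.range (min m n + 1),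
        coeff k (expSeries fun l => -contraction q (A j i) d c l) •
        (coeff (n - k) (expSeries (annihilation A q j d)) *
          coeff (m - k) (expSeries (creation A q i c))) := by
  refine coeff_expSeries_mul_coeff_expSeries (by simp) (by simp) (by simp [contraction_zero])
    (creation_commute A q i i c c) (annihilation_commute A q j j d d) (fun m n => ?_) m n
  rw [annihilation_mul_creation, add_assoc]
  by_cases h : m = n
  · simp [h]
  · simp [h, Ne.symm h]

theorem commute_exp_creation (i j : ι) (c d : ℕ → ℂ) (m n : ℕ) :
    Commute (coeff m (expSeries (creation A q i c))) (coeff n (expSeries (creation A q j d))) :=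
  commute_coeff_expSeries_expSeries (creation_commute A q i j c d) m n

theorem commute_exp_annihilation (i j : ι) (c d : ℕ → ℂ) (m n : ℕ) :
    Commute (coeff m (expSeries (annihilation A q i c)))
      (coeff n (expSeries (annihilation A q j d))) :=
  commute_coeff_expSeries_expSeries (annihilation_commute A q i j c d) m n

theorem annihilation_mem_lowers (i : ι) (c : ℕ → ℂ) (n : ℕ) :
    annihilation A q i c n ∈ lowers ι n := by
  rw [annihilation]
  split_ifs with h
  · rw [heis_pos A q h]
    exact Submodule.smul_mem _ _ (annih_mem_lowers A q i n)
  · exact Submodule.zero_mem _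

theorem exp_annihilation_mem_lowers (i : ι) (c : ℕ → ℂ) (n : ℕ) :
    coeff n (expSeries (annihilation A q i c)) ∈ lowers ι n := by
  rw [expSeries, PowerSeries.coeff_mk]
  exact Submodule.sum_mem _ fun j _ => Submodule.smul_mem _ _
    (coeff_pow_mem_lowers (annihilation_mem_lowers A q i c) j n)

theorem exists_mem_filt (v : Fock ι) : ∃ D : ℕ, v ∈ filt ι D := by
  refine ⟨v.support.sup wt, fun m hm => ?_⟩
  exact_mod_cast Finset.le_sup (f := wt) (MvPolynomial.mem_support_iff.2 hm)

theorem eq_zero_of_mem_filt {v : Fock ι} {d : ℤ} (hd : d < 0) (hv : v ∈ filt ι d) : v = 0 := by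
  ext m
  by_contra hm
  have := hv m hm
  omega

/-- Degree reasons alone: a vector of degree at most `D` is killed by anything lowering the degree
by more than `D`. Hence the bound depends neither on the indices nor on the coefficients of the
exponents. -/
theorem exists_exp_annihilation_eq_zero (v : Fock ι) : ∃ K : ℕ,
    (∀ (i : ι) (c : ℕ → ℂ) (k : ℕ), K ≤ k → coeff k (expSeries (annihilation A q i c)) v = 0) ∧
    ∀ (i j : ι) (c d : ℕ → ℂ) (k l : ℕ), K ≤ k ∨ K ≤ l →
      coeff k (expSeries (annihilation A q i c))
        (coeff l (expSeries (annihilation A q j d)) v) = 0 := by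
  obtain ⟨D, hD⟩ := exists_mem_filt v
  refine ⟨D + 1, fun i c k hk => ?_, fun i j c d k l hkl => ?_⟩
  · exact eq_zero_of_mem_filt (by omega) (exp_annihilation_mem_lowers A q i c k D v hD)
  · exact eq_zero_of_mem_filt (by omega) (exp_annihilation_mem_lowers A q i c k _ _
      (exp_annihilation_mem_lowers A q j d l D v hD))

end Heisenberg

/-! ### Coefficients of power series indexed by the integers -/

section Coefficients

variable {R : Type*} [Ring R]

theorem zcoeff_natCast (f : PowerSeries R) (n : ℕ) : zcoeff f (n : ℤ) = coeff n f := by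
  rw [zcoeff, if_pos (Int.natCast_nonneg n), Int.toNat_natCast]

theorem zcoeff_of_neg (f : PowerSeries R) {n : ℤ} (hn : n < 0) : zcoeff f n = 0 := by
  rw [zcoeff, if_neg (not_le.2 hn)]

theorem zcoeff_add (f g : PowerSeries R) (n : ℤ) : zcoeff (f + g) n = zcoeff f n + zcoeff g n := by
  simp only [zcoeff]; split_ifs <;> simp

theorem zcoeff_smul [Algebra ℂ R] (c : ℂ) (f : PowerSeries R) (n : ℤ) : zcoeff (c • f) n = c • zcoeff f n := by
  simp only [zcoeff]; split_ifs <;> simp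

theorem zcoeff_neg (f : PowerSeries R) (n : ℤ) : zcoeff (-f) n = -zcoeff f n := by
  simp only [zcoeff]; split_ifs <;> simp

theorem zcoeff_sum {α : Type*} (s : Finset α) (f : α → PowerSeries R) (n : ℤ) :
    zcoeff (∑ x ∈ s, f x) n = ∑ x ∈ s, zcoeff (f x) n := by
  simp only [zcoeff]; split_ifs <;> simp

theorem zcoeff_one (n : ℤ) : zcoeff (1 : PowerSeries R) n = if n = 0 then 1 else 0 := by
  rcases lt_or_ge n 0 with h | h
  · rw [zcoeff_of_neg _ h, if_neg h.ne]
  · lift n to ℕ using h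
    rw [zcoeff_natCast, coeff_one]; simp

theorem zcoeff_X_pow_mul (f : PowerSeries R) (k : ℕ) (n : ℤ) :
    zcoeff (X ^ k * f) n = zcoeff f (n - k) := by
  rcases lt_or_ge n 0 with h | h
  · rw [zcoeff_of_neg _ h, zcoeff_of_neg _ (by omega)]
  · lift n to ℕ using h
    rw [zcoeff_natCast, coeff_X_pow_mul']
    split_ifs with h
    · rw [← Nat.cast_sub h, zcoeff_natCast]
    · rw [zcoeff_of_neg _ (by omega)]

/-- The series `f(c x)`, for a scalar `c`. -/
def scale [Algebra ℂ R] (c : ℂ) (f : PowerSeries R) : PowerSeries R := PowerSeries.mk fun n => c ^ n • coeff n f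

theorem scale_expSeries [Algebra ℂ R] (c : ℂ) (s : ℕ → R) :
    scale c (expSeries s) = expSeries fun n => c ^ n • s n := by
  ext n; rw [scale, coeff_mk, coeff_expSeries_pow_smul]

end Coefficients

/-! ### Products of scalar series in `w/z` with operator-valued distributions -/

section Pairing

variable {M : Type*} [AddCommGroup M] [Module ℂ M]

theorem finsum_int_eq_sum_range {M : Type*} [AddCommGroup M] {u : ℤ → M} {H : ℕ} (hneg : ∀ i < 0, u i = 0)
    (hu : ∀ h : ℕ, H ≤ h → u h = 0) : ∑ᶠ i : ℤ, u i = ∑ h ∈ Finset.range H, u h := by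
  rw [finsum_eq_sum_of_support_subset (s := (Finset.range H).map Nat.castEmbedding)]
  · simp
  · intro i hi
    rcases lt_or_ge i 0 with h | h
    · exact absurd (hneg i h) hi
    · lift i to ℕ using h
      simp only [Finset.coe_map, Nat.castEmbedding_apply, Set.mem_image, Finset.mem_coe,
        Finset.mem_range, Nat.cast_inj, exists_eq_right]
      by_contra hH
      exact hi (hu i (not_lt.1 hH))

theorem finsum_zcoeff_smul (f : PowerSeries ℂ) (u : ℤ → M) {H : ℕ}
    (hu : ∀ h : ℕ, H ≤ h → u h = 0) :
    ∑ᶠ i : ℤ, zcoeff f i • u i = ∑ h ∈ Finset.range H, coeff h f • u h := by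
  rw [finsum_int_eq_sum_range (H := H)]
  · simp only [zcoeff_natCast]
  · intro i hi; rw [zcoeff_of_neg _ hi, zero_smul]
  · intro h hh; rw [hu h hh, smul_zero]

/-- The product of `φ(w/z)` and `n(z, w)`, where `φ(x) = ∑ φ i x^i`. -/
def pairing (φ : ℤ → ℂ) (n : ℤ → ℤ → M) (a b : ℤ) : M := ∑ᶠ i : ℤ, φ i • n (a + i) (b - i)

/-- Each homogeneous component of `n(z, w)` is a finite sum. -/
def LineFinite (n : ℤ → ℤ → M) : Prop :=
  ∀ a b, (Function.support fun i : ℤ => n (a + i) (b - i)).Finite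

theorem LineFinite.smul {n : ℤ → ℤ → M} (hn : LineFinite n) (φ : ℤ → ℂ) (a b : ℤ) :
    (Function.support fun i : ℤ => φ i • n (a + i) (b - i)).Finite :=
  (hn a b).subset fun i hi h => hi (by
    change φ i • n (a + i) (b - i) = 0
    rw [show n (a + i) (b - i) = 0 from h, smul_zero])

theorem pairing_smul {n : ℤ → ℤ → M} (hn : LineFinite n) (φ : ℤ → ℂ) (s : ℂ) (a b : ℤ) :
    s • pairing φ n a b = pairing (fun i => s * φ i) n a b := by
  simp only [pairing]
  rw [smul_finsum' s (hn.smul φ a b)]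
  exact finsum_congr fun i => by rw [mul_smul]

theorem pairing_add {n : ℤ → ℤ → M} (hn : LineFinite n) (φ χ : ℤ → ℂ) (a b : ℤ) :
    pairing φ n a b + pairing χ n a b = pairing (fun i => φ i + χ i) n a b := by
  simp only [pairing]
  rw [← finsum_add_distrib (hn.smul φ a b) (hn.smul χ a b)]
  exact finsum_congr fun i => by rw [add_smul]

theorem pairing_sub_smul {n : ℤ → ℤ → M} (hn : LineFinite n) (φ χ : ℤ → ℂ) (s : ℂ) (a b : ℤ) :
    pairing φ n a b - s • pairing χ n a b = pairing (fun i => φ i - s * χ i) n a b := by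
  rw [sub_eq_add_neg, ← neg_smul, pairing_smul hn, pairing_add hn]
  simp only [neg_mul, sub_eq_add_neg]

/-- The product of `P(1, x)` and `φ(x) = ∑ φ i x^i`. -/
def star (P : MvPolynomial (Fin 2) ℂ) (φ : ℤ → ℂ) (i : ℤ) : ℂ :=
  ∑ m ∈ P.support, P.coeff m * φ (i - m 1)

/-- Homogeneity gives `P(z, w) = z^e P(1, w/z)`, so multiplying by `P` multiplies the scalar series
by `P(1, x)` and shifts the power of `z` by `e`. -/
theorem polyMul_apply_eq_pairing {P : MvPolynomial (Fin 2) ℂ} {e : ℕ} (hP : P.IsHomogeneous e)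
    {F : ℤ → ℤ → Module.End ℂ M} {v : M} {φ : ℤ → ℂ} {n : ℤ → ℤ → M} (hn : LineFinite n)
    (hF : ∀ a b, F a b v = pairing φ n a b) (a b : ℤ) :
    polyMul P F a b v = pairing (star P φ) n (a - e) b := by
  have h : ∀ m ∈ P.support, P.coeff m • F (a - m 0) (b - m 1) v =
      ∑ᶠ i : ℤ, (P.coeff m * φ (i - m 1)) • n (a - e + i) (b - i) := by
    intro m hm
    have he : (m 0 : ℤ) + m 1 = e := by
      have := hP (MvPolynomial.mem_support_iff.1 hm)
      rw [Finsupp.weight_apply, Finsupp.sum_fintype _ _ (by simp)] at this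
      simp at this
      exact_mod_cast this
    -- Shifting the summation index by the exponent of `w` puts all monomials on the same line, as
    -- the two exponents add up to `e`.
    rw [hF, pairing_smul hn, pairing,
      ← finsum_comp_equiv (Equiv.subRight (m 1 : ℤ))]
    refine finsum_congr fun i => ?_
    rw [Equiv.subRight_apply, show a - m 0 + (i - m 1) = a - e + i by omega,
      show b - m 1 - (i - m 1) = b - i by omega]
  rw [polyMul, LinearMap.sum_apply]
  simp_rw [LinearMap.smul_apply]
  rw [Finset.sum_congr rfl h, ← finsum_sum_comm, pairing]
  · refine finsum_congr fun i => ?_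
    rw [star, Finset.sum_smul]
  · intro m _
    exact hn.smul (fun i => P.coeff m * φ (i - m 1)) _ _

/-- The series `P(1, x)`. -/
def dehomogenize (P : MvPolynomial (Fin 2) ℂ) : PowerSeries ℂ :=
  MvPolynomial.aeval ![1, (X : PowerSeries ℂ)] P

/-- The series `P(x, 1)`. -/
def dehomogenize' (P : MvPolynomial (Fin 2) ℂ) : PowerSeries ℂ :=
  MvPolynomial.aeval ![(X : PowerSeries ℂ), 1] P

theorem star_zcoeff (P : MvPolynomial (Fin 2) ℂ) (f : PowerSeries ℂ) (i : ℤ) :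
    star P (zcoeff f) i = zcoeff (dehomogenize P * f) i := by
  have : dehomogenize P * f = ∑ m ∈ P.support, P.coeff m • (X ^ (m 1) * f) := by
    rw [dehomogenize, MvPolynomial.aeval_eq_eval₂Hom, MvPolynomial.coe_eval₂Hom,
      MvPolynomial.eval₂_eq', Finset.sum_mul]
    refine Finset.sum_congr rfl fun m _ => ?_
    rw [Algebra.smul_def]; simp [mul_assoc]
  rw [this, zcoeff_sum, star]
  refine Finset.sum_congr rfl fun m _ => ?_
  rw [zcoeff_smul, zcoeff_X_pow_mul, smul_eq_mul]

/-- Here the series is `f(1/x)`, and `P(1, x) f(1/x) = x^e (P(y, 1) f(y))` at `y = 1/x`. -/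
theorem star_zcoeff_neg {P : MvPolynomial (Fin 2) ℂ} {e : ℕ} (hP : P.IsHomogeneous e)
    (f : PowerSeries ℂ) (i : ℤ) :
    star P (fun j => zcoeff f (-j)) i = zcoeff (dehomogenize' P * f) (e - i) := by
  have : dehomogenize' P * f = ∑ m ∈ P.support, P.coeff m • (X ^ (m 0) * f) := by
    rw [dehomogenize', MvPolynomial.aeval_eq_eval₂Hom, MvPolynomial.coe_eval₂Hom,
      MvPolynomial.eval₂_eq', Finset.sum_mul]
    refine Finset.sum_congr rfl fun m _ => ?_
    rw [Algebra.smul_def]; simp [mul_assoc]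
  rw [this, zcoeff_sum, star]
  refine Finset.sum_congr rfl fun m hm => ?_
  have he : (m 0 : ℤ) + m 1 = e := by
    have := hP (MvPolynomial.mem_support_iff.1 hm)
    rw [Finsupp.weight_apply, Finsupp.sum_fintype _ _ (by simp)] at this
    simp at this
    exact_mod_cast this
  rw [zcoeff_smul, zcoeff_X_pow_mul, smul_eq_mul]
  congr 2
  omega

/-- The two dehomogenizations are reversals of each other; both sides compute the coefficients of
`P(1, x)` by the two preceding lemmas with `f = 1`. -/
theorem zcoeff_dehomogenize' {P : MvPolynomial (Fin 2) ℂ} {e : ℕ} (hP : P.IsHomogeneous e)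
    (i : ℤ) : zcoeff (dehomogenize' P) (e - i) = zcoeff (dehomogenize P) i := by
  have h1 := star_zcoeff P 1 i
  have h2 := star_zcoeff_neg hP 1 i
  rw [mul_one] at h1 h2
  rw [← h1, ← h2]
  congr 1
  ext j
  rw [zcoeff_one, zcoeff_one]
  simp

end Pairing

/-! ### Normally ordered products: contraction and specialization -/

section NormalOrder

variable {M : Type*} [AddCommGroup M] [Module ℂ M]

/-- The coefficient at `z^a w^b` of `M₁(z) M₂(w) P₁(z) P₂(w) v`, where the `P_i` are series in
`z⁻¹`, `w⁻¹` of which only `K` terms contribute. -/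
def normalOrder (M₁ M₂ P₁ P₂ : PowerSeries (Module.End ℂ M)) (K : ℕ) (v : M) (a b : ℤ) : M :=
  ∑ k ∈ Finset.range K, ∑ l ∈ Finset.range K,
    zcoeff M₁ (a + k) (zcoeff M₂ (b + l) (coeff k P₁ (coeff l P₂ v)))

variable {M₁ M₂ P₁ P₂ : PowerSeries (Module.End ℂ M)} {K : ℕ} {v : M}

/-- The creation series have no negative powers, and the annihilation series contribute fewer than
`K` to each exponent; this bounds the line on both sides. -/
theorem lineFinite_normalOrder : LineFinite (normalOrder M₁ M₂ P₁ P₂ K v) := by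
  intro a b
  refine (Set.finite_Icc (-a - K) (b + K)).subset fun i hi => ?_
  by_contra h
  refine hi (Finset.sum_eq_zero fun k hk => Finset.sum_eq_zero fun l hl => ?_)
  have hk := Finset.mem_range.1 hk
  have hl := Finset.mem_range.1 hl
  rw [Set.mem_Icc, not_and_or, not_le, not_le] at h
  rcases h with h | h
  · rw [zcoeff_of_neg M₁ (by omega), LinearMap.zero_apply]
  · rw [zcoeff_of_neg M₂ (by omega), LinearMap.zero_apply, map_zero]

theorem normalOrder_swap (hM : ∀ m n, Commute (coeff m M₁) (coeff n M₂))
    (hP : ∀ m n, Commute (coeff m P₁) (coeff n P₂)) (a b : ℤ) :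
    normalOrder M₁ M₂ P₁ P₂ K v a b = normalOrder M₂ M₁ P₂ P₁ K v b a := by
  rw [normalOrder, Finset.sum_comm]
  refine Finset.sum_congr rfl fun l _ => Finset.sum_congr rfl fun k _ => ?_
  have h1 : Commute (zcoeff M₁ (a + k)) (zcoeff M₂ (b + l)) := by
    simp only [zcoeff]
    split_ifs <;> simp [hM]
  rw [← Module.End.mul_apply (coeff k P₁), (hP k l).eq, ← Module.End.mul_apply (zcoeff M₁ _),
    h1.eq]
  rfl

theorem sum_range_zcoeff_shift {g : ℕ → Module.End ℂ M} {P : PowerSeries (Module.End ℂ M)}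
    {w : M} (hw : ∀ k, K ≤ k → coeff k P w = 0) {h N : ℕ} (hN : K + h ≤ N) :
    ∑ k ∈ Finset.range N, g k (zcoeff P ((k : ℤ) - h) w) =
      ∑ k ∈ Finset.range K, g (k + h) (coeff k P w) := by
  have e1 : ∑ k ∈ Finset.range N, g k (zcoeff P ((k : ℤ) - h) w) =
      ∑ k ∈ Finset.range (N - h), g (k + h) (coeff k P w) := by
    rw [show N = h + (N - h) by omega, Finset.sum_range_add, Finset.sum_eq_zero, zero_add,
      Nat.add_sub_cancel_left]
    · refine Finset.sum_congr rfl fun k _ => ?_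
      rw [add_comm h k, show ((k + h : ℕ) : ℤ) - h = k by push_cast; ring, zcoeff_natCast]
    · intro k hk
      have := Finset.mem_range.1 hk
      rw [zcoeff_of_neg _ (by omega), LinearMap.zero_apply, map_zero]
  rw [e1]
  refine (Finset.sum_subset (Finset.range_subset_range.2 (by omega)) fun k _ hk => ?_).symm
  rw [hw k (by simpa using hk), map_zero]

theorem finsum_eq_sum_range_of_eq_zero {M : Type*} [AddCommGroup M] {u : ℕ → M} (hu : ∀ k, K ≤ k → u k = 0) :
    ∑ᶠ k, u k = ∑ k ∈ Finset.range K, u k := by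
  refine finsum_eq_sum_of_support_subset _ fun k hk => ?_
  by_contra h
  exact hk (hu k (by simpa using h))

/-- Moving `P₁` past one coefficient of `M₂`. A contraction of degree `h` lowers the index of `M₂`
by `h` and raises that of `M₁` by `h`, which is multiplication by `(w/z)^h`. -/
theorem finsum_vertex_apply {f : PowerSeries ℂ}
    (hf : ∀ m n, coeff m P₁ * coeff n M₂ = ∑ k ∈ Finset.range (min m n + 1),
      coeff k f • (coeff (n - k) M₂ * coeff (m - k) P₁))
    {w : M} (hw : ∀ k, K ≤ k → coeff k P₁ w = 0) (a n : ℤ) {H : ℕ} (hH : n < H) :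
    ∑ᶠ k : ℕ, zcoeff M₁ (a + k) (coeff k P₁ (zcoeff M₂ n w)) =
      ∑ h ∈ Finset.range H, coeff h f •
        ∑ k ∈ Finset.range K, zcoeff M₁ (a + h + k) (zcoeff M₂ (n - h) (coeff k P₁ w)) := by
  rcases lt_or_ge n 0 with hn | hn
  · rw [zcoeff_of_neg _ hn]
    simp only [LinearMap.zero_apply, map_zero, finsum_zero]
    refine (Finset.sum_eq_zero fun h _ => ?_).symm
    rw [Finset.sum_eq_zero, smul_zero]
    intro k _
    rw [zcoeff_of_neg M₂ (by omega), LinearMap.zero_apply, map_zero]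
  lift n to ℕ using hn
  have h1 : ∀ k, coeff k P₁ (zcoeff M₂ n w) = ∑ h ∈ Finset.range H,
      coeff h f • zcoeff M₂ (n - h) (zcoeff P₁ ((k : ℤ) - h) w) := by
    intro k
    rw [zcoeff_natCast, ← Module.End.mul_apply, hf, LinearMap.sum_apply]
    have h2 : ∀ h ∈ Finset.range (min k n + 1),
        (coeff h f • (coeff (n - h) M₂ * coeff (k - h) P₁)) w =
        coeff h f • zcoeff M₂ (n - h) (zcoeff P₁ ((k : ℤ) - h) w) := by
      intro h hh
      have hh := Finset.mem_range.1 hh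
      rw [← Nat.cast_sub (by omega), ← Nat.cast_sub (by omega), zcoeff_natCast, zcoeff_natCast]
      rfl
    rw [Finset.sum_congr rfl h2]
    refine Finset.sum_subset (Finset.range_subset_range.2 (by omega)) fun h _ hh => ?_
    simp only [Finset.mem_range, not_lt] at hh
    rcases le_or_gt h n with h3 | h3
    · rw [zcoeff_of_neg P₁ (by omega), LinearMap.zero_apply, map_zero, smul_zero]
    · rw [zcoeff_of_neg M₂ (by omega), LinearMap.zero_apply, smul_zero]
  -- Contractions of degree below `H` shift the cutoff `K` of `P₁` by less than `H`.
  rw [finsum_eq_sum_range_of_eq_zero (K := K + H)]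
  · simp_rw [h1, map_sum, map_smul]
    rw [Finset.sum_comm]
    refine Finset.sum_congr rfl fun h hh => ?_
    have hh := Finset.mem_range.1 hh
    have h3 := sum_range_zcoeff_shift (g := fun k => zcoeff M₁ (a + k) * zcoeff M₂ (n - h)) hw
      (show K + h ≤ K + H by omega)
    simp only [Module.End.mul_apply] at h3
    rw [← Finset.smul_sum, h3]
    congr 1
    refine Finset.sum_congr rfl fun k _ => ?_
    congr 2
    push_cast; ring
  · intro k hk
    rw [h1, Finset.sum_eq_zero, map_zero]
    intro h hh
    have hh := Finset.mem_range.1 hh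
    rw [show (k : ℤ) - h = ((k - h : ℕ) : ℤ) by omega, zcoeff_natCast, hw _ (by omega), map_zero,
      smul_zero]

theorem vertex_mul_vertex {f : PowerSeries ℂ} {X₁ X₂ : ℤ → Module.End ℂ M}
    (hX₁ : ∀ a u, X₁ a u = ∑ᶠ k : ℕ, zcoeff M₁ (a + k) (coeff k P₁ u))
    (hX₂ : ∀ a u, X₂ a u = ∑ᶠ k : ℕ, zcoeff M₂ (a + k) (coeff k P₂ u))
    (hf : ∀ m n, coeff m P₁ * coeff n M₂ = ∑ k ∈ Finset.range (min m n + 1),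
      coeff k f • (coeff (n - k) M₂ * coeff (m - k) P₁))
    (hK₂ : ∀ l, K ≤ l → coeff l P₂ v = 0)
    (hK : ∀ k l, K ≤ k ∨ K ≤ l → coeff k P₁ (coeff l P₂ v) = 0) (a b : ℤ) :
    (X₁ a * X₂ b) v = pairing (zcoeff f) (normalOrder M₁ M₂ P₁ P₂ K v) a b := by
  rw [Module.End.mul_apply, hX₂, finsum_eq_sum_range_of_eq_zero (K := K)
    (fun k hk => by rw [hK₂ k hk, map_zero]), map_sum, pairing,
    -- For `h ≥ b + K` every index `b - h + l` with `l < K` is negative, so the normally ordered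
    -- product vanishes there.
    finsum_zcoeff_smul (H := (b + K).toNat)]
  · simp_rw [normalOrder, hX₁]
    have : ∀ l ∈ Finset.range K, ∑ᶠ k : ℕ, zcoeff M₁ (a + k)
        (coeff k P₁ (zcoeff M₂ (b + l) (coeff l P₂ v))) =
        ∑ h ∈ Finset.range (b + K).toNat, coeff h f •
          ∑ k ∈ Finset.range K, zcoeff M₁ (a + h + k) (zcoeff M₂ (b + l - h)
            (coeff k P₁ (coeff l P₂ v))) := by
      intro l hl
      have hl := Finset.mem_range.1 hl
      exact finsum_vertex_apply hf (fun k hk => hK k l (Or.inl hk)) a _ (by omega)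
    rw [Finset.sum_congr rfl this, Finset.sum_comm]
    refine Finset.sum_congr rfl fun h _ => ?_
    rw [← Finset.smul_sum, Finset.sum_comm]
    simp_rw [add_sub_right_comm b]
  · intro h hh
    refine Finset.sum_eq_zero fun k _ => Finset.sum_eq_zero fun l hl => ?_
    have hl := Finset.mem_range.1 hl
    rw [zcoeff_of_neg M₂ (by omega), LinearMap.zero_apply, map_zero]

/-- The creation half of the substitution `w = c⁻¹ z` made by `δ(c w/z)`. -/
theorem finsum_zpow_smul_zcoeff {c : ℂ} (hc : c ≠ 0) (a b : ℤ) (u : M) :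
    ∑ᶠ i : ℤ, c ^ i • zcoeff M₁ (a + i) (zcoeff M₂ (b - i) u) =
      c ^ b • zcoeff (M₁ * scale c⁻¹ M₂) (a + b) u := by
  rw [← finsum_comp_equiv (Equiv.subLeft b)]
  simp only [Equiv.subLeft_apply, sub_sub_cancel]
  rcases lt_or_ge (a + b) 0 with h | h
  · rw [zcoeff_of_neg _ h, LinearMap.zero_apply, smul_zero]
    rw [finsum_congr (g := fun _ => 0), finsum_zero]
    intro j
    rcases lt_or_ge j 0 with hj | hj
    · rw [zcoeff_of_neg M₂ hj, LinearMap.zero_apply, map_zero, smul_zero]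
    · rw [zcoeff_of_neg M₁ (by omega), LinearMap.zero_apply, smul_zero]
  · obtain ⟨N, hN⟩ := Int.eq_ofNat_of_zero_le h
    rw [finsum_int_eq_sum_range (H := N + 1)]
    · rw [hN, zcoeff_natCast, coeff_mul, Finset.Nat.sum_antidiagonal_eq_sum_range_succ_mk,
        ← Finset.sum_range_reflect, LinearMap.sum_apply, Finset.smul_sum]
      refine Finset.sum_congr rfl fun j hj => ?_
      have hj : j ≤ N := by simpa [Nat.lt_succ_iff] using hj
      rw [Nat.add_sub_cancel, scale, coeff_mk, zcoeff_natCast,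
        show a + (b - ((N - j : ℕ) : ℤ)) = j by omega,
        zcoeff_natCast, mul_smul_comm, LinearMap.smul_apply, smul_smul, zpow_sub₀ hc,
        zpow_natCast, inv_pow, div_eq_mul_inv]
      rfl
    · intro j hj
      rw [zcoeff_of_neg M₂ hj, LinearMap.zero_apply, map_zero, smul_zero]
    · intro j hj
      rw [zcoeff_of_neg M₁ (by omega), LinearMap.zero_apply, smul_zero]

/-- The annihilation half of the same substitution: the series in `w⁻¹` becomes one in `c z⁻¹`.
Terms outside the box vanish, so the square can be summed along antidiagonals. -/
theorem sum_box_eq_sum_coeff_mul {c : ℂ} (hK : ∀ k l, K ≤ k ∨ K ≤ l → coeff k P₁ (coeff l P₂ v) = 0)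
    (g : ℕ → Module.End ℂ M) :
    ∑ k ∈ Finset.range K, ∑ l ∈ Finset.range K, c ^ l • g (k + l) (coeff k P₁ (coeff l P₂ v)) =
      ∑ m ∈ Finset.range (2 * K + 1), g m (coeff m (P₁ * scale c P₂) v) := by
  rw [← Finset.sum_product', ← Finset.sum_fiberwise_of_maps_to
    (t := Finset.range (2 * K + 1)) (g := fun x : ℕ × ℕ => x.1 + x.2)]
  · refine Finset.sum_congr rfl fun m _ => ?_
    rw [coeff_mul, LinearMap.sum_apply, map_sum]
    have : ∀ x ∈ Finset.HasAntidiagonal.antidiagonal m,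
        g m ((coeff x.1 P₁ * coeff x.2 (scale c P₂)) v) =
          c ^ x.2 • g (x.1 + x.2) (coeff x.1 P₁ (coeff x.2 P₂ v)) := by
      intro x hx
      rw [Finset.HasAntidiagonal.mem_antidiagonal.1 hx, scale, coeff_mk, mul_smul_comm,
        LinearMap.smul_apply, map_smul]
      rfl
    rw [Finset.sum_congr rfl this]
    refine Finset.sum_subset (fun x hx => ?_) fun x hx hx' => ?_
    · exact Finset.HasAntidiagonal.mem_antidiagonal.2 (Finset.mem_filter.1 hx).2
    · rw [hK x.1 x.2, map_zero, smul_zero]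
      have hx := Finset.HasAntidiagonal.mem_antidiagonal.1 hx
      simp only [Finset.mem_filter, Finset.mem_product, Finset.mem_range] at hx'
      omega
  · intro x hx
    simp only [Finset.mem_product, Finset.mem_range] at hx ⊢
    omega

/-- The identity `δ(c w/z) N(z, w) = δ(c w/z) N(z, c⁻¹ z)`, read off coefficientwise. -/
theorem pairing_zpow_normalOrder {c : ℂ} (hc : c ≠ 0)
    (hK : ∀ k l, K ≤ k ∨ K ≤ l → coeff k P₁ (coeff l P₂ v) = 0) (a b : ℤ) :
    pairing (fun i => c ^ i) (normalOrder M₁ M₂ P₁ P₂ K v) a b =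
      c ^ b • ∑ m ∈ Finset.range (2 * K + 1),
        zcoeff (M₁ * scale c⁻¹ M₂) (a + b + m) (coeff m (P₁ * scale c P₂) v) := by
  rw [← sum_box_eq_sum_coeff_mul hK fun m => zcoeff (M₁ * scale c⁻¹ M₂) (a + b + m), pairing]
  have hfin : ∀ (k l : ℕ) (u : M), (Function.support fun i : ℤ =>
      c ^ i • zcoeff M₁ (a + i + k) (zcoeff M₂ (b - i + l) u)).Finite := by
    intro k l u
    refine (Set.finite_Icc (-a - k) (b + l)).subset fun i hi => ?_
    by_contra h
    refine hi ?_
    rw [Set.mem_Icc, not_and_or, not_le, not_le] at h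
    change c ^ i • zcoeff M₁ (a + i + k) (zcoeff M₂ (b - i + l) u) = 0
    rcases h with h | h
    · rw [zcoeff_of_neg M₁ (by omega), LinearMap.zero_apply, smul_zero]
    · rw [zcoeff_of_neg M₂ (by omega), LinearMap.zero_apply, map_zero, smul_zero]
  simp_rw [normalOrder, Finset.smul_sum, ← Finset.sum_product']
  rw [finsum_sum_comm (Finset.range K ×ˢ Finset.range K) (fun (i : ℤ) (x : ℕ × ℕ) =>
    c ^ i • zcoeff M₁ (a + i + x.1) (zcoeff M₂ (b - i + x.2) (coeff x.1 P₁ (coeff x.2 P₂ v))))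
    fun x _ => hfin x.1 x.2 _]
  refine Finset.sum_congr rfl fun x _ => ?_
  have := finsum_zpow_smul_zcoeff (M₁ := M₁) (M₂ := M₂) hc (a + x.1) (b + x.2)
    (coeff x.1 P₁ (coeff x.2 P₂ v))
  simp_rw [add_right_comm a, add_sub_right_comm b] at this
  rw [this, smul_smul, zpow_add₀ hc, zpow_natCast]
  congr 3
  push_cast; ring

theorem pairing_zpow_of_left_eq_one {c : ℂ} (hc : c ≠ 0)
    (hK : ∀ k l, K ≤ k ∨ K ≤ l → coeff k P₁ (coeff l P₂ v) = 0)
    (h1 : M₁ * scale c⁻¹ M₂ = 1) (a b : ℤ) :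
    pairing (fun i => c ^ i) (normalOrder M₁ M₂ P₁ P₂ K v) a b =
      c ^ b • zcoeff (P₁ * scale c P₂) (-(a + b)) v := by
  rw [pairing_zpow_normalOrder hc hK, h1]
  congr 1
  simp_rw [zcoeff_one]
  rcases lt_or_ge (-(a + b)) 0 with h | h
  · rw [zcoeff_of_neg _ h, LinearMap.zero_apply]
    refine Finset.sum_eq_zero fun m _ => ?_
    rw [if_neg (by omega), LinearMap.zero_apply]
  · obtain ⟨N, hN⟩ := Int.eq_ofNat_of_zero_le h
    rw [hN, zcoeff_natCast]
    have h2 : ∀ m : ℕ, (a + b + m = 0) ↔ m = N := fun m => by omega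
    simp_rw [h2]
    by_cases h3 : N < 2 * K + 1
    · rw [Finset.sum_eq_single N (fun m _ hm => by rw [if_neg hm, LinearMap.zero_apply])
        fun h => absurd (Finset.mem_range.2 h3) h, if_pos rfl, Module.End.one_apply]
    -- Beyond degree `2 K` one of the two factors has degree at least `K`, so both sides are zero.
    · rw [Finset.sum_eq_zero, coeff_mul, LinearMap.sum_apply, Finset.sum_eq_zero]
      · intro x hx
        have hx := Finset.HasAntidiagonal.mem_antidiagonal.1 hx
        rw [scale, coeff_mk, mul_smul_comm, LinearMap.smul_apply, Module.End.mul_apply,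
          hK _ _ (by omega), smul_zero]
      · intro m hm
        have := Finset.mem_range.1 hm
        rw [if_neg (by omega), LinearMap.zero_apply]

theorem pairing_zpow_of_right_eq_one {c : ℂ} (hc : c ≠ 0)
    (hK : ∀ k l, K ≤ k ∨ K ≤ l → coeff k P₁ (coeff l P₂ v) = 0)
    (h1 : P₁ * scale c P₂ = 1) (a b : ℤ) :
    pairing (fun i => c ^ i) (normalOrder M₁ M₂ P₁ P₂ K v) a b =
      c ^ b • zcoeff (M₁ * scale c⁻¹ M₂) (a + b) v := by
  rw [pairing_zpow_normalOrder hc hK, h1]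
  congr 1
  rw [Finset.sum_eq_single 0]
  · simp
  · intro m _ hm
    rw [coeff_one, if_neg hm, LinearMap.zero_apply, map_zero]
  · simp

end NormalOrder

/-! ### Scalar series: logarithms of `(1 + c x)/(1 - c x)` and the contractions -/

section Scalars

theorem expSeries_add_scalar {s t : ℕ → ℂ} (hs : s 0 = 0) (ht : t 0 = 0) :
    expSeries (fun n => s n + t n) = expSeries s * expSeries t :=
  expSeries_add hs ht (fun _ _ => Commute.all _ _) (fun _ _ => Commute.all _ _)
    fun _ _ => Commute.all _ _

theorem expSeries_neg_mul_scalar {s : ℕ → ℂ} (hs : s 0 = 0) :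
    expSeries (fun n => -s n) * expSeries s = 1 :=
  expSeries_neg_mul hs fun _ _ => Commute.all _ _

theorem expSeries_sum_scalar {α : Type*} (I : Finset α) {s : α → ℕ → ℂ} (hs : ∀ k, s k 0 = 0) :
    expSeries (fun n => ∑ k ∈ I, s k n) = ∏ k ∈ I, expSeries (s k) := by
  classical
  induction I using Finset.induction_on with
  | empty => simpa using expSeries_zero (R := ℂ)
  | insert a I ha ih =>
    rw [Finset.prod_insert ha, ← ih, ← expSeries_add_scalar (hs a) (by simp [hs])]
    simp_rw [Finset.sum_insert ha]

theorem expSeries_neg_eq_inv {s : ℕ → ℂ} (hs : s 0 = 0) :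
    expSeries (fun n => -s n) = (expSeries s)⁻¹ := by
  rw [PowerSeries.eq_inv_iff_mul_eq_one (by simp), expSeries_neg_mul_scalar hs]

theorem rescale_expSeries (c : ℂ) (s : ℕ → ℂ) :
    rescale c (expSeries s) = expSeries fun n => c ^ n * s n := by
  ext n
  rw [coeff_rescale]
  exact (coeff_expSeries_pow_smul c s n).symm

/-- The geometric series `∑ c^n x^n`. -/
def geom (c : ℂ) : PowerSeries ℂ := PowerSeries.mk fun n => c ^ n

theorem one_sub_mul_geom (c : ℂ) : (1 - C c * X) * geom c = 1 := by
  ext n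
  rw [sub_mul, one_mul, mul_assoc, map_sub, coeff_C_mul, mul_comm X]
  cases n with
  | zero => simp [geom]
  | succ n => rw [coeff_succ_mul_X, geom, coeff_mk, coeff_mk, coeff_one]; simp [pow_succ']

theorem zcoeff_geom_of_nonneg (c : ℂ) {i : ℤ} (hi : 0 ≤ i) : zcoeff (geom c) i = c ^ i := by
  lift i to ℕ using hi
  rw [zcoeff_natCast, geom, coeff_mk, zpow_natCast]

/-- The coefficients of `log ((1 + c x) / (1 - c x))`. -/
def logSeq (c : ℂ) (n : ℕ) : ℂ := if Odd n then 2 * c ^ n / n else 0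

@[simp] theorem logSeq_zero (c : ℂ) : logSeq c 0 = 0 := by simp [logSeq]

/-- The logarithmic derivative of `(1 + c x)/(1 - c x)` under `x d/dx` is `1/(1 - c x) - 1/(1 + c
x)`, in which only odd powers survive, with coefficient `2 c^n`. -/
theorem expSeries_logSeq (c : ℂ) : (1 - C c * X) * expSeries (logSeq c) = 1 + C c * X := by
  have hU := one_sub_mul_geom c
  have hV := one_sub_mul_geom (-c)
  have hg : euler (PowerSeries.mk (logSeq c)) = geom c - geom (-c) := by
    ext n
    rw [coeff_euler, coeff_mk, map_sub, geom, geom, coeff_mk, coeff_mk, logSeq]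
    split_ifs with h
    · have : (n : ℂ) ≠ 0 := by exact_mod_cast h.pos.ne'
      rw [h.neg_pow, smul_eq_mul]; field_simp; ring
    · rw [(Nat.not_odd_iff_even.1 h).neg_pow]; simp
  have eX : euler (C c * X : PowerSeries ℂ) = C c * X := by
    rw [euler_mul, euler_C, zero_mul, zero_add]
    simpa using congrArg (fun f => C c * f) (euler_X_pow (R := ℂ) 1)
  have e1 : euler (1 : PowerSeries ℂ) = 0 := by simpa using euler_C (1 : ℂ)
  have eU : euler (geom c) = C c * X * geom c ^ 2 := by
    have := congrArg euler hU
    rw [euler_mul, euler_sub, eX, e1] at this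
    linear_combination geom c * this - euler (geom c) * hU
  have eP : euler (1 + C c * X : PowerSeries ℂ) = C c * X := by
    rw [show (1 + C c * X : PowerSeries ℂ) = C c * X - C (-1) by simp [add_comm], euler_sub,
      euler_C, eX, sub_zero]
  have key : (1 + C c * X) * geom c = expSeries (logSeq c) := by
    refine eq_expSeries_of_euler (by simp) (fun _ _ => Commute.all _ _) (by simp [geom]) ?_
    rw [hg, euler_mul, eP, eU]
    rw [map_neg] at hV
    linear_combination (-(1 + C c * X) * geom c) * hU + geom c * hV
  rw [← key]
  linear_combination (1 + C c * X) * hU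

theorem one_sub_ne_zero (c : ℂ) : (1 - C c * X : PowerSeries ℂ) ≠ 0 :=
  left_ne_zero_of_mul_eq_one (one_sub_mul_geom c)

/-- With `a = q^r`, the function is `(1 - a x)/(1 + a x)` times `(1 + a⁻¹ x)/(1 - a⁻¹ x)`. In
logarithmic form it can be compared with contractions coefficient by coefficient. -/
theorem G_eq_expSeries {q : ℂ} (hq : q ≠ 0) (r : ℤ) :
    G q r = expSeries fun n => logSeq (q ^ r)⁻¹ n + -logSeq (q ^ r) n := by
  have ha : q ^ r ≠ 0 := zpow_ne_zero _ hq
  rw [expSeries_add_scalar (by simp) (by simp), G]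
  set a := q ^ r
  have h1 := expSeries_logSeq a
  have h2 := expSeries_logSeq a⁻¹
  have h3 := expSeries_neg_mul_scalar (s := logSeq a) (by simp)
  have ha' : (C a * C a⁻¹ : PowerSeries ℂ) = 1 := by rw [← map_mul, mul_inv_cancel₀ ha, map_one]
  have hD : constantCoeff ((C a * X + 1) * (X - C a) : PowerSeries ℂ) ≠ 0 := by simp [ha]
  have h4 := PowerSeries.mul_inv_cancel _ hD
  refine mul_left_cancel₀ (left_ne_zero_of_mul_eq_one h4) ?_
  set y := (((C a * X + 1) * (X - C a) : PowerSeries ℂ))⁻¹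
  set L := expSeries (logSeq a)
  set L' := expSeries (logSeq a⁻¹)
  set N := expSeries fun n => -logSeq a n
  have h2' : (C a - X) * L' = C a + X := by
    linear_combination C a * h2 + (X * L' + X) * ha'
  linear_combination ((C a * X - 1) * (X + C a)) * h4 - ((C a * X - 1) * (X + C a)) * h3 -
    (N * (X + C a)) * h1 + ((C a * X + 1) * N) * h2'

theorem Gpow_eq_expSeries {q : ℂ} (hq : q ≠ 0) (r : ℤ) (ε : ℤˣ) :
    Gpow q r ε = expSeries fun n => ((ε : ℤ) : ℂ) * (logSeq (q ^ r)⁻¹ n - logSeq (q ^ r) n) := by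
  have h : G q r = expSeries fun n => (logSeq (q ^ r)⁻¹ n - logSeq (q ^ r) n) := by
    simpa only [sub_eq_add_neg] using G_eq_expSeries hq r
  rcases Int.units_eq_one_or ε with rfl | rfl
  · rw [Gpow, if_pos rfl, h]; simp
  · rw [Gpow, if_neg (by decide), h, ← expSeries_neg_eq_inv (by simp)]; simp

theorem qInt_natCast (q : ℂ) (n : ℕ) : qInt q n = (q ^ n - q⁻¹ ^ n) / (q - q⁻¹) := by
  rw [qInt, zpow_natCast, zpow_neg, zpow_natCast, inv_pow]

theorem qInt_mul_natCast (q : ℂ) (r : ℤ) (n : ℕ) :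
    qInt q (r * n) = ((q ^ r) ^ n - (q ^ r)⁻¹ ^ n) / (q - q⁻¹) := by
  rw [qInt, zpow_neg, zpow_mul, zpow_natCast, inv_pow]

theorem sub_inv_ne_zero {q : ℂ} (hq0 : q ≠ 0) (hq : ∀ n : ℕ, 0 < n → q ^ n ≠ 1) {n : ℕ}
    (hn : 0 < n) : q ^ n - q⁻¹ ^ n ≠ 0 := by
  intro h
  refine hq (2 * n) (by omega) ?_
  have h1 : q ^ n ≠ 0 := pow_ne_zero _ hq0
  rw [sub_eq_zero, inv_pow] at h
  rw [two_mul, pow_add]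
  nth_rewrite 1 [h]
  exact inv_mul_cancel₀ h1

/-- The coefficients of the exponent of `E_-^ε(α_i, z)`. -/
def creationCoeff (q p : ℂ) (ε : ℤˣ) (n : ℕ) : ℂ :=
  ((ε : ℤ) : ℂ) * (2 * p ^ (-((ε : ℤ) * n)) / qInt q n)

/-- The coefficients of the exponent of `E_+^ε(α_i, z)`. -/
def annihilationCoeff (q p : ℂ) (ε : ℤˣ) (n : ℕ) : ℂ :=
  -((ε : ℤ) : ℂ) * (2 * p ^ (-((ε : ℤ) * n)) / qInt q n)

variable {q p : ℂ} (hq0 : q ≠ 0) (hq : ∀ n : ℕ, 0 < n → q ^ n ≠ 1)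

include hq0 hq

theorem expSeries_contraction_phi_psi (r : ℤ) :
    expSeries (fun n => -contraction q r (fun _ => 2 * (q - q⁻¹)) (fun _ => 2 * (q⁻¹ - q)) n) =
      rescale q⁻¹ (G q r) * (rescale q (G q r))⁻¹ := by
  have h1 : q - q⁻¹ ≠ 0 := by simpa using sub_inv_ne_zero hq0 hq one_pos
  rw [G_eq_expSeries hq0, rescale_expSeries, rescale_expSeries,
    ← expSeries_neg_eq_inv (by simp), ← expSeries_add_scalar (by simp) (by simp)]
  congr 1
  ext n
  simp only [contraction, logSeq]
  split_ifs with h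
  · have : (n : ℂ) ≠ 0 := by exact_mod_cast h.pos.ne'
    rw [bracket, qInt_mul_natCast]
    set x := q - q⁻¹ with hx
    rw [show q⁻¹ - q = -x by rw [hx]; ring]
    field_simp
    ring
  · simp

theorem expSeries_contraction_phi (r : ℤ) (ε : ℤˣ) :
    expSeries (fun n => -contraction q r (annihilationCoeff q p ε) (fun _ => 2 * (q⁻¹ - q)) n) =
      rescale (p ^ (-(ε : ℤ))) (Gpow q r ε) := by
  have h1 : q - q⁻¹ ≠ 0 := by simpa using sub_inv_ne_zero hq0 hq one_pos
  rw [Gpow_eq_expSeries hq0, rescale_expSeries]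
  congr 1
  ext n
  simp only [contraction, logSeq]
  split_ifs with h
  · have hn : (n : ℂ) ≠ 0 := by exact_mod_cast h.pos.ne'
    have h2 := sub_inv_ne_zero hq0 hq h.pos
    rw [bracket, qInt_mul_natCast, annihilationCoeff, qInt_natCast, ← zpow_natCast (p ^ _),
      ← zpow_mul, neg_mul (ε : ℤ)]
    set y := q ^ n - q⁻¹ ^ n
    set x := q - q⁻¹ with hx
    rw [show q⁻¹ - q = -x by rw [hx]; ring]
    field_simp
    ring
  · simp

theorem expSeries_contraction_psi (r : ℤ) (ε : ℤˣ) :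
    expSeries (contraction q r (fun _ => 2 * (q - q⁻¹)) (creationCoeff q p ε)) =
      rescale (p ^ (-(ε : ℤ))) (Gpow q r (-ε)) := by
  have h1 : q - q⁻¹ ≠ 0 := by simpa using sub_inv_ne_zero hq0 hq one_pos
  rw [Gpow_eq_expSeries hq0, rescale_expSeries]
  congr 1
  ext n
  simp only [contraction, logSeq]
  split_ifs with h
  · have hn : (n : ℂ) ≠ 0 := by exact_mod_cast h.pos.ne'
    have h2 := sub_inv_ne_zero hq0 hq h.pos
    rw [bracket, qInt_mul_natCast, creationCoeff, qInt_natCast, ← zpow_natCast (p ^ _),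
      ← zpow_mul, neg_mul (ε : ℤ)]
    set y := q ^ n - q⁻¹ ^ n
    set x := q - q⁻¹ with hx
    push_cast
    field_simp
    ring
  · simp

/-- The factor `[rn]/[n]` controls everything: for integral `r` it is a signed sum of `n`-th powers,
so the exponentiated contraction is a rational function. -/
theorem contraction_vertex (r : ℤ) (ε ε' : ℤˣ) {n : ℕ} (hn : Odd n) :
    contraction q r (annihilationCoeff q p ε) (creationCoeff q p ε') n =
      -(((ε * ε' : ℤˣ) : ℤ) : ℂ) * (2 * (p ^ (-(ε : ℤ)) * p ^ (-(ε' : ℤ))) ^ n / n) *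
        (((q ^ r) ^ n - (q ^ r)⁻¹ ^ n) / (q ^ n - q⁻¹ ^ n)) := by
  have h1 : q - q⁻¹ ≠ 0 := by simpa using sub_inv_ne_zero hq0 hq one_pos
  have hn' : (n : ℂ) ≠ 0 := by exact_mod_cast hn.pos.ne'
  have h2 := sub_inv_ne_zero hq0 hq hn.pos
  rw [contraction, if_pos hn, bracket, qInt_mul_natCast, annihilationCoeff, creationCoeff,
    qInt_natCast, mul_pow, ← zpow_natCast (p ^ _), ← zpow_natCast (p ^ _),
    ← zpow_mul, ← zpow_mul, neg_mul (ε : ℤ), neg_mul (ε' : ℤ)]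
  set y := q ^ n - q⁻¹ ^ n
  set x := q - q⁻¹ with hx
  push_cast
  field_simp

theorem contraction_vertex_zero (ε ε' : ℤˣ) (n : ℕ) :
    contraction q 0 (annihilationCoeff q p ε) (creationCoeff q p ε') n = 0 := by
  by_cases hn : Odd n
  · rw [contraction_vertex hq0 hq _ _ _ hn]; simp
  · rw [contraction, if_neg hn]

theorem contraction_vertex_two (ε ε' : ℤˣ) (n : ℕ) :
    contraction q 2 (annihilationCoeff q p ε) (creationCoeff q p ε') n =
      -(((ε * ε' : ℤˣ) : ℤ) : ℂ) * (logSeq (p ^ (-(ε : ℤ)) * p ^ (-(ε' : ℤ)) * q) n +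
        logSeq (p ^ (-(ε : ℤ)) * p ^ (-(ε' : ℤ)) * q⁻¹) n) := by
  by_cases hn : Odd n
  · have hn' : (n : ℂ) ≠ 0 := by exact_mod_cast hn.pos.ne'
    have h2 := sub_inv_ne_zero hq0 hq hn.pos
    rw [contraction_vertex hq0 hq _ _ _ hn, logSeq, logSeq, if_pos hn, if_pos hn, mul_pow _ q,
      mul_pow _ q⁻¹, show ((q ^ (2 : ℤ)) ^ n - (q ^ (2 : ℤ))⁻¹ ^ n) / (q ^ n - q⁻¹ ^ n) =
        q ^ n + q⁻¹ ^ n from ?_]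
    · ring
    · rw [div_eq_iff h2, zpow_ofNat, inv_pow, ← pow_mul, inv_pow, mul_comm 2, pow_mul]; ring
  · simp [contraction, logSeq, hn]

theorem contraction_vertex_neg (s : ℕ) (ε ε' : ℤˣ) (n : ℕ) :
    contraction q (-s) (annihilationCoeff q p ε) (creationCoeff q p ε') n =
      (((ε * ε' : ℤˣ) : ℤ) : ℂ) * ∑ k ∈ Finset.range s,
        logSeq (p ^ (-(ε : ℤ)) * p ^ (-(ε' : ℤ)) * q ^ (2 * (k : ℤ) + 1 - s)) n := by
  by_cases hn : Odd n
  · have hn' : (n : ℂ) ≠ 0 := by exact_mod_cast hn.pos.ne'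
    have h2 := sub_inv_ne_zero hq0 hq hn.pos
    have hQ : q ^ n ≠ 0 := pow_ne_zero _ hq0
    have key : (((q ^ (-(s : ℤ))) ^ n - (q ^ (-(s : ℤ)))⁻¹ ^ n) / (q ^ n - q⁻¹ ^ n)) =
        -∑ k ∈ Finset.range s, (q ^ (2 * (k : ℤ) + 1 - s)) ^ n := by
      rw [div_eq_iff h2, neg_mul, Finset.sum_mul]
      -- Multiplying by `q^n - q^{-n}` makes the sum telescope.
      have hk : ∀ k ∈ Finset.range s, (q ^ (2 * (k : ℤ) + 1 - s)) ^ n * (q ^ n - q⁻¹ ^ n) =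
          (q ^ (2 * ((k + 1 : ℕ) : ℤ) - s)) ^ n - (q ^ (2 * (k : ℤ) - s)) ^ n := by
        intro k _
        rw [mul_sub, ← mul_pow, ← mul_pow, ← zpow_add_one₀ hq0, ← zpow_sub_one₀ hq0]
        congr 3 <;> push_cast <;> ring
      rw [Finset.sum_congr rfl hk,
        Finset.sum_range_sub (fun k : ℕ => (q ^ (2 * (k : ℤ) - s)) ^ n)]
      rw [show 2 * (s : ℤ) - s = s by ring, zpow_neg, inv_inv]
      simp
    rw [contraction_vertex hq0 hq _ _ _ hn, key, neg_mul, neg_mul_neg, mul_assoc, Finset.mul_sum]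
    congr 1
    refine Finset.sum_congr rfl fun k _ => ?_
    rw [logSeq, if_pos hn, mul_pow _ (q ^ _)]
    ring
  · simp [contraction, logSeq, hn]

end Scalars

/-! ### Moving `Φ` and `Ψ` past a vertex operator -/

section VertexConjugation

variable {M : Type*} [AddCommGroup M] [Module ℂ M] {M₁ P₁ Y : PowerSeries (Module.End ℂ M)}
  {V : ℤ → Module.End ℂ M}

/-- Here `Y` commutes with the creation half and contracts only with `P₁`, a series in `w⁻¹`.
Stripping `w^{-h}` from `P₁` raises the remaining exponent of `w`, whence `b + h`. -/
theorem coeff_mul_vertex_of_creation {f : PowerSeries ℂ}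
    (hV : ∀ a u, V a u = ∑ᶠ k : ℕ, zcoeff M₁ (a + k) (coeff k P₁ u))
    (hK : ∀ u, ∃ K : ℕ, ∀ k, K ≤ k → coeff k P₁ u = 0)
    (hY : ∀ m n, Commute (coeff m Y) (coeff n M₁))
    (hf : ∀ m n, coeff m Y * coeff n P₁ = ∑ k ∈ Finset.range (min m n + 1),
      coeff k f • (coeff (n - k) P₁ * coeff (m - k) Y)) (m : ℕ) (b : ℤ) :
    coeff m Y * V b = ∑ h ∈ Finset.range (m + 1), coeff h f • (V (b + h) * coeff (m - h) Y) := by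
  refine LinearMap.ext fun v => ?_
  obtain ⟨K₀, hK₀⟩ := hK v
  choose K₁ hK₁ using fun l => hK (coeff l Y v)
  -- The vectors `coeff l Y v` with `l ≤ m` are finitely many, so the sum of their cutoffs serves
  -- all of them.
  obtain ⟨K, hKv, hKY⟩ : ∃ K : ℕ, (∀ k, K ≤ k → coeff k P₁ v = 0) ∧
      ∀ l ≤ m, ∀ k, K ≤ k → coeff k P₁ (coeff l Y v) = 0 := by
    refine ⟨K₀ + ∑ l ∈ Finset.range (m + 1), K₁ l, fun k hk => hK₀ k (by omega),
      fun l hl k hk => hK₁ l k ?_⟩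
    have := Finset.single_le_sum (f := K₁) (fun _ _ => Nat.zero_le _)
      (show l ∈ Finset.range (m + 1) from Finset.mem_range.2 (by omega))
    omega
  have hYM : ∀ n : ℤ, ∀ u, coeff m Y (zcoeff M₁ n u) = zcoeff M₁ n (coeff m Y u) := by
    intro n u
    rcases lt_or_ge n 0 with hn | hn
    · simp [zcoeff_of_neg _ hn]
    · lift n to ℕ using hn
      rw [zcoeff_natCast]
      exact LinearMap.congr_fun (hY m n).eq u
  have hP : ∀ k : ℕ, coeff m Y (coeff k P₁ v) = ∑ h ∈ Finset.range (m + 1),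
      coeff h f • zcoeff P₁ ((k : ℤ) - h) (coeff (m - h) Y v) := by
    intro k
    rw [← Module.End.mul_apply, hf, LinearMap.sum_apply]
    have h2 : ∀ h ∈ Finset.range (min m k + 1),
        (coeff h f • (coeff (k - h) P₁ * coeff (m - h) Y)) v =
        coeff h f • zcoeff P₁ ((k : ℤ) - h) (coeff (m - h) Y v) := by
      intro h hh
      have hh := Finset.mem_range.1 hh
      rw [← Nat.cast_sub (by omega), zcoeff_natCast]
      rfl
    rw [Finset.sum_congr rfl h2]
    refine Finset.sum_subset (Finset.range_subset_range.2 (by omega)) fun h hm hh => ?_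
    simp only [Finset.mem_range, not_lt] at hh hm
    rw [zcoeff_of_neg P₁ (by omega), LinearMap.zero_apply, smul_zero]
  rw [Module.End.mul_apply, hV, finsum_eq_sum_range_of_eq_zero (K := K + m)
    (fun k hk => by rw [hKv k (by omega), map_zero]), map_sum, LinearMap.sum_apply]
  simp_rw [hYM, hP, map_sum, map_smul]
  rw [Finset.sum_comm]
  refine Finset.sum_congr rfl fun h hh => ?_
  have hh := Finset.mem_range.1 hh
  have h3 := sum_range_zcoeff_shift (g := fun k => zcoeff M₁ (b + k))
    (hKY (m - h) (Nat.sub_le _ _)) (show K + h ≤ K + m by omega)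
  rw [← Finset.smul_sum, h3, LinearMap.smul_apply, Module.End.mul_apply, hV,
    finsum_eq_sum_range_of_eq_zero (K := K)
    (fun k hk => by rw [hKY _ (Nat.sub_le _ _) k hk, map_zero])]
  congr 1
  refine Finset.sum_congr rfl fun k _ => ?_
  congr 2
  push_cast; ring

/-- The mirror case: `Y` contracts only with the creation half, a series in `w`, whence `b - h`.
Since `Y` commutes with `P₁`, the cutoff of `v` also serves every `coeff l Y v`. -/
theorem coeff_mul_vertex_of_annihilation {f : PowerSeries ℂ}
    (hV : ∀ a u, V a u = ∑ᶠ k : ℕ, zcoeff M₁ (a + k) (coeff k P₁ u))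
    (hK : ∀ u, ∃ K : ℕ, ∀ k, K ≤ k → coeff k P₁ u = 0)
    (hY : ∀ m n, Commute (coeff m Y) (coeff n P₁))
    (hf : ∀ m n, coeff m Y * coeff n M₁ = ∑ k ∈ Finset.range (min m n + 1),
      coeff k f • (coeff (n - k) M₁ * coeff (m - k) Y)) (m : ℕ) (b : ℤ) :
    coeff m Y * V b = ∑ h ∈ Finset.range (m + 1), coeff h f • (V (b - h) * coeff (m - h) Y) := by
  refine LinearMap.ext fun v => ?_
  obtain ⟨K, hKv⟩ := hK v
  have hKY : ∀ l k, K ≤ k → coeff k P₁ (coeff l Y v) = 0 := by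
    intro l k hk
    rw [← Module.End.mul_apply, ← (hY l k).eq, Module.End.mul_apply, hKv k hk, map_zero]
  have hM : ∀ (n : ℤ) (u : M), coeff m Y (zcoeff M₁ n u) = ∑ h ∈ Finset.range (m + 1),
      coeff h f • zcoeff M₁ (n - h) (coeff (m - h) Y u) := by
    intro n u
    rcases lt_or_ge n 0 with hn | hn
    · rw [zcoeff_of_neg _ hn, LinearMap.zero_apply, map_zero, Finset.sum_eq_zero]
      intro h _
      rw [zcoeff_of_neg M₁ (by omega), LinearMap.zero_apply, smul_zero]
    lift n to ℕ using hn
    rw [zcoeff_natCast, ← Module.End.mul_apply, hf, LinearMap.sum_apply]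
    have h2 : ∀ h ∈ Finset.range (min m n + 1),
        (coeff h f • (coeff (n - h) M₁ * coeff (m - h) Y)) u =
        coeff h f • zcoeff M₁ ((n : ℤ) - h) (coeff (m - h) Y u) := by
      intro h hh
      have hh := Finset.mem_range.1 hh
      rw [← Nat.cast_sub (by omega), zcoeff_natCast]
      rfl
    rw [Finset.sum_congr rfl h2]
    refine Finset.sum_subset (Finset.range_subset_range.2 (by omega)) fun h hm hh => ?_
    simp only [Finset.mem_range, not_lt] at hh hm
    rw [zcoeff_of_neg M₁ (by omega), LinearMap.zero_apply, smul_zero]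
  rw [Module.End.mul_apply, hV, finsum_eq_sum_range_of_eq_zero (K := K)
    (fun k hk => by rw [hKv k hk, map_zero]), map_sum, LinearMap.sum_apply]
  simp_rw [hM]
  rw [Finset.sum_comm]
  refine Finset.sum_congr rfl fun h _ => ?_
  rw [← Finset.smul_sum, LinearMap.smul_apply, Module.End.mul_apply, hV,
    finsum_eq_sum_range_of_eq_zero (K := K) (fun k hk => by rw [hKY _ k hk, map_zero])]
  congr 1
  refine Finset.sum_congr rfl fun k _ => ?_
  rw [← Module.End.mul_apply (coeff (m - h) Y), (hY _ k).eq, Module.End.mul_apply,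
    add_sub_right_comm]

end VertexConjugation

/-! ### Products of two vertex operators on the Fock space -/

section FockVertex

variable {ι : Type*} (A : ι → ι → ℤ) (q p : ℂ)

theorem Eminus_eq (ε : ℤˣ) (i : ι) :
    Eminus A q p ε i = expSeries (creation A q i (creationCoeff q p ε)) := rfl

theorem Eplus_eq (ε : ℤˣ) (i : ι) :
    Eplus A q p ε i = expSeries (annihilation A q i (annihilationCoeff q p ε)) := rfl

theorem Phi_heis (i : ι) :
    Phi q (heis A q) i = expSeries (creation A q i fun _ => 2 * (q⁻¹ - q)) := rfl

theorem Psi_heis (i : ι) :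
    Psi q (heis A q) i = expSeries (annihilation A q i fun _ => 2 * (q - q⁻¹)) := rfl

theorem vertexFock_apply (ε : ℤˣ) (i : ι) (a : ℤ) (u : Fock ι) : vertexFock A q p ε i a u =
    ∑ᶠ k : ℕ, zcoeff (Eminus A q p ε i) (a + k) (coeff k (Eplus A q p ε i) u) := rfl

/-- The coefficients of `X_i^ε(z) X_j^ε'(w) = :X_i^ε(z) X_j^ε'(w): f(w/z)`, on the Fock space. -/
def opeSeries (r : ℤ) (ε ε' : ℤˣ) : PowerSeries ℂ :=
  expSeries (contraction q r (annihilationCoeff q p ε) (creationCoeff q p ε'))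

/-- Lets one series `f` serve both orders of the product. -/
theorem opeSeries_symm (r : ℤ) (ε ε' : ℤˣ) : opeSeries q p r ε ε' = opeSeries q p r ε' ε := by
  rw [opeSeries, opeSeries]
  congr 1
  ext n
  rw [contraction, contraction, annihilationCoeff, creationCoeff, annihilationCoeff,
    creationCoeff]
  congr 1
  ring

/-- The normally ordered product `:X_i^ε(z) X_j^ε'(w):` on the Fock space, applied to `v`. -/
def normalVertex (ε ε' : ℤˣ) (i j : ι) (K : ℕ) (v : Fock ι) : ℤ → ℤ → Fock ι :=
  normalOrder (Eminus A q p ε i) (Eminus A q p ε' j) (Eplus A q p ε i) (Eplus A q p ε' j) K v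

variable {K : ℕ} {v : Fock ι}
  (hK₁ : ∀ (i : ι) (c : ℕ → ℂ) (k : ℕ), K ≤ k → coeff k (expSeries (annihilation A q i c)) v = 0)
  (hK : ∀ (i j : ι) (c d : ℕ → ℂ) (k l : ℕ), K ≤ k ∨ K ≤ l →
      coeff k (expSeries (annihilation A q i c))
        (coeff l (expSeries (annihilation A q j d)) v) = 0)

include hK₁ hK in
theorem vertexFock_mul_vertexFock (ε ε' : ℤˣ) (i j : ι) (a b : ℤ) :
    (vertexFock A q p ε i a * vertexFock A q p ε' j b) v =
      pairing (zcoeff (opeSeries q p (A i j) ε ε')) (normalVertex A q p ε ε' i j K v) a b :=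
  vertex_mul_vertex (vertexFock_apply A q p ε i) (vertexFock_apply A q p ε' j)
    (exp_annihilation_mul_exp_creation A q i j _ _) (hK₁ j _) (hK i j _ _) a b

theorem pairing_swap {M : Type*} [AddCommGroup M] [Module ℂ M] {n n' : ℤ → ℤ → M}
    (h : ∀ a b, n' b a = n a b) (φ : ℤ → ℂ) (a b : ℤ) :
    pairing φ n' b a = pairing (fun i => φ (-i)) n a b := by
  rw [pairing, ← finsum_comp_equiv (Equiv.neg ℤ), pairing]
  refine finsum_congr fun i => ?_
  rw [Equiv.neg_apply, h, sub_neg_eq_add, sub_eq_add_neg b]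

variable (hA : ∀ i j, A i j = A j i)

include hK₁ hK hA in
-- The normally ordered product does not depend on the order of its factors, so exchanging the
-- operators only replaces `f(w/z)` by `f(z/w)`.
theorem vertexFock_mul_vertexFock_swap (ε ε' : ℤˣ) (i j : ι) (a b : ℤ) :
    (vertexFock A q p ε' j b * vertexFock A q p ε i a) v =
      pairing (fun l => zcoeff (opeSeries q p (A i j) ε ε') (-l))
        (normalVertex A q p ε ε' i j K v) a b := by
  rw [vertexFock_mul_vertexFock A q p hK₁ hK, hA j i, opeSeries_symm]
  refine pairing_swap (fun a b => ?_) _ a b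
  exact (normalOrder_swap (commute_exp_creation A q i j _ _)
    (commute_exp_annihilation A q i j _ _) a b).symm

include hK₁ hK hA in
-- The reduction to scalars: both products are multiples of one normally ordered product. The scalar
-- `s` leaves room for the sign produced by the operators on `T`.
theorem polyMul_vertexFock_sub {P P' : MvPolynomial (Fin 2) ℂ} {e : ℕ} (hP : P.IsHomogeneous e)
    (hP' : P'.IsHomogeneous e) (ε ε' : ℤˣ) (i j : ι) (s : ℂ) (a b : ℤ) :
    (polyMul P (prodZW (vertexFock A q p ε i) (vertexFock A q p ε' j)) a b -
      s • polyMul P' (prodWZ (vertexFock A q p ε i) (vertexFock A q p ε' j)) a b) v =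
    pairing (fun l => zcoeff (dehomogenize P * opeSeries q p (A i j) ε ε') l -
        s * zcoeff (dehomogenize' P' * opeSeries q p (A i j) ε ε') (e - l))
      (normalVertex A q p ε ε' i j K v) (a - e) b := by
  rw [LinearMap.sub_apply, LinearMap.smul_apply,
    polyMul_apply_eq_pairing (F := prodZW _ _) hP lineFinite_normalOrder
      (vertexFock_mul_vertexFock A q p hK₁ hK ε ε' i j),
    polyMul_apply_eq_pairing (F := prodWZ _ _) hP' lineFinite_normalOrder
      (vertexFock_mul_vertexFock_swap A q p hK₁ hK hA ε ε' i j),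
    pairing_sub_smul lineFinite_normalOrder]
  simp_rw [star_zcoeff, star_zcoeff_neg hP']
  rfl

end FockVertex

/-! ### The polynomials `(z - w)_{q²}^n` and their dehomogenizations -/

section Polynomials

variable {q : ℂ}

theorem isHomogeneous_linear (c d : ℂ) : (K c * Z + K d * W).IsHomogeneous 1 := by
  simpa using (((MvPolynomial.isHomogeneous_C (Fin 2) c).mul
    (MvPolynomial.isHomogeneous_X ℂ (0 : Fin 2))).add
    ((MvPolynomial.isHomogeneous_C (Fin 2) d).mul (MvPolynomial.isHomogeneous_X ℂ (1 : Fin 2))))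

theorem isHomogeneous_qPow (n : ℕ) {x y : MvPolynomial (Fin 2) ℂ} (hx : x.IsHomogeneous 1)
    (hy : y.IsHomogeneous 1) : (qPow q n x y).IsHomogeneous n := by
  have := MvPolynomial.IsHomogeneous.prod (Finset.range n)
    (fun k : ℕ => x - K (q ^ (2 * (k : ℤ) + 1 - n)) * y) (fun _ => 1) fun k _ => by
      have h := (MvPolynomial.isHomogeneous_C (Fin 2) (q ^ (2 * (k : ℤ) + 1 - n))).mul hy
      rw [zero_add] at h
      exact hx.sub h
  simpa [qPow] using this

theorem dehomogenize_qPow (n : ℕ) (x y : MvPolynomial (Fin 2) ℂ) : dehomogenize (qPow q n x y) =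
    ∏ k ∈ Finset.range n,
      (dehomogenize x - C (q ^ (2 * (k : ℤ) + 1 - n)) * dehomogenize y) := by
  simp [dehomogenize, qPow]

theorem dehomogenize'_qPow (n : ℕ) (x y : MvPolynomial (Fin 2) ℂ) : dehomogenize' (qPow q n x y) =
    ∏ k ∈ Finset.range n,
      (dehomogenize' x - C (q ^ (2 * (k : ℤ) + 1 - n)) * dehomogenize' y) := by
  simp [dehomogenize', qPow]

/-- The powers of `q` in `(x - y)_{q²}^n` are symmetric. -/
theorem prod_qPow_symm (hq0 : q ≠ 0) (n : ℕ) (x y : PowerSeries ℂ) :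
    ∏ k ∈ Finset.range n, (x - C (q ^ (2 * (k : ℤ) + 1 - n)) * y) =
      (-1) ^ n * ∏ k ∈ Finset.range n, (y - C (q ^ (2 * (k : ℤ) + 1 - n)) * x) := by
  -- The exponents `2k + 1 - n` are symmetric about zero, so these constants have product one.
  have h1 : ∏ k ∈ Finset.range n, (C (q ^ (2 * (k : ℤ) + 1 - n)) : PowerSeries ℂ) = 1 := by
    rw [← map_prod]
    have : ∀ m : ℕ, ∏ k ∈ Finset.range m, q ^ (2 * (k : ℤ) + 1 - n) =
        q ^ ((m : ℤ) * m - n * m) := by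
      intro m
      induction m with
      | zero => simp
      | succ m ih => rw [Finset.prod_range_succ, ih, ← zpow_add₀ hq0]; congr 1; push_cast; ring
    rw [this]; simp
  -- The factor with index `k` is matched with index `n - 1 - k`, whose power of `q` is the inverse
  -- one.
  have h3 : ∏ k ∈ Finset.range n, (x - C (q ^ (2 * (k : ℤ) + 1 - n)) * y) =
      ∏ k ∈ Finset.range n, (-1 * (C (q ^ (2 * (k : ℤ) + 1 - n)) *
        (y - C (q ^ (2 * ((n - 1 - k : ℕ) : ℤ) + 1 - n)) * x))) := by
    refine Finset.prod_congr rfl fun k hk => ?_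
    have hk := Finset.mem_range.1 hk
    have h2 : (C (q ^ (2 * (k : ℤ) + 1 - n)) * C (q ^ (2 * ((n - 1 - k : ℕ) : ℤ) + 1 - n)) :
        PowerSeries ℂ) = 1 := by
      rw [← map_mul, ← zpow_add₀ hq0, show (2 * (k : ℤ) + 1 - n) +
        (2 * ((n - 1 - k : ℕ) : ℤ) + 1 - n) = 0 by omega, zpow_zero, map_one]
    linear_combination (-x) * h2
  rw [h3, Finset.prod_mul_distrib, Finset.prod_mul_distrib, h1, one_mul, Finset.prod_const,
    Finset.card_range,
    Finset.prod_range_reflect (fun k : ℕ => y - C (q ^ (2 * (k : ℤ) + 1 - n)) * x)]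

/-- Shifting the `t + 1` symmetric exponents by `-ε` gives the `t` symmetric exponents together with
one extreme exponent, the first for `ε = 1` and the last for `ε = -1`. This separates the factor `z
- q^{εr} w` from `(z - w)_{q²}^{-r-1}`. -/
theorem prod_qPow_shift (hq0 : q ≠ 0) (t : ℕ) (ε : ℤˣ) (g : ℂ → PowerSeries ℂ) :
    ∏ k ∈ Finset.range (t + 1), g (q ^ (-(ε : ℤ)) * q ^ (2 * (k : ℤ) + 1 - (t + 1 : ℕ))) =
      (∏ k ∈ Finset.range t, g (q ^ (2 * (k : ℤ) + 1 - t))) *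
        g (q ^ ((ε : ℤ) * -((t + 1 : ℕ) : ℤ))) := by
  simp_rw [← zpow_add₀ hq0]
  rcases Int.units_eq_one_or ε with rfl | rfl
  · rw [Finset.prod_range_succ']
    congr 1
    · refine Finset.prod_congr rfl fun k _ => ?_
      congr 2; push_cast; ring
    · congr 2; push_cast; ring
  · rw [Finset.prod_range_succ]
    congr 1
    · refine Finset.prod_congr rfl fun k _ => ?_
      congr 2; push_cast; ring
    · congr 2; push_cast; ring

end Polynomials

/-! ### The rational functions `f(w/z)` and their expansions -/

section OpeSeries

variable {q p : ℂ}

theorem zpow_neg_mul_zpow_neg (hp : p ^ 2 = q) (ε : ℤˣ) :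
    p ^ (-(ε : ℤ)) * p ^ (-(ε : ℤ)) = q ^ (-(ε : ℤ)) := by
  rw [← mul_zpow, ← sq, hp]

theorem zpow_neg_mul_zpow_neg_neg (hp0 : p ≠ 0) (ε : ℤˣ) :
    p ^ (-(ε : ℤ)) * p ^ (-((-ε : ℤˣ) : ℤ)) = 1 := by
  rw [← zpow_add₀ hp0]; simp

variable (hq0 : q ≠ 0) (hq : ∀ n : ℕ, 0 < n → q ^ n ≠ 1)

include hq0 hq

theorem opeSeries_zero (ε ε' : ℤˣ) : opeSeries q p 0 ε ε' = 1 := by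
  rw [opeSeries, ← expSeries_zero]
  congr 1
  ext n
  exact contraction_vertex_zero hq0 hq ε ε' n

/-- The denominator of `f` is exactly `(z + w)_{q²}^s`, and its numerator is `(z - w)_{q²}^s`. -/
theorem prod_mul_opeSeries_opp (hp0 : p ≠ 0) (s : ℕ) :
    (∏ k ∈ Finset.range s, (1 + C (q ^ (2 * (k : ℤ) + 1 - s)) * X)) *
      opeSeries q p (-s) 1 (-1) =
    ∏ k ∈ Finset.range s, (1 - C (q ^ (2 * (k : ℤ) + 1 - s)) * X) := by
  have h1 : opeSeries q p (-s) 1 (-1) =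
      expSeries fun n => -∑ k ∈ Finset.range s, logSeq (q ^ (2 * (k : ℤ) + 1 - s)) n := by
    rw [opeSeries]
    congr 1
    ext n
    rw [contraction_vertex_neg hq0 hq, zpow_neg_mul_zpow_neg_neg hp0]
    simp
  have h2 := expSeries_neg_mul_scalar
    (s := fun n => ∑ k ∈ Finset.range s, logSeq (q ^ (2 * (k : ℤ) + 1 - s)) n) (by simp)
  rw [expSeries_sum_scalar _ (by simp), ← h1] at h2
  simp_rw [← expSeries_logSeq]
  rw [Finset.prod_mul_distrib]
  linear_combination (∏ k ∈ Finset.range s, (1 - C (q ^ (2 * (k : ℤ) + 1 - s)) * X)) * h2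

theorem prod_mul_opeSeries_same (hp : p ^ 2 = q) (t : ℕ) (ε : ℤˣ) :
    ((∏ k ∈ Finset.range t, (1 - C (q ^ (2 * (k : ℤ) + 1 - t)) * X)) *
      (1 - C (q ^ ((ε : ℤ) * -((t + 1 : ℕ) : ℤ))) * X)) *
      opeSeries q p (-((t + 1 : ℕ) : ℤ)) ε ε =
    (∏ k ∈ Finset.range t, (1 + C (q ^ (2 * (k : ℤ) + 1 - t)) * X)) *
      (1 + C (q ^ ((ε : ℤ) * -((t + 1 : ℕ) : ℤ))) * X) := by
  have h1 : opeSeries q p (-((t + 1 : ℕ) : ℤ)) ε ε =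
      ∏ k ∈ Finset.range (t + 1),
        expSeries (logSeq (q ^ (-(ε : ℤ)) * q ^ (2 * (k : ℤ) + 1 - (t + 1 : ℕ)))) := by
    rw [opeSeries, ← expSeries_sum_scalar _ (by simp)]
    congr 1
    ext n
    rw [contraction_vertex_neg hq0 hq, zpow_neg_mul_zpow_neg hp]
    simp
  rw [h1, ← prod_qPow_shift hq0 t ε fun c => 1 - C c * X,
    ← prod_qPow_shift hq0 t ε fun c => 1 + C c * X, ← Finset.prod_mul_distrib]
  simp_rw [expSeries_logSeq]

/-- Here `f = (1 + q x)(1 + q⁻¹ x)/((1 - q x)(1 - q⁻¹ x))` has simple poles at `q^{∓1}`. The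
difference of the expansions in `x` and in `x⁻¹` is a combination of `δ(q x)` and `δ(q⁻¹ x)`. -/
theorem zcoeff_opeSeries_sub (hp0 : p ≠ 0) (i : ℤ) :
    zcoeff (opeSeries q p 2 1 (-1)) i - zcoeff (opeSeries q p 2 1 (-1)) (-i) =
      2 * (q + q⁻¹) / (q - q⁻¹) * (q ^ i - q⁻¹ ^ i) := by
  have h1 : q - q⁻¹ ≠ 0 := by simpa using sub_inv_ne_zero hq0 hq one_pos
  set a := 2 * (q + q⁻¹) / (q - q⁻¹) with ha
  have hf : opeSeries q p 2 1 (-1) = expSeries (logSeq q) * expSeries (logSeq q⁻¹) := by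
    rw [opeSeries, ← expSeries_add_scalar (by simp) (by simp)]
    congr 1
    ext n
    rw [contraction_vertex_two hq0 hq, zpow_neg_mul_zpow_neg_neg hp0]
    simp
  -- The partial fraction decomposition.
  have key : opeSeries q p 2 1 (-1) = 1 + (a • geom q + -(a • geom q⁻¹)) := by
    refine mul_left_cancel₀ (mul_ne_zero (one_sub_ne_zero q) (one_sub_ne_zero q⁻¹)) ?_
    have h2 := expSeries_logSeq q
    have h3 := expSeries_logSeq q⁻¹
    have h4 := one_sub_mul_geom q
    have h5 := one_sub_mul_geom q⁻¹
    have h6 : (C a * (C q - C q⁻¹) : PowerSeries ℂ) = 2 * (C q + C q⁻¹) := by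
      rw [← map_sub, ← map_mul, ha, div_mul_cancel₀ _ h1, map_mul, map_add]; rfl
    rw [hf, PowerSeries.smul_eq_C_mul, PowerSeries.smul_eq_C_mul]
    linear_combination (1 - C q⁻¹ * X) * expSeries (logSeq q⁻¹) * h2 + (1 + C q * X) * h3 -
      C a * (1 - C q⁻¹ * X) * h4 + C a * (1 - C q * X) * h5 - X * h6
  have hz : ∀ i, zcoeff (opeSeries q p 2 1 (-1)) i =
      (if i = 0 then 1 else 0) + (a * zcoeff (geom q) i + -(a * zcoeff (geom q⁻¹) i)) := by
    intro i
    rw [key, zcoeff_add, zcoeff_add, zcoeff_neg, zcoeff_smul, zcoeff_smul, zcoeff_one]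
    rfl
  rw [hz, hz]
  rcases lt_trichotomy i 0 with h | h | h
  · rw [zcoeff_of_neg _ h, zcoeff_of_neg _ h, zcoeff_geom_of_nonneg _ (by omega),
      zcoeff_geom_of_nonneg _ (by omega), if_neg h.ne, if_neg (by omega), zpow_neg, zpow_neg,
      inv_zpow, inv_inv]
    ring
  · subst h; simp
  · rw [zcoeff_of_neg _ (neg_neg_of_pos h), zcoeff_of_neg _ (neg_neg_of_pos h),
      zcoeff_geom_of_nonneg _ h.le, zcoeff_geom_of_nonneg _ h.le, if_neg h.ne', if_neg (by omega)]
    ring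

/-- After multiplication by the quadratic prefactor only the pole at `x = -1` remains, and it
produces `δ(-x)`. The sum, rather than a difference, appears because the prefactor on the other side
dehomogenizes to the negative. -/
theorem zcoeff_opeSeries_self (hp : p ^ 2 = q) (ε : ℤˣ) (i : ℤ) :
    zcoeff ((1 - C (q ^ (2 * (ε : ℤ))) * X) * (1 + C (q ^ (-(2 * (ε : ℤ)))) * X) *
        opeSeries q p 2 ε ε) i +
      zcoeff ((1 - C (q ^ (2 * (ε : ℤ))) * X) * (1 + C (q ^ (-(2 * (ε : ℤ)))) * X) *
        opeSeries q p 2 ε ε) (2 - i) = 2 * (q + q⁻¹) ^ 2 * (-1) ^ i := by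
  set a := q ^ (-(2 * (ε : ℤ))) with ha
  set b := q ^ (2 * (ε : ℤ)) with hb
  have hab : a * b = 1 := by rw [ha, hb, ← zpow_add₀ hq0]; simp
  have hB : 2 * (q + q⁻¹) ^ 2 = 4 + 2 * (a + b) := by
    rcases Int.units_eq_one_or ε with h | h
    · rw [ha, hb, h]; simp [zpow_ofNat, zpow_neg]; field_simp; ring
    · rw [ha, hb, h]; simp [zpow_ofNat, zpow_neg]; field_simp; ring
  -- The parameters `q^{-ε} q` and `q^{-ε} q⁻¹` are `1` and `q^{-2ε}`, in an order depending on `ε`.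
  have hf : opeSeries q p 2 ε ε * (expSeries (logSeq 1) * expSeries (logSeq a)) = 1 := by
    rw [← expSeries_add_scalar (by simp) (by simp), ← expSeries_neg_mul_scalar
      (s := fun n => logSeq 1 n + logSeq a n) (by simp), opeSeries]
    congr 2
    ext n
    rw [contraction_vertex_two hq0 hq, zpow_neg_mul_zpow_neg hp, ← zpow_add_one₀ hq0,
      ← zpow_sub_one₀ hq0, ha]
    rcases Int.units_eq_one_or ε with h | h
    · rw [h]; simp
    · rw [h]; simp [add_comm]
  have h2 := expSeries_logSeq 1
  have h3 := expSeries_logSeq a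
  have h4 := one_sub_mul_geom (-1)
  rw [map_neg] at h4
  rw [map_one] at h2 h4
  have hab' : (C a * C b : PowerSeries ℂ) = 1 := by rw [← map_mul, hab, map_one]
  -- Polynomial division of `(1 - b x)(1 - x)(1 - a x)` by `1 + x`, using `a b = 1`; the remainder
  -- `4 + 2 (a + b)` is the value at `x = -1`.
  have key : (1 - C b * X) * (1 + C a * X) * opeSeries q p 2 ε ε =
      (-(3 + 2 * (a + b))) • 1 + ((2 + (a + b)) • (X ^ 1 * 1) + (-(X ^ 2 * 1) +
        (4 + 2 * (a + b)) • geom (-1))) := by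
    have h5 : (1 + X : PowerSeries ℂ) ≠ 0 := by
      intro h; have := congrArg constantCoeff h; simp at this
    refine mul_left_cancel₀ h5 ?_
    simp only [PowerSeries.smul_eq_C_mul, map_add, map_mul, map_neg]
    have e2 : (C (2 : ℂ) : PowerSeries ℂ) = 2 := rfl
    have e3 : (C (3 : ℂ) : PowerSeries ℂ) = 3 := rfl
    have e4 : (C (4 : ℂ) : PowerSeries ℂ) = 4 := rfl
    rw [e2, e3, e4]
    have h6 : (1 + X) * (1 + C a * X) * opeSeries q p 2 ε ε = (1 - X) * (1 - C a * X) := by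
      linear_combination (-(1 + C a * X) * opeSeries q p 2 ε ε) * h2 -
        (1 - X) * expSeries (logSeq 1) * opeSeries q p 2 ε ε * h3 + (1 - X) * (1 - C a * X) * hf
    linear_combination (1 - C b * X) * h6 - (4 + 2 * (C a + C b)) * h4 + (1 - X) * X ^ 2 * hab'
  rw [key, hB]
  simp only [zcoeff_add, zcoeff_neg, zcoeff_smul, zcoeff_X_pow_mul, zcoeff_one, smul_eq_mul]
  have hpar : (-1 : ℂ) ^ (2 - i) = (-1) ^ i := by
    rw [zpow_sub₀ (by norm_num), div_eq_iff (zpow_ne_zero _ (by norm_num)), ← mul_zpow]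
    norm_num
  -- For `0 ≤ i ≤ 2` the geometric series contributes twice, at `i` and at `2 - i`, and the
  -- quadratic polynomial part removes the excess. Otherwise it contributes once.
  obtain h | rfl | rfl | rfl | h : i < 0 ∨ i = 0 ∨ i = 1 ∨ i = 2 ∨ 2 < i := by omega
  · rw [zcoeff_of_neg _ h, zcoeff_geom_of_nonneg _ (by omega), hpar, if_neg (by omega),
      if_neg (by omega), if_neg (by omega), if_neg (by omega), if_neg (by omega),
      if_neg (by omega)]
    ring
  · rw [zcoeff_geom_of_nonneg _ (by omega), zcoeff_geom_of_nonneg _ (by omega), hpar]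
    norm_num
    ring
  · rw [zcoeff_geom_of_nonneg _ (by omega), zcoeff_geom_of_nonneg _ (by omega), hpar]
    norm_num
    ring
  · rw [zcoeff_geom_of_nonneg _ (by omega), zcoeff_geom_of_nonneg _ (by omega), hpar]
    norm_num
    ring
  · rw [zcoeff_of_neg _ (show 2 - i < 0 by omega), zcoeff_geom_of_nonneg _ (by omega),
      if_neg (by omega), if_neg (by omega), if_neg (by omega), if_neg (by omega),
      if_neg (by omega), if_neg (by omega)]
    ring

end OpeSeries

/-! ### The relations on the Fock space -/

section FockRelations

variable {ι : Type*} (A : ι → ι → ℤ) (q p : ℂ)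

theorem exp_creation_mul_scale (i : ι) (c d : ℕ → ℂ) (x : ℂ) :
    expSeries (creation A q i c) * scale x (expSeries (creation A q i d)) =
      expSeries (creation A q i fun n => c n + x ^ n * d n) := by
  have hd : (fun n => x ^ n • creation A q i d n) = creation A q i fun n => x ^ n * d n := by
    ext1 n; simp only [creation]; split_ifs <;> simp [mul_smul]
  rw [scale_expSeries, hd, ← expSeries_add (by simp) (by simp) (creation_commute A q i i _ _)
    (creation_commute A q i i _ _) (creation_commute A q i i _ _)]
  congr 1
  ext1 n
  simp only [creation]
  split_ifs <;> simp [add_smul]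

theorem exp_annihilation_mul_scale (i : ι) (c d : ℕ → ℂ) (x : ℂ) :
    expSeries (annihilation A q i c) * scale x (expSeries (annihilation A q i d)) =
      expSeries (annihilation A q i fun n => c n + x ^ n * d n) := by
  have hd : (fun n => x ^ n • annihilation A q i d n) =
      annihilation A q i fun n => x ^ n * d n := by
    ext1 n; simp only [annihilation]; split_ifs <;> simp [mul_smul]
  rw [scale_expSeries, hd, ← expSeries_add (by simp) (by simp) (annihilation_commute A q i i _ _)
    (annihilation_commute A q i i _ _) (annihilation_commute A q i i _ _)]
  congr 1
  ext1 n
  simp only [annihilation]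
  split_ifs <;> simp [add_smul]

theorem creation_congr (i : ι) {c d : ℕ → ℂ} (h : ∀ n, Odd n → c n = d n) :
    creation A q i c = creation A q i d := by
  ext1 n; simp only [creation]; split_ifs with hn
  · rw [h n hn]
  · rfl

theorem annihilation_congr (i : ι) {c d : ℕ → ℂ} (h : ∀ n, Odd n → c n = d n) :
    annihilation A q i c = annihilation A q i d := by
  ext1 n; simp only [annihilation]; split_ifs with hn
  · rw [h n hn]
  · rfl

theorem exp_creation_eq_one (i : ι) {c : ℕ → ℂ} (h : ∀ n, Odd n → c n = 0) :
    expSeries (creation A q i c) = 1 := by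
  rw [creation_congr A q i h, ← expSeries_zero]
  congr 1
  ext1 n; simp [creation]

theorem exp_annihilation_eq_one (i : ι) {c : ℕ → ℂ} (h : ∀ n, Odd n → c n = 0) :
    expSeries (annihilation A q i c) = 1 := by
  rw [annihilation_congr A q i h, ← expSeries_zero]
  congr 1
  ext1 n; simp [annihilation]

theorem scale_exp_creation (i : ι) (c : ℕ → ℂ) (x : ℂ) :
    scale x (expSeries (creation A q i c)) = expSeries (creation A q i fun n => x ^ n * c n) := by
  have := exp_creation_mul_scale A q i (fun _ => 0) c x
  rwa [exp_creation_eq_one A q i fun _ _ => rfl, one_mul, funext fun n => zero_add _] at this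

theorem scale_exp_annihilation (i : ι) (c : ℕ → ℂ) (x : ℂ) :
    scale x (expSeries (annihilation A q i c)) =
      expSeries (annihilation A q i fun n => x ^ n * c n) := by
  have := exp_annihilation_mul_scale A q i (fun _ => 0) c x
  rwa [exp_annihilation_eq_one A q i fun _ _ => rfl, one_mul, funext fun n => zero_add _] at this

theorem zcoeff_scale {R : Type*} [Ring R] [Algebra ℂ R] (c : ℂ) (f : PowerSeries R) (n : ℤ) :
    zcoeff (scale c f) n = c ^ n • zcoeff f n := by
  rcases lt_or_ge n 0 with h | h
  · rw [zcoeff_of_neg _ h, zcoeff_of_neg _ h, smul_zero]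
  · lift n to ℕ using h
    rw [zcoeff_natCast, zcoeff_natCast, scale, coeff_mk, zpow_natCast]

variable (hA : ∀ i j, A i j = A j i) (hq0 : q ≠ 0) (hq : ∀ n : ℕ, 0 < n → q ^ n ≠ 1)

include hA in
theorem polyMul_vertexFock_eq {P P' : MvPolynomial (Fin 2) ℂ} {e : ℕ} (hP : P.IsHomogeneous e)
    (hP' : P'.IsHomogeneous e) (ε ε' : ℤˣ) (i j : ι) (s : ℂ)
    (h : ∀ l, zcoeff (dehomogenize P * opeSeries q p (A i j) ε ε') l =
      s * zcoeff (dehomogenize' P' * opeSeries q p (A i j) ε ε') (e - l)) (a b : ℤ) :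
    polyMul P (prodZW (vertexFock A q p ε i) (vertexFock A q p ε' j)) a b =
      s • polyMul P' (prodWZ (vertexFock A q p ε i) (vertexFock A q p ε' j)) a b := by
  rw [← sub_eq_zero]
  refine LinearMap.ext fun v => ?_
  obtain ⟨K, hK₁, hK⟩ := exists_exp_annihilation_eq_zero A q v
  rw [polyMul_vertexFock_sub A q p hK₁ hK hA hP hP']
  simp [h, pairing]

theorem isHomogeneous_Z : Z.IsHomogeneous 1 := MvPolynomial.isHomogeneous_X ℂ 0

theorem isHomogeneous_W : W.IsHomogeneous 1 := MvPolynomial.isHomogeneous_X ℂ 1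

include hA hq0 hq in
theorem vertexFock_commute (ε ε' : ℤˣ) (i j : ι) (h : A i j = 0) (a b : ℤ) :
    vertexFock A q p ε i a * vertexFock A q p ε' j b =
      vertexFock A q p ε' j b * vertexFock A q p ε i a := by
  refine LinearMap.ext fun v => ?_
  obtain ⟨K, hK₁, hK⟩ := exists_exp_annihilation_eq_zero A q v
  rw [vertexFock_mul_vertexFock A q p hK₁ hK, vertexFock_mul_vertexFock_swap A q p hK₁ hK hA, h,
    opeSeries_zero hq0 hq]
  congr 1
  ext l
  rw [zcoeff_one, zcoeff_one]
  simp

include hA hq0 hq in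
-- The poles cancel and leave `(z - w)_{q²}^s`. Expanded from either side it is the same polynomial,
-- with the sign `(-1)^s` from exchanging `z` and `w`.
theorem vertexFock_opp (hp0 : p ≠ 0) (i j : ι) (s : ℕ) (h : A i j = -s) (a b : ℤ) :
    polyMul (qPow q s Z (-W)) (prodZW (vertexFock A q p 1 i) (vertexFock A q p (-1) j)) a b =
      (-1 : ℂ) ^ s • polyMul (qPow q s Z (-W))
        (prodWZ (vertexFock A q p 1 i) (vertexFock A q p (-1) j)) a b := by
  have hP := isHomogeneous_qPow (q := q) s isHomogeneous_Z isHomogeneous_W.neg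
  have hQ := isHomogeneous_qPow (q := q) s isHomogeneous_Z isHomogeneous_W
  have d1 : dehomogenize (qPow q s Z (-W)) =
      ∏ k ∈ Finset.range s, (1 + C (q ^ (2 * (k : ℤ) + 1 - s)) * X) := by
    rw [dehomogenize_qPow]; simp [dehomogenize]
  have d2 : dehomogenize' (qPow q s Z (-W)) =
      ∏ k ∈ Finset.range s, (1 + C (q ^ (2 * (k : ℤ) + 1 - s)) * X) := by
    rw [dehomogenize'_qPow, prod_qPow_symm hq0, ← Finset.card_range s, ← Finset.prod_const,
      Finset.card_range, ← Finset.prod_mul_distrib]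
    refine Finset.prod_congr rfl fun k _ => ?_
    simp [dehomogenize']; ring
  have d3 : dehomogenize (qPow q s Z W) =
      ∏ k ∈ Finset.range s, (1 - C (q ^ (2 * (k : ℤ) + 1 - s)) * X) := by
    rw [dehomogenize_qPow]; simp [dehomogenize]
  have d4 : dehomogenize' (qPow q s Z W) = ((-1 : ℂ) ^ s) • dehomogenize (qPow q s Z W) := by
    rw [dehomogenize'_qPow, prod_qPow_symm hq0, d3, PowerSeries.smul_eq_C_mul]
    simp [dehomogenize']
  refine polyMul_vertexFock_eq A q p hA hP hP 1 (-1) i j _ (fun l => ?_) a b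
  rw [h, d1, d2, prod_mul_opeSeries_opp hq0 hq hp0, ← d3, ← zcoeff_dehomogenize' hQ, d4,
    zcoeff_smul]
  rfl

include hA hq0 hq in
theorem vertexFock_same (hp : p ^ 2 = q) (ε : ℤˣ) (i j : ι) (t : ℕ)
    (h : A i j = -((t + 1 : ℕ) : ℤ)) (a b : ℤ) :
    polyMul (qPow q t Z W * (Z - K (q ^ ((ε : ℤ) * A i j)) * W) *
        (Z + K (q ^ (-((ε : ℤ) * A i j))) * W))
      (prodZW (vertexFock A q p ε i) (vertexFock A q p ε j)) a b =
    (-1 : ℂ) ^ (t + 1) •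
      polyMul (qPow q t Z W * (K (q ^ ((ε : ℤ) * A i j)) * Z - W) *
          (K (q ^ (-((ε : ℤ) * A i j))) * Z + W))
        (prodWZ (vertexFock A q p ε i) (vertexFock A q p ε j)) a b := by
  have hc0 : q ^ ((ε : ℤ) * A i j) ≠ 0 := zpow_ne_zero _ hq0
  have key := prod_mul_opeSeries_same hq0 hq hp t ε
  rw [← h] at key
  rw [zpow_neg]
  set c := q ^ ((ε : ℤ) * A i j)
  have hcc : (C c * C c⁻¹ : PowerSeries ℂ) = 1 := by
    rw [← map_mul, mul_inv_cancel₀ hc0, map_one]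
  have hl : ∀ x y : ℂ, (K x * Z + K y * W).IsHomogeneous 1 := isHomogeneous_linear
  have hP : (qPow q t Z W * (Z - K c * W) * (Z + K c⁻¹ * W)).IsHomogeneous (t + 1 + 1) := by
    refine ((isHomogeneous_qPow t isHomogeneous_Z isHomogeneous_W).mul ?_).mul ?_
    · simpa [sub_eq_add_neg] using hl 1 (-c)
    · simpa using hl 1 c⁻¹
  have hP' : (qPow q t Z W * (K c * Z - W) * (K c⁻¹ * Z + W)).IsHomogeneous (t + 1 + 1) := by
    refine ((isHomogeneous_qPow t isHomogeneous_Z isHomogeneous_W).mul ?_).mul ?_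
    · simpa [sub_eq_add_neg] using hl c (-1)
    · simpa using hl c⁻¹ 1
  -- This polynomial is what remains of the left-hand prefactor after multiplication by `f`. It is
  -- palindromic, so its two dehomogenizations agree.
  have hQ : (qPow q t Z (-W) * (Z + K c * W) * (Z + K c⁻¹ * W)).IsHomogeneous (t + 1 + 1) := by
    refine ((isHomogeneous_qPow t isHomogeneous_Z isHomogeneous_W.neg).mul ?_).mul ?_
    · simpa using hl 1 c
    · simpa using hl 1 c⁻¹
  have hneg : ((-1 : ℂ) ^ (t + 1)) * ((-1 : ℂ) ^ (t + 1)) = 1 := by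
    rw [← mul_pow]; simp
  have d1 : dehomogenize (qPow q t Z W * (Z - K c * W) * (Z + K c⁻¹ * W)) =
      (∏ k ∈ Finset.range t, (1 - C (q ^ (2 * (k : ℤ) + 1 - t)) * X)) * (1 - C c * X) *
        (1 + C c⁻¹ * X) := by
    rw [dehomogenize, map_mul, map_mul, ← dehomogenize, dehomogenize_qPow]
    simp [dehomogenize]
  have d2 : dehomogenize' (qPow q t Z W * (K c * Z - W) * (K c⁻¹ * Z + W)) =
      ((-1 : ℂ) ^ (t + 1)) • ((∏ k ∈ Finset.range t,
        (1 - C (q ^ (2 * (k : ℤ) + 1 - t)) * X)) * (1 - C c * X) * (1 + C c⁻¹ * X)) := by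
    rw [dehomogenize', map_mul, map_mul, ← dehomogenize', dehomogenize'_qPow, prod_qPow_symm hq0,
      PowerSeries.smul_eq_C_mul]
    simp only [dehomogenize', map_sub, map_add, map_mul, MvPolynomial.aeval_X, MvPolynomial.aeval_C,
      map_pow, map_neg, map_one]
    simp
    ring
  have d3 : dehomogenize (qPow q t Z (-W) * (Z + K c * W) * (Z + K c⁻¹ * W)) =
      (∏ k ∈ Finset.range t, (1 + C (q ^ (2 * (k : ℤ) + 1 - t)) * X)) * (1 + C c * X) *
        (1 + C c⁻¹ * X) := by
    rw [dehomogenize, map_mul, map_mul, ← dehomogenize, dehomogenize_qPow]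
    simp [dehomogenize]
  have d4 : dehomogenize' (qPow q t Z (-W) * (Z + K c * W) * (Z + K c⁻¹ * W)) =
      (∏ k ∈ Finset.range t, (1 + C (q ^ (2 * (k : ℤ) + 1 - t)) * X)) * (1 + C c * X) *
        (1 + C c⁻¹ * X) := by
    rw [dehomogenize', map_mul, map_mul, ← dehomogenize', dehomogenize'_qPow, prod_qPow_symm hq0]
    have : ∏ k ∈ Finset.range t, (1 + C (q ^ (2 * (k : ℤ) + 1 - t)) * X : PowerSeries ℂ) =
        (-1) ^ t * ∏ k ∈ Finset.range t,
          (dehomogenize' (-W) - C (q ^ (2 * (k : ℤ) + 1 - t)) * dehomogenize' Z) := by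
      rw [← Finset.card_range t, ← Finset.prod_const, Finset.card_range,
        ← Finset.prod_mul_distrib]
      refine Finset.prod_congr rfl fun k _ => ?_
      simp [dehomogenize']; ring
    rw [this]
    simp [dehomogenize', mul_assoc]
    left
    linear_combination (1 - X ^ 2) * hcc
  refine polyMul_vertexFock_eq A q p hA hP hP' ε ε i j _ (fun l => ?_) a b
  rw [d1, d2, smul_mul_assoc, zcoeff_smul, smul_eq_mul, ← mul_assoc, hneg, one_mul,
    mul_right_comm, key, ← d3, ← zcoeff_dehomogenize' hQ, d3, d4]

include hq0 hq in
-- Specialization at the two poles. At `w = q⁻¹ z` the creation parts cancel and the annihilation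
-- parts combine to `Ψ(q^{-1/2} z)`; at `w = q z` the annihilation parts cancel and the creation
-- parts combine to `Φ(q^{1/2} z)`.
theorem vertexFock_diag_series (i : ι) (hp : p ^ 2 = q) (hp0 : p ≠ 0) :
    Eminus A q p 1 i * scale q⁻¹ (Eminus A q p (-1) i) = 1 ∧
    Eplus A q p 1 i * scale q (Eplus A q p (-1) i) = scale p (Psi q (heis A q) i) ∧
    Eplus A q p 1 i * scale q⁻¹ (Eplus A q p (-1) i) = 1 ∧
    Eminus A q p 1 i * scale q (Eminus A q p (-1) i) = scale p (Phi q (heis A q) i) := by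
  have h1 : q - q⁻¹ ≠ 0 := by simpa using sub_inv_ne_zero hq0 hq one_pos
  have hpn : ∀ n : ℕ, p ^ n ≠ 0 := fun n => pow_ne_zero _ hp0
  have hqn : ∀ n : ℕ, q ^ n = p ^ n * p ^ n := fun n => by rw [← hp, ← pow_mul, two_mul, pow_add]
  simp only [Eminus_eq, Eplus_eq, Phi_heis, Psi_heis, exp_creation_mul_scale,
    exp_annihilation_mul_scale]
  simp only [scale_exp_creation, scale_exp_annihilation]
  refine ⟨exp_creation_eq_one A q i ?_, congrArg _ (annihilation_congr A q i ?_),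
    exp_annihilation_eq_one A q i ?_, congrArg _ (creation_congr A q i ?_)⟩
  all_goals
    intro n hn
    have h2 := sub_inv_ne_zero hq0 hq hn.pos
    have h3 := hpn n
    simp only [creationCoeff, annihilationCoeff, qInt_natCast, inv_pow, hqn] at h2 ⊢
    simp only [Units.val_one, Units.val_neg, Int.cast_one, Int.cast_neg, one_mul, neg_mul, neg_neg,
      zpow_neg, zpow_natCast]
    set x := q - q⁻¹ with hx
    try rw [show q⁻¹ - q = -x by rw [hx]; ring]
    set y := p ^ n * p ^ n - (p ^ n * p ^ n)⁻¹ with hy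
    field_simp
    try rw [hy]
    try field_simp
    try ring

include hA hq0 hq in
theorem vertexFock_diag (hp : p ^ 2 = q) (hp0 : p ≠ 0) (i : ι) (h : A i i = 2) (a b : ℤ) :
    vertexFock A q p 1 i a * vertexFock A q p (-1) i b -
      vertexFock A q p (-1) i b * vertexFock A q p 1 i a =
    (2 * (q + q⁻¹) / (q - q⁻¹)) • (q ^ b • p⁻¹ ^ (a + b) • PsiD q (heis A q) i (a + b) -
      q⁻¹ ^ b • p ^ (a + b) • PhiD q (heis A q) i (a + b)) := by
  obtain ⟨h1, h2, h3, h4⟩ := vertexFock_diag_series A q p hq0 hq i hp hp0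
  refine LinearMap.ext fun v => ?_
  obtain ⟨K, hK₁, hK⟩ := exists_exp_annihilation_eq_zero A q v
  have hn : LineFinite (normalVertex A q p 1 (-1) i i K v) := lineFinite_normalOrder
  have hK' := hK i i (annihilationCoeff q p 1) (annihilationCoeff q p (-1))
  rw [LinearMap.sub_apply, vertexFock_mul_vertexFock A q p hK₁ hK,
    vertexFock_mul_vertexFock_swap A q p hK₁ hK hA, h,
    ← one_smul ℂ (pairing (fun l => zcoeff _ (-l)) _ _ _), pairing_sub_smul hn]
  simp_rw [one_mul, zcoeff_opeSeries_sub hq0 hq hp0]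
  rw [← pairing_smul hn, ← one_smul ℂ (_ - _ : Module.End ℂ (Fock ι))]
  have e : ∀ l : ℤ, q ^ l - q⁻¹ ^ l = q ^ l - 1 * q⁻¹ ^ l := fun l => by rw [one_mul]
  simp_rw [e]
  -- The term `δ(q w/z)`, where only annihilation operators survive; `e2` is the term `δ(q⁻¹ w/z)`,
  -- where only creation operators survive.
  have e1 : pairing (fun l => q ^ l) (normalVertex A q p 1 (-1) i i K v) a b =
      q ^ b • zcoeff (Eplus A q p 1 i * scale q (Eplus A q p (-1) i)) (-(a + b)) v :=
    pairing_zpow_of_left_eq_one hq0 hK' h1 a b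
  have e2 : pairing (fun l => q⁻¹ ^ l) (normalVertex A q p 1 (-1) i i K v) a b =
      q⁻¹ ^ b • zcoeff (Eminus A q p 1 i * scale q⁻¹⁻¹ (Eminus A q p (-1) i)) (a + b) v :=
    pairing_zpow_of_right_eq_one (inv_ne_zero hq0) hK' h3 a b
  rw [← pairing_sub_smul hn, e1, e2, inv_inv, h2, h4, zcoeff_scale, zcoeff_scale, PsiD, PhiD,
    zpow_neg, inv_zpow p]
  simp

include hA hq0 hq in
theorem vertexFock_self (hp : p ^ 2 = q) (ε : ℤˣ) (i : ι) (h : A i i = 2) (a b : ℤ) :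
    polyMul ((Z - K (q ^ (2 * (ε : ℤ))) * W) * (Z + K (q ^ (-(2 * (ε : ℤ)))) * W))
        (prodZW (vertexFock A q p ε i) (vertexFock A q p ε i)) a b -
      (1 : ℂ) • polyMul ((K (q ^ (2 * (ε : ℤ))) * Z - W) * (K (q ^ (-(2 * (ε : ℤ)))) * Z + W))
        (prodWZ (vertexFock A q p ε i) (vertexFock A q p ε i)) a b =
    (2 * (q + q⁻¹) ^ 2) • deltaNeg 1 (a - 2) b := by
  have key := zcoeff_opeSeries_self (p := p) hq0 hq hp ε
  have hc0 : q ^ (2 * (ε : ℤ)) ≠ 0 := zpow_ne_zero _ hq0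
  rw [zpow_neg] at key ⊢
  set c := q ^ (2 * (ε : ℤ))
  have hl : ∀ x y : ℂ, (K x * Z + K y * W).IsHomogeneous 1 := isHomogeneous_linear
  have hP : ((Z - K c * W) * (Z + K c⁻¹ * W)).IsHomogeneous (1 + 1) := by
    refine MvPolynomial.IsHomogeneous.mul ?_ ?_
    · simpa [sub_eq_add_neg] using hl 1 (-c)
    · simpa using hl 1 c⁻¹
  have hP' : ((K c * Z - W) * (K c⁻¹ * Z + W)).IsHomogeneous (1 + 1) := by
    refine MvPolynomial.IsHomogeneous.mul ?_ ?_
    · simpa [sub_eq_add_neg] using hl c (-1)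
    · simpa using hl c⁻¹ 1
  have d1 : dehomogenize ((Z - K c * W) * (Z + K c⁻¹ * W)) =
      (1 - C c * X) * (1 + C c⁻¹ * X) := by
    simp [dehomogenize]
  have d2 : dehomogenize' ((K c * Z - W) * (K c⁻¹ * Z + W)) =
      -((1 - C c * X) * (1 + C c⁻¹ * X)) := by
    simp [dehomogenize']; ring
  have hneg : ∀ n : ℕ, Odd n → (-1 : ℂ) ^ n = -1 := fun n hn => hn.neg_one_pow
  -- Only odd modes occur, so replacing `z` by `-z` inverts the exponential. At `w = -z` the whole
  -- normally ordered product is the identity.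
  have h1 : Eminus A q p ε i * scale (-1)⁻¹ (Eminus A q p ε i) = 1 := by
    rw [Eminus_eq, exp_creation_mul_scale]
    refine exp_creation_eq_one A q i fun n hn => ?_
    rw [inv_neg_one, hneg n hn]; ring
  have h2 : Eplus A q p ε i * scale (-1) (Eplus A q p ε i) = 1 := by
    rw [Eplus_eq, exp_annihilation_mul_scale]
    refine exp_annihilation_eq_one A q i fun n hn => ?_
    rw [hneg n hn]; ring
  refine LinearMap.ext fun v => ?_
  obtain ⟨K, hK₁, hK⟩ := exists_exp_annihilation_eq_zero A q v
  have hn : LineFinite (normalVertex A q p ε ε i i K v) := lineFinite_normalOrder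
  rw [polyMul_vertexFock_sub A q p hK₁ hK hA hP hP', h, d1, d2]
  have e2 : (((1 + 1 : ℕ) : ℤ)) = 2 := rfl
  simp_rw [neg_mul, zcoeff_neg, one_mul, sub_neg_eq_add, e2, key]
  have e3 : pairing (fun l => (-1) ^ l) (normalVertex A q p ε ε i i K v) (a - 2) b =
      (-1 : ℂ) ^ b • zcoeff (Eplus A q p ε i * scale (-1) (Eplus A q p ε i)) (-(a - 2 + b)) v :=
    pairing_zpow_of_left_eq_one (by norm_num) (hK i i _ _) h1 (a - 2) b
  rw [← pairing_smul hn, e3, h2, zcoeff_one, deltaNeg]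
  by_cases h0 : a - 2 + b = 0
  · rw [if_pos (by omega), if_pos h0]; simp
  · rw [if_neg (by omega), if_neg h0]; simp

theorem exists_Eplus_eq_zero (ε : ℤˣ) (i : ι) (u : Fock ι) :
    ∃ K : ℕ, ∀ k, K ≤ k → coeff k (Eplus A q p ε i) u = 0 := by
  obtain ⟨K, hK, -⟩ := exists_exp_annihilation_eq_zero A q u
  exact ⟨K, hK i _⟩

include hA hq0 hq in
-- Symmetry of `A` is needed because the annihilation operators of the vertex operator, with index
-- `j`, act on the creation operators of `Φ_i`.
theorem coeff_Phi_mul_vertexFock (ε : ℤˣ) (i j : ι) (m : ℕ) (b : ℤ) :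
    coeff m (Phi q (heis A q) i) * vertexFock A q p ε j b =
      ∑ h ∈ Finset.range (m + 1), coeff h (rescale (p ^ (-(ε : ℤ))) (Gpow q (A i j) ε)) •
        (vertexFock A q p ε j (b + h) * coeff (m - h) (Phi q (heis A q) i)) := by
  rw [← expSeries_contraction_phi hq0 hq, hA i j]
  exact coeff_mul_vertex_of_creation (vertexFock_apply A q p ε j) (exists_Eplus_eq_zero A q p ε j)
    (commute_exp_creation A q i j _ _) (exp_creation_mul_exp_annihilation A q i j _ _) m b

include hq0 hq in
theorem coeff_Psi_mul_vertexFock (ε : ℤˣ) (i j : ι) (m : ℕ) (b : ℤ) :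
    coeff m (Psi q (heis A q) i) * vertexFock A q p ε j b =
      ∑ h ∈ Finset.range (m + 1), coeff h (rescale (p ^ (-(ε : ℤ))) (Gpow q (A i j) (-ε))) •
        (vertexFock A q p ε j (b - h) * coeff (m - h) (Psi q (heis A q) i)) := by
  rw [← expSeries_contraction_psi hq0 hq]
  exact coeff_mul_vertex_of_annihilation (vertexFock_apply A q p ε j)
    (exists_Eplus_eq_zero A q p ε j)
    (commute_exp_annihilation A q i j _ _) (exp_annihilation_mul_exp_creation A q i j _ _) m b

include hA hq0 hq in
theorem coeff_Phi_mul_coeff_Psi (i j : ι) (m n : ℕ) :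
    coeff m (Phi q (heis A q) i) * coeff n (Psi q (heis A q) j) =
      ∑ k ∈ Finset.range (min m n + 1),
        coeff k (rescale q⁻¹ (G q (A i j)) * (rescale q (G q (A i j)))⁻¹) •
        (coeff (n - k) (Psi q (heis A q) j) * coeff (m - k) (Phi q (heis A q) i)) := by
  rw [← expSeries_contraction_phi_psi hq0 hq, hA i j]
  exact exp_creation_mul_exp_annihilation A q i j _ _ m n

end FockRelations

/-! ### From the Fock space to the tensor product with `T` -/

section PolyMul

variable {R S : Type*} [Ring R] [Algebra ℂ R] [Ring S] [Algebra ℂ S]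

theorem map_polyMul (L : R →ₗ[ℂ] S) (P : MvPolynomial (Fin 2) ℂ) (F : ℤ → ℤ → R) (a b : ℤ) :
    L (polyMul P F a b) = polyMul P (fun a b => L (F a b)) a b := by
  simp [polyMul]

theorem polyMul_sub (P : MvPolynomial (Fin 2) ℂ) (F H : ℤ → ℤ → R) (a b : ℤ) :
    polyMul P (F - H) a b = polyMul P F a b - polyMul P H a b := by
  simp [polyMul, smul_sub]

theorem polyMul_smul (P : MvPolynomial (Fin 2) ℂ) (c : ℂ) (F : ℤ → ℤ → R) (a b : ℤ) :
    polyMul P (c • F) a b = c • polyMul P F a b := by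
  simp [polyMul, smul_comm _ c, Finset.smul_sum]

theorem polyMul_K_mul_Z_pow (c : ℂ) (k : ℕ) (F : ℤ → ℤ → R) (a b : ℤ) :
    polyMul (K c * Z ^ k) F a b = c • F (a - k) b := by
  classical
  rw [MvPolynomial.C_mul_X_pow_eq_monomial, polyMul, MvPolynomial.support_monomial]
  split_ifs with h
  · simp [h]
  · simp

end PolyMul

/-- An action on an algebra `S` of operators on the Fock space and, commuting with it, of operators
on `T`: the operator `f ⊗ g` is `act g f`. -/
structure TensorAction (ι T S : Type*) [AddCommGroup T] [Module ℂ T] [Ring S] [Algebra ℂ S] where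
  act : Module.End ℂ T → Module.End ℂ (Fock ι) →ₗ[ℂ] S
  act_mul : ∀ g g' f f', act g f * act g' f' = act (g * g') (f * f')
  act_one : act 1 1 = 1
  act_smul : ∀ (c : ℂ) g f, act (c • g) f = c • act g f

/-- The operators `f ⊗ g` on `V_Q`. -/
def tensorAction (ι T : Type*) [AddCommGroup T] [Module ℂ T] :
    TensorAction ι T (Module.End ℂ (Fock ι ⊗[ℂ] T)) where
  act g :=
    { toFun := fun f => TensorProduct.map f g
      map_add' := fun f f' => TensorProduct.map_add_left f f' g
      map_smul' := fun c f => TensorProduct.map_smul_left c f g }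
  act_mul g g' f f' := (TensorProduct.map_comp f g f' g').symm
  act_one := TensorProduct.map_id
  act_smul c g f := TensorProduct.map_smul_right c f g

section Tensor

variable {ι : Type*} {T S : Type*} [AddCommGroup T] [Module ℂ T] [Ring S] [Algebra ℂ S]
  (τ : TensorAction ι T S)

/-- The action of the operators on the Fock space. -/
def TensorAction.fock : Module.End ℂ (Fock ι) →ₐ[ℂ] S :=
  AlgHom.ofLinearMap (τ.act 1) τ.act_one fun f f' => by rw [τ.act_mul, one_mul]

theorem fock_apply (f : Module.End ℂ (Fock ι)) : τ.fock f = τ.act 1 f := rfl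

theorem fock_mul_act (f f' : Module.End ℂ (Fock ι)) (g : Module.End ℂ T) :
    τ.fock f * τ.act g f' = τ.act g (f * f') := by
  rw [fock_apply, τ.act_mul, one_mul]

theorem act_mul_fock (f f' : Module.End ℂ (Fock ι)) (g : Module.End ℂ T) :
    τ.act g f * τ.fock f' = τ.act g (f * f') := by
  rw [fock_apply, τ.act_mul, mul_one]

/-- The operators `a_i(m)` on `V_Q`. -/
def TensorAction.heis (A : ι → ι → ℤ) (q : ℂ) (i : ι) (m : ℤ) : S :=
  τ.fock (TwistedLoop.heis A q i m)

variable (A : ι → ι → ℤ) (q p : ℂ)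

theorem map_coeff_Phi {R S : Type*} [Ring R] [Algebra ℂ R] [Ring S] [Algebra ℂ S] (φ : R →ₐ[ℂ] S)
    {a : ι → ℤ → R} {a' : ι → ℤ → S} (h : ∀ i m, Odd m → φ (a i m) = a' i m) (i : ι) (m : ℕ) :
    φ (coeff m (Phi q a i)) = coeff m (Phi q a' i) := by
  rw [Phi, map_coeff_expSeries, Phi]
  congr 2
  ext1 k
  split_ifs with hk
  · rw [map_smul, h i _ (by simpa using hk)]
  · exact map_zero _

theorem map_coeff_Psi {R S : Type*} [Ring R] [Algebra ℂ R] [Ring S] [Algebra ℂ S] (φ : R →ₐ[ℂ] S)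
    {a : ι → ℤ → R} {a' : ι → ℤ → S} (h : ∀ i m, Odd m → φ (a i m) = a' i m) (i : ι) (m : ℕ) :
    φ (coeff m (Psi q a i)) = coeff m (Psi q a' i) := by
  rw [Psi, map_coeff_expSeries, Psi]
  congr 2
  ext1 k
  split_ifs with hk
  · rw [map_smul, h i _ (by simpa using hk)]
  · exact map_zero _

theorem map_PhiD {R S : Type*} [Ring R] [Algebra ℂ R] [Ring S] [Algebra ℂ S] (φ : R →ₐ[ℂ] S)
    {a : ι → ℤ → R} {a' : ι → ℤ → S} (h : ∀ i m, Odd m → φ (a i m) = a' i m) (i : ι) (m : ℤ) :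
    φ (PhiD q a i m) = PhiD q a' i m := by
  rw [PhiD, PhiD, zcoeff, zcoeff]
  split_ifs
  · exact map_coeff_Phi q φ h i _
  · exact map_zero _

theorem map_PsiD {R S : Type*} [Ring R] [Algebra ℂ R] [Ring S] [Algebra ℂ S] (φ : R →ₐ[ℂ] S)
    {a : ι → ℤ → R} {a' : ι → ℤ → S} (h : ∀ i m, Odd m → φ (a i m) = a' i m) (i : ι) (m : ℤ) :
    φ (PsiD q a i m) = PsiD q a' i m := by
  rw [PsiD, PsiD, zcoeff, zcoeff]
  split_ifs
  · exact map_coeff_Psi q φ h i _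
  · exact map_zero _

theorem coeff_Phi_tensor (i : ι) (m : ℕ) : coeff m (Phi q (τ.heis A q) i) =
    τ.fock (coeff m (Phi q (heis A q) i)) :=
  (map_coeff_Phi q τ.fock (fun _ _ _ => rfl) i m).symm

theorem coeff_Psi_tensor (i : ι) (m : ℕ) : coeff m (Psi q (τ.heis A q) i) =
    τ.fock (coeff m (Psi q (heis A q) i)) :=
  (map_coeff_Psi q τ.fock (fun _ _ _ => rfl) i m).symm

theorem isUnit_of_expSeries {R : Type*} [Ring R] [Algebra ℂ R] {s : ℕ → R} (h0 : s 0 = 0)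
    (hs : ∀ m n, Commute (s m) (s n)) : IsUnit (expSeries s) :=
  ⟨⟨_, _, expSeries_mul_neg h0 hs, expSeries_neg_mul h0 hs⟩, rfl⟩

theorem isUnit_Phi (i : ι) : IsUnit (Phi q (τ.heis A q) i) := by
  have h : Phi q (τ.heis A q) i =
      expSeries fun n => τ.fock (creation A q i (fun _ => 2 * (q⁻¹ - q)) n) := by
    ext1 m
    rw [coeff_Phi_tensor, Phi_heis, map_coeff_expSeries]
  rw [h]
  exact isUnit_of_expSeries (by simp) fun m n => (creation_commute A q i i _ _ m n).map _

theorem isUnit_Psi (i : ι) : IsUnit (Psi q (τ.heis A q) i) := by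
  have h : Psi q (τ.heis A q) i =
      expSeries fun n => τ.fock (annihilation A q i (fun _ => 2 * (q - q⁻¹)) n) := by
    ext1 m
    rw [coeff_Psi_tensor, Psi_heis, map_coeff_expSeries]
  rw [h]
  exact isUnit_of_expSeries (by simp) fun m n => (annihilation_commute A q i i _ _ m n).map _

/-- Turns the coefficientwise form, convenient for computation, into conjugation by an invertible
series. -/
theorem conj_eq_of_coeff {R : Type*} [Ring R] {Y : PowerSeries R} (hY : IsUnit Y) {x : R}
    {y : ℕ → R} (h : ∀ m, coeff m Y * x =
      ∑ l ∈ Finset.HasAntidiagonal.antidiagonal m, y l.1 * coeff l.2 Y) :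
    Y * C x * Ring.inverse Y = PowerSeries.mk y := by
  have h1 : Y * C x = PowerSeries.mk y * Y := by
    ext m
    rw [coeff_mul_C, h, coeff_mul]
    simp
  rw [h1, mul_assoc, Ring.mul_inverse_cancel _ hY, mul_one]

end Tensor

/-! ### The relations on `V_Q` -/

section Vertex

variable {ι : Type*} (A : ι → ι → ℤ) (q p : ℂ) {E T S : Type*} [Group E] [AddCommGroup T]
  [Module ℂ T] [Ring S] [Algebra ℂ S] (τ : TensorAction ι T S) (ρ : Representation ℂ E T) (e : ι → E)

/-- The twisted vertex operator `X_i^ε(z)` on `V_Q`. -/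
def TensorAction.vertex (ε : ℤˣ) (i : ι) (a : ℤ) : S :=
  τ.act (ρ (e i ^ (ε : ℤ))) (vertexFock A q p ε i a)

theorem vertex_eq (ε : ℤˣ) (i : ι) (a : ℤ) : τ.vertex A q p ρ e ε i a =
    τ.act (ρ (e i ^ (ε : ℤ))) (vertexFock A q p ε i a) := rfl

/-- As `s² = 1`, inverting either element does not change the commutation factor. -/
theorem map_zpow_unit_commutation {x y : E} {s : ℂ} (hs : s * s = 1)
    (h : ρ x * ρ y = s • (ρ y * ρ x)) (ε ε' : ℤˣ) :
    ρ (x ^ (ε : ℤ)) * ρ (y ^ (ε' : ℤ)) = s • (ρ (y ^ (ε' : ℤ)) * ρ (x ^ (ε : ℤ))) := by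
  have inv : ∀ {x y : E}, ρ x * ρ y = s • (ρ y * ρ x) → ρ x⁻¹ * ρ y = s • (ρ y * ρ x⁻¹) := by
    intro x y h
    have h1 : ρ x⁻¹ * (ρ x * ρ y) * ρ x⁻¹ = s • (ρ x⁻¹ * (ρ y * ρ x) * ρ x⁻¹) := by
      rw [h, mul_smul_comm, smul_mul_assoc]
    simp only [← map_mul] at h1 ⊢
    rw [inv_mul_cancel_left, mul_assoc, mul_assoc, mul_inv_cancel, mul_one] at h1
    rw [h1, smul_smul, hs, one_smul]
  have symm : ∀ {x y : E}, ρ x * ρ y = s • (ρ y * ρ x) → ρ y * ρ x = s • (ρ x * ρ y) := by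
    intro x y h
    rw [h, smul_smul, hs, one_smul]
  have left : ρ (x ^ (ε : ℤ)) * ρ y = s • (ρ y * ρ (x ^ (ε : ℤ))) := by
    rcases Int.units_eq_one_or ε with rfl | rfl
    · simpa using h
    · simpa using inv h
  rcases Int.units_eq_one_or ε' with rfl | rfl
  · simpa using left
  · simpa using symm (inv (symm left))

variable (hA : ∀ i j, A i j = A j i) (hq0 : q ≠ 0) (hq : ∀ n : ℕ, 0 < n → q ^ n ≠ 1)
  (hcomm : ∀ i j, ρ (e i) * ρ (e j) = ((-1 : ℂ) ^ A i j) • (ρ (e j) * ρ (e i)))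

theorem prodZW_vertex (ε ε' : ℤˣ) (i j : ι) :
    prodZW (τ.vertex A q p ρ e ε i) (τ.vertex A q p ρ e ε' j) = fun a b =>
      τ.act (ρ (e i ^ (ε : ℤ)) * ρ (e j ^ (ε' : ℤ)))
        (prodZW (vertexFock A q p ε i) (vertexFock A q p ε' j) a b) := by
  ext1 a; ext1 b
  exact τ.act_mul _ _ _ _

theorem neg_one_zpow_mul_self (n : ℤ) : (-1 : ℂ) ^ n * (-1) ^ n = 1 := by
  rw [← mul_zpow]; simp

include hcomm in
-- Writes both orders over the same operator on `T`; the exchange costs the sign `(-1)^r`, which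
-- each Fock space identity has to compensate.
theorem prodWZ_vertex (ε ε' : ℤˣ) (i j : ι) :
    prodWZ (τ.vertex A q p ρ e ε i) (τ.vertex A q p ρ e ε' j) = (-1 : ℂ) ^ A i j • fun a b =>
      τ.act (ρ (e i ^ (ε : ℤ)) * ρ (e j ^ (ε' : ℤ)))
        (prodWZ (vertexFock A q p ε i) (vertexFock A q p ε' j) a b) := by
  ext1 a; ext1 b
  rw [map_zpow_unit_commutation ρ (neg_one_zpow_mul_self _) (hcomm i j)]
  simp only [Pi.smul_apply]
  rw [τ.act_smul, smul_smul, neg_one_zpow_mul_self, one_smul]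
  exact τ.act_mul _ _ _ _

theorem Phi_commute (i j : ι) (m n : ℕ) : Commute (coeff m (Phi q (τ.heis A q) i))
    (coeff n (Phi q (τ.heis A q) j)) := by
  rw [coeff_Phi_tensor, coeff_Phi_tensor]
  exact (commute_exp_creation A q i j _ _ m n).map _

theorem Psi_commute (i j : ι) (m n : ℕ) : Commute (coeff m (Psi q (τ.heis A q) i))
    (coeff n (Psi q (τ.heis A q) j)) := by
  rw [coeff_Psi_tensor, coeff_Psi_tensor]
  exact (commute_exp_annihilation A q i j _ _ m n).map _

include hA hq0 hq in
theorem Phi_mul_Psi (i j : ι) (m n : ℕ) :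
    coeff m (Phi q (τ.heis A q) i) * coeff n (Psi q (τ.heis A q) j) =
      ∑ k ∈ Finset.range (min m n + 1),
        coeff k (rescale q⁻¹ (G q (A i j)) * (rescale q (G q (A i j)))⁻¹) •
        (coeff (n - k) (Psi q (τ.heis A q) j) * coeff (m - k) (Phi q (τ.heis A q) i)) := by
  simp only [coeff_Phi_tensor, coeff_Psi_tensor, ← map_mul]
  rw [coeff_Phi_mul_coeff_Psi A q hA hq0 hq, map_sum]
  simp only [map_smul]

include hA hq0 hq in
theorem Phi_mul_vertex (ε : ℤˣ) (i j : ι) (m : ℕ) (b : ℤ) :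
    coeff m (Phi q (τ.heis A q) i) * τ.vertex A q p ρ e ε j b =
      ∑ l ∈ Finset.HasAntidiagonal.antidiagonal m,
        (coeff l.1 (rescale (p ^ (-(ε : ℤ))) (Gpow q (A i j) ε)) •
          τ.vertex A q p ρ e ε j (b + l.1)) * coeff l.2 (Phi q (τ.heis A q) i) := by
  simp only [coeff_Phi_tensor, vertex_eq]
  rw [fock_mul_act, coeff_Phi_mul_vertexFock A q p hA hq0 hq, map_sum,
    Finset.Nat.sum_antidiagonal_eq_sum_range_succ_mk]
  refine Finset.sum_congr rfl fun k _ => ?_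
  rw [map_smul, smul_mul_assoc, act_mul_fock]

include hq0 hq in
theorem Psi_mul_vertex (ε : ℤˣ) (i j : ι) (m : ℕ) (b : ℤ) :
    coeff m (Psi q (τ.heis A q) i) * τ.vertex A q p ρ e ε j b =
      ∑ l ∈ Finset.HasAntidiagonal.antidiagonal m,
        (coeff l.1 (rescale (p ^ (-(ε : ℤ))) (Gpow q (A i j) (-ε))) •
          τ.vertex A q p ρ e ε j (b - l.1)) * coeff l.2 (Psi q (τ.heis A q) i) := by
  simp only [coeff_Psi_tensor, vertex_eq]
  rw [fock_mul_act, coeff_Psi_mul_vertexFock A q p hq0 hq, map_sum,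
    Finset.Nat.sum_antidiagonal_eq_sum_range_succ_mk]
  refine Finset.sum_congr rfl fun k _ => ?_
  rw [map_smul, smul_mul_assoc, act_mul_fock]

include hA hq0 hq hcomm in
theorem comm_vertex_eq_zero (ε ε' : ℤˣ) (i j : ι) (h : A i j = 0) :
    comm (τ.vertex A q p ρ e ε i) (τ.vertex A q p ρ e ε' j) = 0 := by
  rw [comm, prodZW_vertex, prodWZ_vertex A q p τ ρ e hcomm, h, zpow_zero, one_smul, sub_eq_zero]
  ext1 a; ext1 b
  exact congrArg _ (vertexFock_commute A q p hA hq0 hq ε ε' i j h a b)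

include hA hq0 hq hcomm in
theorem qPow_mul_comm_vertex (hp0 : p ≠ 0) (i j : ι) (h : A i j < 0) :
    polyMul (qPow q (-A i j).toNat Z (-W))
      (comm (τ.vertex A q p ρ e 1 i) (τ.vertex A q p ρ e (-1) j)) = 0 := by
  obtain ⟨s, hs⟩ : ∃ s : ℕ, A i j = -s := ⟨(-A i j).toNat, by omega⟩
  ext1 a; ext1 b
  -- The sign `(-1)^{-s}` from `T` equals the sign `(-1)^s` from the Fock space, so the two products
  -- cancel.
  rw [comm, prodZW_vertex, prodWZ_vertex A q p τ ρ e hcomm, polyMul_sub, polyMul_smul,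
    ← map_polyMul, ← map_polyMul, ← map_smul, hs, neg_neg, Int.toNat_natCast,
    vertexFock_opp A q p hA hq0 hq hp0 i j s hs, zpow_neg, zpow_natCast, ← inv_pow, inv_neg_one,
    sub_self]
  rfl

include hA hq0 hq in
theorem comm_vertex_diag (hp : p ^ 2 = q) (hp0 : p ≠ 0) (i : ι) (h : A i i = 2) :
    comm (τ.vertex A q p ρ e 1 i) (τ.vertex A q p ρ e (-1) i) =
      (2 * (q + q⁻¹) / (q - q⁻¹)) •
        (deltaMul q (dilate p⁻¹ (PsiD q (τ.heis A q) i)) -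
          deltaMul q⁻¹ (dilate p (PhiD q (τ.heis A q) i))) := by
  have h1 : ρ (e i ^ ((1 : ℤˣ) : ℤ)) * ρ (e i ^ ((-1 : ℤˣ) : ℤ)) = 1 := by
    rw [← map_mul]; simp
  have h2 : ρ (e i ^ ((-1 : ℤˣ) : ℤ)) * ρ (e i ^ ((1 : ℤˣ) : ℤ)) = 1 := by
    rw [← map_mul]; simp
  ext1 a; ext1 b
  change τ.vertex A q p ρ e 1 i a * τ.vertex A q p ρ e (-1) i b -
    τ.vertex A q p ρ e (-1) i b * τ.vertex A q p ρ e 1 i a =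
    (2 * (q + q⁻¹) / (q - q⁻¹)) • (q ^ b • p⁻¹ ^ (a + b) • PsiD q (τ.heis A q) i (a + b) -
      q⁻¹ ^ b • p ^ (a + b) • PhiD q (τ.heis A q) i (a + b))
  simp only [vertex_eq]
  rw [τ.act_mul, τ.act_mul, h1, h2, ← map_sub,
    vertexFock_diag A q p hA hq0 hq hp hp0 i h, ← fock_apply,
    ← map_PsiD q τ.fock (a := heis A q) (a' := τ.heis A q) (fun _ _ _ => rfl),
    ← map_PhiD q τ.fock (a := heis A q) (a' := τ.heis A q) (fun _ _ _ => rfl)]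
  simp only [map_smul, map_sub]

include hA hq0 hq hcomm in
theorem polyMul_vertex_same (hp : p ^ 2 = q) (ε : ℤˣ) (i j : ι) (h : A i j < 0) :
    polyMul (qPow q (-A i j - 1).toNat Z W * (Z - K (q ^ ((ε : ℤ) * A i j)) * W) *
        (Z + K (q ^ (-((ε : ℤ) * A i j))) * W))
      (prodZW (τ.vertex A q p ρ e ε i) (τ.vertex A q p ρ e ε j)) =
    polyMul (qPow q (-A i j - 1).toNat Z W * (K (q ^ ((ε : ℤ) * A i j)) * Z - W) *
        (K (q ^ (-((ε : ℤ) * A i j))) * Z + W))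
      (prodWZ (τ.vertex A q p ρ e ε i) (τ.vertex A q p ρ e ε j)) := by
  obtain ⟨t, ht⟩ : ∃ t : ℕ, A i j = -((t + 1 : ℕ) : ℤ) := ⟨(-A i j - 1).toNat, by omega⟩
  have ht' : (-A i j - 1).toNat = t := by omega
  ext1 a; ext1 b
  rw [prodZW_vertex, prodWZ_vertex A q p τ ρ e hcomm, polyMul_smul, ← map_polyMul, ← map_polyMul,
    ← map_smul, ht', vertexFock_same A q p hA hq0 hq hp ε i j t ht,
    show (-1 : ℂ) ^ A i j = (-1) ^ (t + 1) by
      rw [ht, zpow_neg, zpow_natCast, ← inv_pow, inv_neg_one]]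

include hA hq0 hq in
theorem polyMul_vertex_self (hp : p ^ 2 = q) (ε : ℤˣ) (i : ι) (h : A i i = 2) :
    polyMul ((Z - K (q ^ (2 * (ε : ℤ))) * W) * (Z + K (q ^ (-(2 * (ε : ℤ)))) * W))
        (prodZW (τ.vertex A q p ρ e ε i) (τ.vertex A q p ρ e ε i)) =
      polyMul ((K (q ^ (2 * (ε : ℤ))) * Z - W) * (K (q ^ (-(2 * (ε : ℤ)))) * Z + W))
          (prodWZ (τ.vertex A q p ρ e ε i) (τ.vertex A q p ρ e ε i)) +
        polyMul (K (2 * (q + q⁻¹) ^ 2) * Z ^ 2) (deltaNeg (τ.act (ρ (e i ^ (2 * (ε : ℤ)))) 1)) := by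
  have hg : ρ (e i ^ (ε : ℤ)) * ρ (e i ^ (ε : ℤ)) = ρ (e i ^ (2 * (ε : ℤ))) := by
    rw [← map_mul, ← zpow_add, two_mul]
  have hWZ : prodWZ (τ.vertex A q p ρ e ε i) (τ.vertex A q p ρ e ε i) = fun a b =>
      τ.act (ρ (e i ^ (2 * (ε : ℤ))))
        (prodWZ (vertexFock A q p ε i) (vertexFock A q p ε i) a b) := by
    ext1 a; ext1 b
    rw [← hg]
    exact τ.act_mul _ _ _ _
  have hd : ∀ a b : ℤ, deltaNeg (τ.act (ρ (e i ^ (2 * (ε : ℤ)))) 1) a b =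
      τ.act (ρ (e i ^ (2 * (ε : ℤ)))) (deltaNeg 1 a b) := by
    intro a b
    rw [deltaNeg, deltaNeg]
    split_ifs
    · rw [map_smul]
    · rw [map_zero]
  ext1 a; ext1 b
  rw [Pi.add_apply, Pi.add_apply, ← sub_eq_iff_eq_add', prodZW_vertex, hWZ, hg, ← map_polyMul,
    ← map_polyMul, ← map_sub, polyMul_K_mul_Z_pow, hd, ← map_smul,
    ← one_smul ℂ (polyMul _ (prodWZ _ _) _ _), vertexFock_self A q p hA hq0 hq hp ε i h]
  rfl

end Vertex

/-! ### The level one representation of the loop algebra -/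

section LoopAlgebra

variable {ι : Type*} (A : ι → ι → ℤ) (q p : ℂ) {E T S : Type*} [Group E] [AddCommGroup T]
  [Module ℂ T] [Ring S] [Algebra ℂ S] (τ : TensorAction ι T S) (ρ : Representation ℂ E T) (e : ι → E)

/-- The images of the generators in the level one representation. -/
def genImage : Gen ι → S
  | Gen.a i m => τ.heis A q i m
  | Gen.x ε i n => τ.vertex A q p ρ e ε i (-n)
  | Gen.c => 1
  | Gen.g => p • 1
  | Gen.gi => p⁻¹ • 1

/-- The level one representation, on the free algebra. -/
def freeRep : FreeAlgebra ℂ (Gen ι) →ₐ[ℂ] S := FreeAlgebra.lift ℂ (genImage A q p τ ρ e)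

theorem freeRep_gen (y : Gen ι) : freeRep A q p τ ρ e (gen y) = genImage A q p τ ρ e y :=
  FreeAlgebra.lift_ι_apply _ _

theorem freeRep_genA (i : ι) (m : ℤ) (hm : Odd m) :
    freeRep A q p τ ρ e (genA i m) = τ.heis A q i m := by
  rw [genA, dif_pos hm, freeRep_gen]; rfl

theorem freeRep_genX (ε : ℤˣ) (i : ι) (a : ℤ) :
    freeRep A q p τ ρ e (genX ε i a) = τ.vertex A q p ρ e ε i a := by
  rw [genX, freeRep_gen, genImage, neg_neg]

theorem freeRep_gam (k : ℤ) : freeRep A q p τ ρ e (gam k) = p ^ k • 1 := by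
  rw [gam]
  split_ifs with h
  · lift k to ℕ using h
    rw [map_pow, freeRep_gen, genImage, smul_pow, one_pow, Int.toNat_natCast, zpow_natCast]
  · obtain ⟨n, hn⟩ : ∃ n : ℕ, k = -n := ⟨(-k).toNat, by omega⟩
    rw [map_pow, freeRep_gen, genImage, smul_pow, one_pow, hn, neg_neg, Int.toNat_natCast, zpow_neg,
      zpow_natCast, inv_pow]

theorem freeRep_phi (i : ι) (m : ℕ) : freeRep A q p τ ρ e (coeff m (phi q i)) =
    coeff m (Phi q (τ.heis A q) i) :=
  map_coeff_Phi q _ (freeRep_genA A q p τ ρ e) i m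

theorem freeRep_psi (i : ι) (m : ℕ) : freeRep A q p τ ρ e (coeff m (psi q i)) =
    coeff m (Psi q (τ.heis A q) i) :=
  map_coeff_Psi q _ (freeRep_genA A q p τ ρ e) i m

theorem freeRep_polyMul (P : MvPolynomial (Fin 2) ℂ) (F : ℤ → ℤ → FreeAlgebra ℂ (Gen ι)) (a b : ℤ) :
    freeRep A q p τ ρ e (polyMul P F a b) =
      polyMul P (fun a b => freeRep A q p τ ρ e (F a b)) a b :=
  map_polyMul (freeRep A q p τ ρ e).toLinearMap P F a b

theorem freeRep_prodZW (ε ε' : ℤˣ) (i j : ι) :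
    (fun a b => freeRep A q p τ ρ e (prodZW (genX ε i) (genX ε' j) a b)) =
      prodZW (τ.vertex A q p ρ e ε i) (τ.vertex A q p ρ e ε' j) := by
  ext1 a; ext1 b
  simp only [prodZW, map_mul, freeRep_genX]

theorem freeRep_prodWZ (ε ε' : ℤˣ) (i j : ι) :
    (fun a b => freeRep A q p τ ρ e (prodWZ (genX ε i) (genX ε' j) a b)) =
      prodWZ (τ.vertex A q p ρ e ε i) (τ.vertex A q p ρ e ε' j) := by
  ext1 a; ext1 b
  simp only [prodWZ, map_mul, freeRep_genX]

theorem freeRep_comm (ε ε' : ℤˣ) (i j : ι) :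
    (fun a b => freeRep A q p τ ρ e (comm (genX ε i) (genX ε' j) a b)) =
      comm (τ.vertex A q p ρ e ε i) (τ.vertex A q p ρ e ε' j) := by
  rw [comm, comm, ← freeRep_prodZW, ← freeRep_prodWZ]
  ext1 a; ext1 b
  exact map_sub _ _ _

/-- The presentation uses coefficients of `G⁻¹` with a power of `γ`, the operator identity the
inverse of a rescaled `G`; the constant term is nonzero, so they agree. -/
theorem inv_rescale_G (hq0 : q ≠ 0) (r : ℤ) : (rescale q (G q r))⁻¹ = rescale q (G q r)⁻¹ := by
  have h : constantCoeff (G q r) ≠ 0 := by rw [G_eq_expSeries hq0]; simp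
  symm
  have h' : constantCoeff (rescale q (G q r)) ≠ 0 := by
    rwa [← coeff_zero_eq_constantCoeff_apply, coeff_rescale, pow_zero, one_mul,
      coeff_zero_eq_constantCoeff_apply]
  rw [PowerSeries.eq_inv_iff_mul_eq_one h', ← map_mul, PowerSeries.inv_mul_cancel _ h,
    map_one]

variable (hA : ∀ i j, A i j = A j i) (hA2 : ∀ i, A i i = 2)
  (hq0 : q ≠ 0) (hq : ∀ n : ℕ, 0 < n → q ^ n ≠ 1) (hp : p ^ 2 = q) (hp0 : p ≠ 0)
  (hcomm : ∀ i j, ρ (e i) * ρ (e j) = ((-1 : ℂ) ^ A i j) • (ρ (e j) * ρ (e i)))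

include hA hA2 hq0 hq hp hp0 hcomm in
-- With `c = 1` and `γ^{1/2} = p`, each relation specializes to an identity on `V_Q` proved above.
-- The normalization `a_i² = 1` enters only in the last one, where `c` replaces `a_i^{±2}`.
theorem freeRep_rel (hsq : ∀ i, ρ (e i ^ 2) = 1) {x y : FreeAlgebra ℂ (Gen ι)} (h : Rel A q x y) :
    freeRep A q p τ ρ e x = freeRep A q p τ ρ e y := by
  have hpq : ∀ k : ℤ, p ^ (2 * k) = q ^ k := fun k => by rw [zpow_mul, zpow_ofNat, hp]
  induction h with
  | c_central y =>
    rw [map_mul, map_mul, freeRep_gen, genImage, one_mul, mul_one]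
  | g_central y =>
    rw [map_mul, map_mul, freeRep_gen, genImage, smul_one_mul, mul_smul_one]
  | g_gi =>
    rw [map_mul, freeRep_gen, freeRep_gen, genImage, genImage, smul_mul_smul_comm,
      mul_inv_cancel₀ hp0, map_one, one_smul, one_mul]
  | gi_g =>
    rw [map_mul, freeRep_gen, freeRep_gen, genImage, genImage, smul_mul_smul_comm,
      inv_mul_cancel₀ hp0, map_one, one_smul, one_mul]
  | phi_phi i j m n =>
    rw [map_mul, map_mul, freeRep_phi, freeRep_phi]
    exact Phi_commute A q τ i j m n
  | psi_psi i j m n =>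
    rw [map_mul, map_mul, freeRep_psi, freeRep_psi]
    exact Psi_commute A q τ i j m n
  | phi_psi i j m n =>
    simp only [map_mul, map_sum, map_smul, freeRep_phi, freeRep_psi, freeRep_gam]
    rw [Phi_mul_Psi A q τ hA hq0 hq, inv_rescale_G q hq0]
    refine Finset.sum_congr rfl fun k _ => ?_
    rw [coeff_mul, Finset.sum_smul]
    refine Finset.sum_congr rfl fun l _ => ?_
    rw [coeff_rescale, coeff_rescale, smul_one_mul, smul_smul, hpq, zpow_sub₀ hq0, zpow_natCast,
      zpow_natCast, inv_pow]
    congr 1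
    ring
  | phi_x ε i j m b =>
    simp only [map_mul, map_sum, map_smul, freeRep_phi, freeRep_genX, freeRep_gam]
    rw [Phi_mul_vertex A q p τ ρ e hA hq0 hq]
    refine Finset.sum_congr rfl fun l _ => ?_
    rw [coeff_rescale, smul_one_mul, smul_mul_assoc, smul_mul_assoc, smul_smul, ← neg_mul, zpow_mul,
      zpow_natCast, mul_comm]
  | psi_x ε i j m b =>
    simp only [map_mul, map_sum, map_smul, freeRep_psi, freeRep_genX, freeRep_gam]
    rw [Psi_mul_vertex A q p τ ρ e hq0 hq]
    refine Finset.sum_congr rfl fun l _ => ?_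
    rw [coeff_rescale, smul_one_mul, smul_mul_assoc, smul_mul_assoc, smul_smul, ← neg_mul, zpow_mul,
      zpow_natCast, mul_comm]
  | x_x_zero ε ε' i j h a b =>
    rw [map_zero]
    refine (congrFun (congrFun (freeRep_comm A q p τ ρ e ε ε' i j) a) b).trans ?_
    rw [comm_vertex_eq_zero A q p τ ρ e hA hq0 hq hcomm ε ε' i j h]
    rfl
  | x_x_opp i j h a b =>
    rw [freeRep_polyMul, freeRep_comm, map_zero,
      qPow_mul_comm_vertex A q p τ ρ e hA hq0 hq hcomm hp0 i j h]
    rfl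
  | x_x_diag i a b =>
    refine (congrFun (congrFun (freeRep_comm A q p τ ρ e 1 (-1) i i) a) b).trans ?_
    rw [comm_vertex_diag A q p τ ρ e hA hq0 hq hp hp0 i (hA2 i)]
    simp only [map_mul, map_sub, map_smul, freeRep_gam,
      map_PsiD q (freeRep A q p τ ρ e) (freeRep_genA A q p τ ρ e),
      map_PhiD q (freeRep A q p τ ρ e) (freeRep_genA A q p τ ρ e)]
    change (2 * (q + q⁻¹) / (q - q⁻¹)) • (q ^ b • p⁻¹ ^ (a + b) • PsiD q (τ.heis A q) i (a + b) -
      q⁻¹ ^ b • p ^ (a + b) • PhiD q (τ.heis A q) i (a + b)) = _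
    -- The powers of `q` from `δ` and of `q^{1/2}` from the dilation combine into one power of
    -- `γ^{1/2}`.
    have e1 : q ^ b * p⁻¹ ^ (a + b) = p ^ (-(a + b) + 2 * b) := by
      rw [zpow_add₀ hp0, hpq, zpow_neg, inv_zpow, mul_comm]
    have e2 : q⁻¹ ^ b * p ^ (a + b) = p ^ ((a + b) - 2 * b) := by
      rw [zpow_sub₀ hp0, hpq, inv_zpow, div_eq_mul_inv, mul_comm]
    rw [smul_one_mul, smul_one_mul, smul_smul, smul_smul, e1, e2]
  | x_x_same ε i j h a b =>
    rw [freeRep_polyMul, freeRep_polyMul, freeRep_prodZW, freeRep_prodWZ,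
      polyMul_vertex_same A q p τ ρ e hA hq0 hq hcomm hp ε i j h]
  | x_x_self ε i a b =>
    have hε : ρ (e i ^ (2 * (ε : ℤ))) = 1 := by
      rcases Int.units_eq_one_or ε with rfl | rfl
      · have := hsq i
        rwa [← zpow_natCast] at this
      · have h1 : ρ (e i ^ (2 * ((-1 : ℤˣ) : ℤ))) * ρ (e i ^ 2) = 1 := by
          rw [← map_mul, ← zpow_natCast, ← zpow_add]; simp
        rwa [hsq, mul_one] at h1
    have hd : (fun a b => freeRep A q p τ ρ e (deltaNeg (gen Gen.c) a b)) =
        deltaNeg (τ.act (ρ (e i ^ (2 * (ε : ℤ)))) 1) := by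
      ext1 a; ext1 b
      rw [hε, τ.act_one, deltaNeg, deltaNeg]
      split_ifs
      · rw [map_smul, freeRep_gen, genImage]
      · rw [map_zero]
    rw [map_add, freeRep_polyMul, freeRep_polyMul, freeRep_polyMul, freeRep_prodZW, freeRep_prodWZ,
      hd, polyMul_vertex_self A q p τ ρ e hA hq0 hq hp ε i (hA2 i)]
    rfl

include hA hA2 hq0 hq hp hp0 hcomm in
theorem exists_loopAlgebra_rep (hsq : ∀ i, ρ (e i ^ 2) = 1) :
    ∃ θ : LoopAlgebra A q →ₐ[ℂ] S,
      θ (LoopAlgebra.of A q Gen.c) = 1 ∧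
      θ (LoopAlgebra.of A q Gen.g) = p • 1 ∧
      (∀ i (m : {m : ℤ // Odd m}), θ (LoopAlgebra.of A q (Gen.a i m)) = τ.heis A q i m) ∧
      ∀ ε i n, θ (LoopAlgebra.of A q (Gen.x ε i n)) = τ.vertex A q p ρ e ε i (-n) := by
  let θ : LoopAlgebra A q →ₐ[ℂ] S := RingQuot.liftAlgHom ℂ ⟨freeRep A q p τ ρ e, fun _ _ h =>
    freeRep_rel A q p τ ρ e hA hA2 hq0 hq hp hp0 hcomm hsq h⟩
  have hθ : ∀ y, θ (LoopAlgebra.of A q y) = genImage A q p τ ρ e y := fun y =>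
    (RingQuot.liftAlgHom_mkAlgHom_apply _ _ _ _).trans (freeRep_gen A q p τ ρ e y)
  exact ⟨θ, hθ _, hθ _, fun i m => hθ _, fun ε i n => hθ _⟩

end LoopAlgebra

end TwistedLoop

end

open TwistedLoop in
theorem theoremP
    -- a finitely generated lattice with generators of square length two
    {ι : Type*} [Finite ι] {Q : Type*} [AddCommGroup Q] (B : LinearMap.BilinForm ℤ Q)
    (hB : B.IsSymm) (α : ι → Q) (hα : Submodule.span ℤ (Set.range α) = ⊤)
    (hB2 : ∀ i, B (α i) (α i) = 2)
    -- its Gram matrix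
    (A : ι → ι → ℤ) (hA : ∀ i j, A i j = B (α i) (α j))
    -- a generic complex number `q` with a square root `p`
    (q p : ℂ) (hq0 : q ≠ 0) (hq : ∀ n : ℕ, 0 < n → q ^ n ≠ 1) (hp : p ^ 2 = q)
    -- a central extension of the lattice by the finite cyclic group generated by `κ`
    {E : Type*} [Group E] (κ : E) (hκ : κ ∈ Subgroup.center E) (hκfin : IsOfFinOrder κ)
    (π : E →* Multiplicative Q) (hπ : Function.Surjective π) (hker : π.ker = Subgroup.zpowers κ)
    (e : ι → E) (he : ∀ i, π (e i) = Multiplicative.ofAdd (α i))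
    -- a module on which `κ` acts as a primitive root of unity
    {T : Type*} [AddCommGroup T] [Module ℂ T] (ρ : Representation ℂ E T)
    (ω : ℂ) (hω : IsPrimitiveRoot ω (orderOf κ)) (hρκ : ρ κ = ω • LinearMap.id)
    (hcomm : ∀ i j, ρ (e i) * ρ (e j) = ((-1 : ℂ) ^ A i j) • (ρ (e j) * ρ (e i))) :
    -- `[Φ_i(z), Φ_j(w)] = [Ψ_i(z), Ψ_j(w)] = 0`
    (∀ i j, ∀ m n : ℕ,
      Commute (PowerSeries.coeff m (Phi q (heisV A q T) i))
        (PowerSeries.coeff n (Phi q (heisV A q T) j)) ∧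
      Commute (PowerSeries.coeff m (Psi q (heisV A q T) i))
        (PowerSeries.coeff n (Psi q (heisV A q T) j))) ∧
    -- `Φ_i(z) Ψ_j(w) = Ψ_j(w) Φ_i(z) G_{ij}(q⁻¹ z/w) / G_{ij}(q z/w)`
    (∀ i j, ∀ m n : ℕ,
      PowerSeries.coeff m (Phi q (heisV A q T) i) * PowerSeries.coeff n (Psi q (heisV A q T) j) =
        ∑ k ∈ Finset.range (min m n + 1),
          PowerSeries.coeff k (PowerSeries.rescale q⁻¹ (G q (A i j)) *
            (PowerSeries.rescale q (G q (A i j)))⁻¹) •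
          (PowerSeries.coeff (n - k) (Psi q (heisV A q T) j) *
            PowerSeries.coeff (m - k) (Phi q (heisV A q T) i))) ∧
    -- `Φ_i(z) X_j^ε(w) Φ_i(z)⁻¹ = X_j^ε(w) G_{ij}(q^{-ε/2} z/w)^ε`, at each power `w^b`
    (∀ (ε : ℤˣ) (i j : ι) (b : ℤ), IsUnit (Phi q (heisV A q T) i) ∧
      Phi q (heisV A q T) i * PowerSeries.C (vertex A q p ρ e ε j b) *
          Ring.inverse (Phi q (heisV A q T) i) =
        PowerSeries.mk fun k =>
          PowerSeries.coeff k (PowerSeries.rescale (p ^ (-(ε : ℤ))) (Gpow q (A i j) ε)) •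
            vertex A q p ρ e ε j (b + k)) ∧
    -- `Ψ_i(z) X_j^ε(w) Ψ_i(z)⁻¹ = X_j^ε(w) G_{ij}(q^{-ε/2} w/z)^{-ε}`, at each power `w^b`
    (∀ (ε : ℤˣ) (i j : ι) (b : ℤ), IsUnit (Psi q (heisV A q T) i) ∧
      Psi q (heisV A q T) i * PowerSeries.C (vertex A q p ρ e ε j b) *
          Ring.inverse (Psi q (heisV A q T) i) =
        PowerSeries.mk fun k =>
          PowerSeries.coeff k (PowerSeries.rescale (p ^ (-(ε : ℤ))) (Gpow q (A i j) (-ε))) •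
            vertex A q p ρ e ε j (b - k)) ∧
    -- `[X_i^ε(z), X_j^ε'(w)] = 0` if `(α_i|α_j) = 0`
    (∀ (ε ε' : ℤˣ) (i j : ι), A i j = 0 →
      comm (vertex A q p ρ e ε i) (vertex A q p ρ e ε' j) = 0) ∧
    -- `(z + w)_{q²}^{-(α_i|α_j)} [X_i^+(z), X_j^-(w)] = 0` if `(α_i|α_j) < 0`
    (∀ i j : ι, A i j < 0 →
      polyMul (qPow q (-A i j).toNat Z (-W))
        (comm (vertex A q p ρ e 1 i) (vertex A q p ρ e (-1) j)) = 0) ∧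
    -- `[X_i^+(z), X_i^-(w)] = 2(q+q⁻¹)/(q-q⁻¹)
    --   (Ψ_i(q^{-1/2} z) δ(q w/z) - Φ_i(q^{1/2} z) δ(q⁻¹ w/z))`
    (∀ i : ι, comm (vertex A q p ρ e 1 i) (vertex A q p ρ e (-1) i) =
      (2 * (q + q⁻¹) / (q - q⁻¹)) •
        (deltaMul q (dilate p⁻¹ (PsiD q (heisV A q T) i)) -
          deltaMul q⁻¹ (dilate p (PhiD q (heisV A q T) i)))) ∧
    -- `(z-w)_{q²}^{-r-1} (z - q^{εr} w)(z + q^{-εr} w) X_i^ε(z) X_j^ε(w)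
    --   = (z-w)_{q²}^{-r-1} (q^{εr} z - w)(q^{-εr} z + w) X_j^ε(w) X_i^ε(z)`, `r = (α_i|α_j) < 0`
    (∀ (ε : ℤˣ) (i j : ι), A i j < 0 →
      polyMul (qPow q (-A i j - 1).toNat Z W * (Z - K (q ^ ((ε : ℤ) * A i j)) * W) *
          (Z + K (q ^ (-((ε : ℤ) * A i j))) * W))
        (prodZW (vertex A q p ρ e ε i) (vertex A q p ρ e ε j)) =
      polyMul (qPow q (-A i j - 1).toNat Z W * (K (q ^ ((ε : ℤ) * A i j)) * Z - W) *
          (K (q ^ (-((ε : ℤ) * A i j))) * Z + W))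
        (prodWZ (vertex A q p ρ e ε i) (vertex A q p ρ e ε j))) ∧
    -- `(z - q^{2ε} w)(z + q^{-2ε} w) X_i^ε(z) X_i^ε(w)
    --   = (q^{2ε} z - w)(q^{-2ε} z + w) X_i^ε(w) X_i^ε(z) + 2 (q+q⁻¹)² z² δ(-w/z) a_i^{2ε}`
    (∀ (ε : ℤˣ) (i : ι),
      polyMul ((Z - K (q ^ (2 * (ε : ℤ))) * W) * (Z + K (q ^ (-(2 * (ε : ℤ)))) * W))
        (prodZW (vertex A q p ρ e ε i) (vertex A q p ρ e ε i)) =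
      polyMul ((K (q ^ (2 * (ε : ℤ))) * Z - W) * (K (q ^ (-(2 * (ε : ℤ)))) * Z + W))
          (prodWZ (vertex A q p ρ e ε i) (vertex A q p ρ e ε i)) +
        polyMul (K (2 * (q + q⁻¹) ^ 2) * Z ^ 2) (deltaNeg (groupV ρ (e i ^ (2 * (ε : ℤ)))))) ∧
    -- if the `a_i²` act as the identity on `T`, then the operators define a level one
    -- representation of the twisted quantum loop algebra
    ((∀ i, ρ (e i ^ 2) = 1) →
      ∃ θ : LoopAlgebra A q →ₐ[ℂ] Module.End ℂ (Fock ι ⊗[ℂ] T),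
        θ (LoopAlgebra.of A q Gen.c) = 1 ∧
        θ (LoopAlgebra.of A q Gen.g) = p • 1 ∧
        (∀ i (m : {m : ℤ // Odd m}), θ (LoopAlgebra.of A q (Gen.a i m)) = heisV A q T i m) ∧
        ∀ ε i n, θ (LoopAlgebra.of A q (Gen.x ε i n)) = vertex A q p ρ e ε i (-n)) := by
  have hsymm : ∀ i j, A i j = A j i := fun i j => by
    rw [hA, hA]; exact hB.eq (α i) (α j)
  have hA2 : ∀ i, A i i = 2 := fun i => (hA i i).trans (hB2 i)
  have hp0 : p ≠ 0 := by rintro rfl; exact hq0 (by rw [← hp]; simp)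
  have hh : heisV A q T = (tensorAction ι T).heis A q := rfl
  have hv : vertex A q p ρ e = (tensorAction ι T).vertex A q p ρ e := rfl
  have hg : ∀ x, groupV ρ x = (tensorAction ι T).act (ρ x) 1 := fun _ => rfl
  simp only [hh, hv, hg]
  -- From here only the multiplicativity, the unit and the linearity of `f ⊗ g` matter.
  generalize tensorAction ι T = τ
  refine ⟨fun i j m n => ⟨Phi_commute A q τ i j m n, Psi_commute A q τ i j m n⟩,
    Phi_mul_Psi A q τ hsymm hq0 hq,
    fun ε i j b => ⟨isUnit_Phi τ A q i, conj_eq_of_coeff (isUnit_Phi τ A q i) fun m =>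
      Phi_mul_vertex A q p τ ρ e hsymm hq0 hq ε i j m b⟩,
    fun ε i j b => ⟨isUnit_Psi τ A q i, conj_eq_of_coeff (isUnit_Psi τ A q i) fun m =>
      Psi_mul_vertex A q p τ ρ e hq0 hq ε i j m b⟩,
    comm_vertex_eq_zero A q p τ ρ e hsymm hq0 hq hcomm,
    qPow_mul_comm_vertex A q p τ ρ e hsymm hq0 hq hcomm hp0,
    fun i => comm_vertex_diag A q p τ ρ e hsymm hq0 hq hp hp0 i (hA2 i),
    polyMul_vertex_same A q p τ ρ e hsymm hq0 hq hcomm hp,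
    fun ε i => polyMul_vertex_self A q p τ ρ e hsymm hq0 hq hp ε i (hA2 i),
    exists_loopAlgebra_rep A q p τ ρ e hsymm hA2 hq0 hq hp hp0 hcomm⟩
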